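/- **Setting.** A parity game with $n\ge 1$ vertices and $c$ priorities is a finite directed graph $(V,E)$, $|V|=n$, in which every vertex has an outgoing edge, with a partition $V=V_{\mathcal E}\cup V_{\mathcal O}$ and a priority function $\alpha:V\to\{0,\dots,c-1\}$; $P_i=\{v:\alpha(v)=i\}$, and we assume $P_i\neq\emptyset$ for $0<i<c$. A player moves the token at his vertices by a memoryless strategy; player $\mathcal E$ (resp. $\mathcal O$) wins a play if the highest priority occurring infinitely often is even (resp. odd). The winning set $W_z$ of player $z$ is the set of the vertices from which $z$ has a strategy that wins against every strategy of the opponent. A *set-based symbolic algorithm* stores sets of vertices (initially $V$, $V_{\mathcal E}$, $V_{\mathcal O}$, $P_0,\dots,P_{c-1}$) and accesses the game only through the basic set operations $\cup,\cap,\setminus,\subseteq$ and the one-step operations $\mathrm{Pre}(B)=\{v:\exists u\in B,\ (v,u)\in E\}$ and $\mathrm{CPre}_z(B)$, the set of the vertices from which $z$ can ensure that the next vertex is in $B$. The numbers $n$, $c$, $|P_0|,\dots,|P_{c-1}|$ are given. The *symbolic dominion search* for player $\mathcal E$ and a parameter $h$ in a (sub)game with $c$ priorities maintains a rank for each vertex.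 Ranks are $\top$ and the vectors $(r_0,\dots,r_{c-1})$ with $r_i=0$ for even $i$, $0\le r_i\le |P_i|$ for odd $i$ (with $P_i$ the set in the input game), and $\sum_i r_i\le h$, ordered lexicographically with the highest index most significant and $\top$ as the maximum. It raises ranks, processing one rank at a time by means of the sets of vertices of rank at least $r$, until they form the least simultaneous fixed point of the lift operators of the progress measure with this co-domain, and returns the set of vertices with rank below $\top$. It does not store one set for each rank, but the sets of the vertices whose rank has the entry $x$ at the odd index $i$, and the set of the vertices with rank $\top$. For player $\mathcal O$ the roles of the players are exchanged and all priorities are increased by one. The *symbolic Big-Step algorithm* with parameter function $h(n,c_0,c)\in[1,n]$, where $n$ and $c_0$ belong to the input game, solves a (sub)game $\mathcal G$ with $c$ priorities as follows. If $c=1$, player $\mathcal E$ wins everywhere. If $c\in\{2,3\}$, the dominion search for $\mathcal E$ with parameter $n$ returns $W_{\mathcal E}$, and $W_{\mathcal O}$ is the complement. If $c\ge 4$, let $z$ be $\mathcal E$ for odd $c$ and $\mathcal O$ for even $c$, and let $\bar z$ be the opponent. Repeat: run the dominion search for $\bar z$ with parameter $h(n,c_0,c)$ in $\mathcal G$, add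 the $\bar z$-attractor of the result to $W_{\bar z}$ and remove it from $\mathcal G$; then solve recursively the game with $c-1$ priorities that results from $\mathcal G$ by removing the $z$-attractor of the vertices with priority $c-1$, add the $\bar z$-attractor of the winning set $W'_{\bar z}$ of $\bar z$ in this game to $W_{\bar z}$ and remove it from $\mathcal G$; stop when $W'_{\bar z}=\emptyset$. All vertices that are not in $W_{\bar z}$ form $W_z$. **Theorem.** Let $\gamma(c)=\frac c3+\frac12-\frac4{c^2-1}$ for odd $c$ and $\gamma(c)=\frac c3+\frac12-\frac1{3c}-\frac4{c^2}$ for even $c$. There are a parameter function $h$ and constants $\kappa>0$, $K$, $C$, $S$ such that, for every parity game with $n\ge1$ vertices and $c$ priorities with $P_i\ne\emptyset$ for $0<i<c$, the symbolic Big-Step algorithm with parameter function $h$ halts, computes the winning sets $W_{\mathcal E}$ and $W_{\mathcal O}$, stores at most $S\cdot n$ sets, and, if $c\ge3$, uses at most $$\min\Big\{K\cdot n\cdot\Big(\frac{\kappa\, n}{c}\Big)^{\gamma(c)},\ n^{C\sqrt n}\Big\}$$ symbolic one-step operations; if $c\le 2$ and $n\ge2$, it uses at most $n^{C\sqrt n}$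 symbolic one-step operations. -/

import Mathlib

/-! ## Parity games -/

/-- The two players. -/
inductive Player
  | even
  | odd
  deriving DecidableEq

/-- The opponent of a player. -/
def Player.opp : Player → Player
  | .even => .odd
  | .odd => .even

/-- A parity game with priorities `0, …, c - 1` on the vertex set `V`; every vertex has at least
one outgoing edge. -/
structure ParityGame (V : Type*) (c : ℕ) where
  /-- The edge relation. -/
  edge : V → V → Prop
  /-- The player that moves at a vertex. -/
  owner : V → Player
  /-- The priority of a vertex. -/
  prio : V → Fin c
  /-- Every vertex has a successor. -/
  exists_edge : ∀ v, ∃ w, edge v w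

namespace ParityGame

variable {V : Type*} {c : ℕ} (G : ParityGame V c)

/-- The vertices with priority `i` (empty for `i ≥ c`). -/
def prioSet (i : ℕ) : Set V := {v | (G.prio v : ℕ) = i}

/-- A memoryless strategy of player `z` (its values outside of the vertices of `z` are
irrelevant). -/
def IsStrategy (z : Player) (f : V → V) : Prop := ∀ v, G.owner v = z → G.edge v (f v)

/-- The play that starts at `v` when even moves according to `f` and odd according to `g`. -/
def play (f g : V → V) (v : V) : ℕ → V
  | 0 => v
  | k + 1 =>
    match G.owner (play f g v k) with
    | .even => f (play f g v k)
    | .odd => g (play f g v k)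

/-- The highest priority that occurs infinitely often in `ρ` is `p`. -/
def IsLimsupPriority (ρ : ℕ → V) (p : ℕ) : Prop :=
  IsGreatest {i : ℕ | ∃ᶠ k in Filter.atTop, (G.prio (ρ k) : ℕ) = i} p

/-- Player `z` wins the play `ρ`. -/
def Wins (z : Player) (ρ : ℕ → V) : Prop :=
  match z with
  | .even => ∃ p, G.IsLimsupPriority ρ p ∧ Even p
  | .odd => ∃ p, G.IsLimsupPriority ρ p ∧ Odd p

/-- The winning set of a player: the start vertices from which the player has a strategy that
wins against every strategy of the opponent. -/
def winningSet : Player → Set V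
  | .even => {v | ∃ f, G.IsStrategy .even f ∧
      ∀ g, G.IsStrategy .odd g → G.Wins .even (G.play f g v)}
  | .odd => {v | ∃ g, G.IsStrategy .odd g ∧
      ∀ f, G.IsStrategy .even f → G.Wins .odd (G.play f g v)}

/-- The one-step predecessor operator. -/
def pre (B : Set V) : Set V := {v | ∃ u ∈ B, G.edge v u}

/-- The one-step controllable predecessor operator of player `z`. -/
def cpre (z : Player) (B : Set V) : Set V :=
  {v | G.owner v = z ∧ ∃ u ∈ B, G.edge v u} ∪ {v | G.owner v = z.opp ∧ ∀ u, G.edge v u → u ∈ B}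

end ParityGame

/-! ## Set-based symbolic programs

A program manipulates finitely many sets of vertices, stored in registers with names in `R`.
It has no other access to the game than the instructions and the inclusion test below; the control
(the type `α` of returned values) contains no vertices. -/

/-- The basic set operations and the two one-step operations; `d` is the target register. -/
inductive Instr (R : Type)
  | union (d a b : R)
  | inter (d a b : R)
  | diff (d a b : R)
  | pre (d a : R)
  | cpre (z : Player) (d a : R)

namespace Instr

variable {R : Type}

/-- The target register. -/
def target : Instr R → R
  | union d _ _ => d
  | inter d _ _ => d
  | diff d _ _ => d
  | pre d _ => d
  | cpre _ d _ => d

/-- The set that is written to the target register. -/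
def value {V : Type*} {c : ℕ} (G : ParityGame V c) (m : R → Set V) : Instr R → Set V
  | union _ a b => m a ∪ m b
  | inter _ a b => m a ∩ m b
  | diff _ a b => m a \ m b
  | pre _ a => G.pre (m a)
  | cpre z _ a => G.cpre z (m a)

/-- All registers that occur in an instruction lie in `U`. -/
def UsesOnly (U : Finset R) : Instr R → Prop
  | union d a b => d ∈ U ∧ a ∈ U ∧ b ∈ U
  | inter d a b => d ∈ U ∧ a ∈ U ∧ b ∈ U
  | diff d a b => d ∈ U ∧ a ∈ U ∧ b ∈ U
  | pre d a => d ∈ U ∧ a ∈ U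
  | cpre _ d a => d ∈ U ∧ a ∈ U

/-- The number of one-step operations: `1` for the predecessor operators, `0` for set
operations. -/
def oneSteps : Instr R → ℕ
  | pre _ _ => 1
  | cpre _ _ _ => 1
  | _ => 0

end Instr

/-- Set-based symbolic programs over the registers `R` that return a control value in `α`. -/
inductive Prog (R : Type) : Type → Type 1
  /-- Stop and return `a`. -/
  | ret {α : Type} (a : α) : Prog R α
  /-- Sequential composition. -/
  | andThen {α β : Type} (p : Prog R α) (q : α → Prog R β) : Prog R β
  /-- Execute an instruction. -/
  | instr (i : Instr R) : Prog R Unit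
  /-- Test whether the set in `a` is contained in the set in `b`. -/
  | subset (a b : R) : Prog R Bool
  /-- Execute `body s`; on the result `.inl s'` repeat the loop with `s'`, on the result `.inr a`
  leave it with `a`. -/
  | loop {σ α : Type} (body : σ → Prog R (σ ⊕ α)) (s : σ) : Prog R α

namespace Prog

instance (R : Type) : Monad (Prog R) where
  pure a := ret a
  bind p q := andThen p q

variable {R : Type}

/-- The execution of a loop whose body has the execution relation `B`. -/
inductive LoopRun {M σ α : Type*} (B : σ → M → σ ⊕ α → M → ℕ → Prop) :
    σ → M → α → M → ℕ → Prop
  | leave {s : σ} {m m' : M} {a : α} {t : ℕ} (h : B s m (.inr a) m' t) : LoopRun B s m a m' t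
  | again {s s' : σ} {m m' m'' : M} {a : α} {t t' : ℕ} (h : B s m (.inl s') m' t)
      (h' : LoopRun B s' m' a m'' t') : LoopRun B s m a m'' (t + t')

/-- `Run G U p m a m' t`: on the game `G`, the program `p`, started with the register contents `m`,
halts with control value `a` and register contents `m'` after exactly `t` one-step operations, and
it uses only registers in `U`. -/
def Run {V : Type*} {c : ℕ} (G : ParityGame V c) (U : Finset R) :
    {α : Type} → Prog R α → (R → Set V) → α → (R → Set V) → ℕ → Prop
  | _, ret a, m, a', m', t => a' = a ∧ m' = m ∧ t = 0
  | _, andThen p q, m, b, m'', t => ∃ a m' t₁ t₂,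
      Run G U p m a m' t₁ ∧ Run G U (q a) m' b m'' t₂ ∧ t = t₁ + t₂
  | _, instr i, m, _, m', t =>
      i.UsesOnly U ∧ (∀ r, (r = i.target → m' r = i.value G m) ∧ (r ≠ i.target → m' r = m r)) ∧
        t = i.oneSteps
  | _, subset x y, m, a, m', t => x ∈ U ∧ y ∈ U ∧ (a = true ↔ m x ⊆ m y) ∧ m' = m ∧ t = 0
  | _, loop body s, m, a, m', t => LoopRun (fun s => Run G U (body s)) s m a m' t

/-- Execute `body x` for the elements `x` of a list, in order. -/
def forEach {β : Type} (l : List β) (body : β → Prog R Unit) : Prog R Unit :=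
  match l with
  | [] => ret ()
  | x :: l => andThen (body x) fun _ => forEach l body

/-- Repeat `body` until it returns `true`. -/
def repeatUntil (body : Prog R Bool) : Prog R Unit :=
  loop (fun _ : Unit => do
    let fixed ← body
    return if fixed then .inr () else .inl ()) ()

/-- `d := a ∪ b`. -/
def union (d a b : R) : Prog R Unit := instr (.union d a b)
/-- `d := a ∩ b`. -/
def inter (d a b : R) : Prog R Unit := instr (.inter d a b)
/-- `d := a \ b`. -/
def diff (d a b : R) : Prog R Unit := instr (.diff d a b)
/-- `d := Pre(a)`. -/
def pre (d a : R) : Prog R Unit := instr (.pre d a)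
/-- `d := a`. -/
def copy (d a : R) : Prog R Unit := union d a a
/-- `d := ∅`. -/
def clear (d : R) : Prog R Unit := diff d d d

end Prog

/-! ## Ranks -/

/-- The rank vectors with indices `0, …, c - 1`, in the lexicographic order in which the entry with
the largest index is the most significant one. -/
abbrev Rank (c : ℕ) : Type := Colex (Fin c → ℕ)

namespace Rank

variable {c : ℕ}

/-- The zero vector. -/
def zero : Rank c := toColex fun _ => 0

/-- Set the entries with index less than `l` to `0`. -/
def proj (l : ℕ) (x : Rank c) : Rank c := toColex fun i => if (i : ℕ) < l then 0 else x i

/-- The rank vectors `x` with `x i ≤ N i` for all `i` whose entries sum up to at most `h`. The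
co-domain of the ranking functions consists of these vectors and the top element. -/
def domain (N : Fin c → ℕ) (h : ℕ) : Finset (Rank c) :=
  ((Fintype.piFinset fun i => Finset.range (N i + 1)).filter fun x => ∑ i, x i ≤ h).map
    toColex.toEmbedding

open Classical in
/-- The smallest element of the co-domain that is larger than `x` with respect to the indices
`≥ l`; it is `⊤` if no vector in `M` is. -/
noncomputable def incrAt (M : Finset (Rank c)) (l : ℕ) (x : Rank c) : WithTop (Rank c) :=
  (M.filter fun y => proj l x < proj l y).min

open Classical in
/-- The partial inverse of `incrAt M l`: the smallest vector `y` with `incrAt M l y = r`, or the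
zero vector if all the entries of `r` with index `≥ l` are zero. -/
noncomputable def decrAt (M : Finset (Rank c)) (l : ℕ) (r : WithTop (Rank c)) : WithTop (Rank c) :=
  if r.map (proj l) = ((zero : Rank c) : WithTop (Rank c)) then ((zero : Rank c) : WithTop (Rank c))
  else (M.filter fun y => incrAt M l y = r).min

/-- The successor in the co-domain. -/
noncomputable def incr (M : Finset (Rank c)) : WithTop (Rank c) → WithTop (Rank c)
  | ⊤ => ⊤
  | (x : Rank c) => incrAt M 0 x

/-- The predecessor in the co-domain. -/
noncomputable def decr (M : Finset (Rank c)) (r : WithTop (Rank c)) : WithTop (Rank c) :=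
  decrAt M 0 r

open Classical in
/-- For a vector, the maximal index `l` such that all entries with index less than `l` are zero;
for the top element, the number of indices (so that there every priority is admitted). -/
noncomputable def level : WithTop (Rank c) → ℕ
  | ⊤ => c
  | (x : Rank c) => ((Finset.range c).filter fun l => proj l x = x).sup id

end Rank

/-! ## The symbolic Big-Step algorithm -/

/-- The names of the sets that the Big-Step algorithm stores. -/
inductive Reg
  /-- Input: all vertices. -/
  | vert
  /-- Input: the vertices of player `z`. -/
  | own (z : Player)
  /-- Input: the vertices with priority `i`. -/
  | prio (i : ℕ)
  /-- The vertices of the game that the call for `c` priorities has to solve. -/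
  | all (c : ℕ)
  /-- The game that is maintained by the call for `c` priorities. -/
  | game (c : ℕ)
  /-- The winning set of player `z` that is computed by the call for `c` priorities. -/
  | win (z : Player) (c : ℕ)
  /-- The vertices whose rank is a vector with entry `x` at the odd index `j`. -/
  | coord (j x : ℕ)
  /-- The vertices with rank `⊤`. -/
  | top
  /-- The set of vertices with rank at least `r`, for the rank `r` that is processed. -/
  | cur
  /-- The value of `cur` at the beginning of the iteration. -/
  | old
  /-- The set of vertices with rank at least `r'`, for another rank `r'`. -/
  | cmp
  /-- The vertices whose rank agrees with `r` on the indices treated so far. -/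
  | agree
  /-- The result of a controllable predecessor operator. -/
  | step
  /-- Auxiliary set for the controllable predecessor operator. -/
  | esc
  /-- Auxiliary set. -/
  | aux
  /-- The result of an attractor computation. -/
  | att
  /-- The result of a dominion search. -/
  | dom
  deriving DecidableEq

/-- The register contents in the beginning: the input registers hold the description of the game,
all other registers are empty. -/
def ParityGame.input {V : Type*} {c : ℕ} (G : ParityGame V c) : Reg → Set V
  | .vert => Set.univ
  | .own z => {v | G.owner v = z}
  | .prio i => G.prioSet i
  | _ => ∅

namespace BigStep

open Prog Reg

/-- `d :=` the controllable predecessors for player `z` of the set in `b` in the subgame that is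
induced by the set in `X`, computed as
`(X ∩ Pre(b)) \ (V_opp ∩ Pre(X \ b))`. -/
def cpreIn (z : Player) (X d b : Reg) : Prog Reg Unit := do
  diff esc X b
  pre esc esc
  inter esc esc (own z.opp)
  pre d b
  inter d d X
  diff d d esc

/-- `att :=` the attractor of player `z` to the set in `U` in the subgame induced by `X`. -/
def attractor (z : Player) (X U : Reg) : Prog Reg Unit := do
  inter att U X
  repeatUntil do
    cpreIn z X step att
    let fixed ← subset step att
    union att att step
    return fixed

/-- To search for dominions of player odd the roles of the players are exchanged and each priority
is increased by one; for player even nothing is changed. -/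
def shift : Player → ℕ
  | .even => 0
  | .odd => 1

/-- The bounds for the entries of the rank vectors: for odd indices the number of vertices with this
(shifted) priority, for even indices `0`. -/
def bounds (y : Player) (size : ℕ → ℕ) (c : ℕ) : Fin (c + shift y) → ℕ := fun j =>
  if Odd (j : ℕ) then size (j - shift y) else 0

/-- The odd indices below `c`, in increasing order. -/
def oddIndices (c : ℕ) : List (Fin c) := (List.finRange c).filter fun j => Odd (j : ℕ)

/-- Initially, all vertices of the game in `X` have the zero vector as their rank. -/
def initRanks {c : ℕ} (N : Fin c → ℕ) (X : Reg) : Prog Reg Unit := do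
  forEach (oddIndices c) fun j => do
    forEach (List.range (N j + 1)) fun x => clear (coord j x)
    copy (coord j 0) X
  clear top

/-- `d :=` the set of vertices (of the game in `X`) with rank at least `r`. -/
def loadRank {c : ℕ} (N : Fin c → ℕ) (X d : Reg) : WithTop (Rank c) → Prog Reg Unit
  | ⊤ => copy d top
  | (r : Rank c) => do
    copy d top
    copy agree X
    forEach (oddIndices c).reverse fun j => do
      forEach ((List.range (N j + 1)).filter fun x => r j < x) fun x => do
        inter aux agree (coord j x)
        union d d aux
      inter agree agree (coord j (r j))
    union d d agree

/-- Give the rank `r` to all vertices in `cur \ old`. -/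
def saveRank {c : ℕ} (N : Fin c → ℕ) (r : WithTop (Rank c)) : Prog Reg Unit := do
  diff aux cur old
  forEach (oddIndices c) fun j =>
    forEach (List.range (N j + 1)) fun x => diff (coord j x) (coord j x) aux
  match r with
  | ⊤ => union top top aux
  | (r : Rank c) => forEach (oddIndices c) fun j => union (coord j (r j)) (coord j (r j)) aux

/-- `cur :=` the updated set of vertices with rank at least `r`, where `M` is the set of rank
vectors. -/
noncomputable def updateRank (y : Player) {c : ℕ} (N : Fin c → ℕ) (M : Finset (Rank c)) (X : Reg)
    (r : WithTop (Rank c)) : Prog Reg Unit := do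
  loadRank N X cur r
  copy old cur
  forEach ((oddIndices c).filter fun j => (j : ℕ) ≤ Rank.level r) fun j => do
    loadRank N X cmp (Rank.decrAt M j r)
    cpreIn y.opp X step cmp
    inter step step (prio (j - shift y))
    union cur cur step
  repeatUntil do
    cpreIn y.opp X step cur
    forEach ((List.range c).filter fun k => Rank.level r < k) fun k =>
      diff step step (prio (k - shift y))
    let fixed ← subset step cur
    union cur cur step
    return fixed

/-- The symbolic progress measure algorithm: `dom :=` a set that is empty or a dominion of player
`y`, and that contains all dominions of player `y` with at most `h + 1` vertices, in the subgame
induced by `X` with the priorities `0, …, c - 1`. -/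
noncomputable def dominion (size : ℕ → ℕ) (y : Player) (c h : ℕ) (X : Reg) : Prog Reg Unit := do
  let N := bounds y size c
  let M := Rank.domain N h
  initRanks N X
  loop (fun r : WithTop (Rank (c + shift y)) => do
    updateRank y N M X r
    loadRank N X cmp (Rank.decr M r)
    let closed ← subset cur cmp
    if closed then
      saveRank N r
      return if r = ⊤ then .inr () else .inl (Rank.incr M r)
    else
      let r' ← loop (fun r' : WithTop (Rank (c + shift y)) => do
        let r'' := Rank.decr M r'
        loadRank N X cmp r''
        let closed' ← subset cur cmp
        return if closed' then .inr r'' else .inl r'') (Rank.decr M r)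
      saveRank N r
      return .inl (Rank.incr M r')) (Rank.incr M (Rank.zero : Rank (c + shift y)))
  diff dom X top

/-- The player who wins if the priority `c - 1` occurs infinitely often. -/
def topPlayer (c : ℕ) : Player := if Odd c then .even else .odd

/-- One iteration of the main loop for `c` priorities; it returns whether the winning set of player
`y` in the recursive call `rec` for `c - 1` priorities is empty. -/
noncomputable def iteration (size : ℕ → ℕ) (h c : ℕ) (rec : Prog Reg Unit) :
    Prog Reg Bool := do
  let z := topPlayer c
  let y := z.opp
  dominion size y c h (game c)
  attractor y (game c) dom
  union (win y c) (win y c) att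
  diff (game c) (game c) att
  attractor z (game c) (prio (c - 1))
  diff (all (c - 1)) (game c) att
  rec
  attractor y (game c) (win y (c - 1))
  union (win y c) (win y c) att
  diff (game c) (game c) att
  clear aux
  subset (win y (c - 1)) aux

/-- The recursion on the number of priorities: solve the game in `all c`, where `n` is the number of
vertices of the input game, `size i` is its number of vertices with priority `i`, and `h c` is the
parameter of the dominion search in the calls for `c` priorities. -/
noncomputable def solve (n : ℕ) (size : ℕ → ℕ) (h : ℕ → ℕ) : ℕ → Prog Reg Unit
  | 0 => return ()
  | 1 => do
    copy (win .even 1) (all 1)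
    clear (win .odd 1)
  | c + 2 =>
    if c + 2 ≤ 3 then do
      dominion size .even (c + 2) n (all (c + 2))
      copy (win .even (c + 2)) dom
      diff (win .odd (c + 2)) (all (c + 2)) dom
    else do
      let z := topPlayer (c + 2)
      let y := z.opp
      copy (game (c + 2)) (all (c + 2))
      clear (win y (c + 2))
      repeatUntil (iteration size (h (c + 2)) (c + 2) (solve n size h (c + 1)))
      diff (win z (c + 2)) (all (c + 2)) (win y (c + 2))

end BigStep

/-- The set-based symbolic Big-Step algorithm for parity games with `n` vertices, `c` priorities
and `size i` vertices of priority `i`. -/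
noncomputable def symbolicBigStep (n c : ℕ) (size : ℕ → ℕ) (h : ℕ → ℕ) : Prog Reg Unit := do
  Prog.copy (.all c) .vert
  BigStep.solve n size h c

/-- The exponent in the bound on the number of one-step operations. -/
noncomputable def bigStepGamma (c : ℕ) : ℝ :=
  if Odd c then (c : ℝ) / 3 + 1 / 2 - 4 / ((c : ℝ) ^ 2 - 1)
  else (c : ℝ) / 3 + 1 / 2 - 1 / (3 * (c : ℝ)) - 4 / (c : ℝ) ^ 2

/-! Correctness rests on dominions: sets in which a player can keep the play by a memoryless
strategy that closes no cycle won by the opponent. The attractor of a dominion is a dominion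
(`IsDominion.attractor`), a dominion found in the rest of the game can be joined to one already
found (`IsDominion.union`), dominions of the opponent survive when an attractor is put back
(`IsDominion.of_diff_attractor`), and a player who wins outside of his attractor to a favourable top
priority wins everywhere (`IsDominion.of_attractor_top`). Zielonka's induction then covers every
subgame by one dominion for each player (`IsSubgame.isDetermined`). Dominions lie in the winning
sets, which are disjoint, so any two dominions of the two players that cover the game are the
winning sets.

The dominion search computes a ranking that is closed under the updates of every rank and lies below
all progress measures. Closedness makes it a measure (`isMeasure_of_isUpdateClosed`), and lying
below all measures follows since the level sets of a measure are update-closed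
(`IsMeasure.isUpdateClosed`). The vertices of finite rank in a measure form a dominion
(`IsMeasure.isDominion`); conversely, a dominion with at most `h` vertices carries a measure with
values in the co-domain (`IsDominion.exists_isMeasure`), obtained by counting reachable vertices of
each odd priority. So the search misses no dominion with at most `h` vertices. If the recursive call
then still finds a nonempty winning set of the opponent, the iteration removes more than `h`
vertices; otherwise the rest belongs to the top player (`ensures_iteration`).

For the cost of a search, the potential "position of the current rank plus twice the sum of the
positions of all vertex ranks" grows in every round, even when the search goes back to a smaller
rank. This gives a bound linear in the number of vertices times the size of the co-domain, apart
from a factor linear in the number of priorities (`ensures_dominion`). The co-domain has at most `(h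
+ q).choose q` vectors, where `q` is the number of odd indices.

The recursion is estimated for two parameters. With `q * (n / k) ^ β` and `β = γ(k - 1) / q`, search
and recursive call both cost about `n * (n / k) ^ γ(k - 1)`, and there are about `(n / k) ^ (1 - β)`
iterations; this is the recursion satisfied by `bigStepGamma` (`bigStepGamma_rec`). With the
constant parameter `⌈√n⌉`, the exponent of `n` is of order `√n` (`solveCost_le_rpow_sqrt`). The
parameter function picks whichever bound is smaller for the input game. -/

open Relation

/-! ### Paths and closed sets of a relation -/

namespace Relation

variable {α : Type*} {R : α → α → Prop} {S : Set α}

/-- Along a path, either `S` is entered or a measure that decreases outside of `S` decreases. -/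
theorem TransGen.mem_or_lt (f : α → ℕ) (hS : ∀ a b, R a b → a ∈ S → b ∈ S)
    (hf : ∀ a b, R a b → a ∉ S → b ∈ S ∨ f b < f a) {a b : α} (h : TransGen R a b) :
    b ∈ S ∨ f b < f a := by
  induction h with
  | single h =>
    by_cases ha : a ∈ S
    · exact .inl (hS _ _ h ha)
    · exact hf _ _ h ha
  | @tail b c _ h ih =>
    by_cases hb : b ∈ S
    · exact .inl (hS _ _ h hb)
    · rcases ih with ih | ih
      · exact absurd ih hb
      · exact (hf _ _ h hb).imp_right fun h => h.trans ih

theorem TransGen.restrict_of_mem (hS : ∀ a b, R a b → a ∈ S → b ∈ S) {a b : α}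
    (h : TransGen R a b) (ha : a ∈ S) :
    b ∈ S ∧ TransGen (fun a b => R a b ∧ a ∈ S ∧ b ∈ S) a b := by
  induction h with
  | single h => exact ⟨hS _ _ h ha, .single ⟨h, ha, hS _ _ h ha⟩⟩
  | tail _ h ih => exact ⟨hS _ _ h ih.1, .tail ih.2 ⟨h, ih.1, hS _ _ h ih.1⟩⟩

theorem TransGen.restrict_of_notMem (hS : ∀ a b, R a b → a ∈ S → b ∈ S) {a b : α}
    (h : TransGen R a b) (hb : b ∉ S) :
    a ∉ S ∧ TransGen (fun a b => R a b ∧ a ∉ S ∧ b ∉ S) a b := by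
  induction h with
  | single h => exact ⟨fun ha => hb (hS _ _ h ha), .single ⟨h, fun ha => hb (hS _ _ h ha), hb⟩⟩
  | @tail b c _ h ih =>
    have hb' : b ∉ S := fun hb' => hb (hS _ _ h hb')
    exact ⟨(ih hb').1, .tail (ih hb').2 ⟨h, hb', hb⟩⟩

end Relation

@[simp] theorem Player.opp_opp (z : Player) : z.opp.opp = z := by cases z <;> rfl

theorem Player.opp_ne (z : Player) : z.opp ≠ z := by cases z <;> simp [Player.opp]

theorem Player.ne_iff_eq_opp {y z : Player} : y ≠ z ↔ y = z.opp := by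
  cases y <;> cases z <;> simp [Player.opp]

/-! ### Subgames, attractors and dominions -/

namespace ParityGame

variable {V : Type*} {c : ℕ} (G : ParityGame V c)

/-- The subgame of `G` that is induced by `X` has no dead ends. -/
def IsSubgame (X : Set V) : Prop := ∀ v ∈ X, ∃ w ∈ X, G.edge v w

/-- The controllable predecessors of `B` in the subgame that is induced by `X`. -/
def cpreIn (z : Player) (X B : Set V) : Set V :=
  {v | v ∈ X ∧ (∃ w ∈ B, G.edge v w) ∧ (G.owner v = z.opp → ∀ w ∈ X, G.edge v w → w ∈ B)}

/-- The priorities in the game in which player `y` is the even player. -/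
def shiftedPrio (y : Player) (v : V) : ℕ := G.prio v + BigStep.shift y

/-- The moves inside `D` through vertices of priority at most `p`, when `y` plays `σ`. -/
def stratRel (y : Player) (D : Set V) (σ : V → V) (p : ℕ) (a b : V) : Prop :=
  a ∈ D ∧ b ∈ D ∧ G.edge a b ∧ (G.owner a = y → b = σ a) ∧ (G.prio a : ℕ) ≤ p ∧ (G.prio b : ℕ) ≤ p

/-- `D` is a dominion of player `y` in the subgame induced by `X`: there is a memoryless strategy
of `y` such that the plays from `D` stay in `D` and no cycle is won by the opponent. -/
def IsDominion (y : Player) (X D : Set V) : Prop :=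
  D ⊆ X ∧ ∃ σ : V → V, (∀ v ∈ D, G.owner v = y → G.edge v (σ v) ∧ σ v ∈ D) ∧
    (∀ v ∈ D, G.owner v ≠ y → ∀ w ∈ X, G.edge v w → w ∈ D) ∧
    ∀ v ∈ D, Odd (G.shiftedPrio y v) → ¬ TransGen (G.stratRel y D σ (G.prio v)) v v

/-- `A` is an initial part of the computation of the attractor of player `z` to `B`; the function
`f` is the step in which a vertex is attracted. -/
def IsPreAttractor (z : Player) (X B A : Set V) (f : V → ℕ) : Prop :=
  A ⊆ X ∧ B ∩ X ⊆ A ∧ ∀ v ∈ A, v ∉ B → v ∈ G.cpreIn z X {w | w ∈ A ∧ f w < f v}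

/-- `A` is the attractor of player `z` to `B` in the subgame induced by `X`. -/
def IsAttractor (z : Player) (X B A : Set V) : Prop :=
  (∃ f, G.IsPreAttractor z X B A f) ∧ G.cpreIn z X A ⊆ A

variable {G} {y z : Player} {X A B D : Set V}

theorem cpreIn_mono {B B' : Set V} (h : B ⊆ B') : G.cpreIn z X B ⊆ G.cpreIn z X B' :=
  fun _ hv => ⟨hv.1, hv.2.1.imp fun _ hw => ⟨h hw.1, hw.2⟩, fun ho w hw he => h (hv.2.2 ho w hw he)⟩

theorem isPreAttractor_inter : G.IsPreAttractor z X B (B ∩ X) fun _ => 0 :=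
  ⟨Set.inter_subset_right, subset_rfl, fun _ hv hB => absurd hv.1 hB⟩

-- The newly attracted vertices get a step number `N` that exceeds all numbers used before, so all
-- of `A` counts as earlier for them.
open Classical in
theorem IsPreAttractor.union_cpreIn [Finite V] {f : V → ℕ} (h : G.IsPreAttractor z X B A f) :
    ∃ f', G.IsPreAttractor z X B (A ∪ G.cpreIn z X A) f' := by
  obtain ⟨N, hN⟩ : ∃ N, ∀ v, f v < N := by
    obtain ⟨N, hN⟩ := (Set.finite_range f).bddAbove
    exact ⟨N + 1, fun v => Nat.lt_succ_of_le (hN ⟨v, rfl⟩)⟩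
  refine ⟨fun v => if v ∈ A then f v else N, Set.union_subset h.1 fun v hv => hv.1,
    h.2.1.trans Set.subset_union_left, ?_⟩
  intro v hv hB
  by_cases hA : v ∈ A
  · refine cpreIn_mono ?_ (h.2.2 v hA hB)
    rintro w ⟨hw, hlt⟩
    exact ⟨.inl hw, by simpa [hw, hA] using hlt⟩
  · refine cpreIn_mono ?_ (hv.resolve_left hA)
    intro w hw
    exact ⟨.inl hw, by simpa [hw, hA] using hN w⟩

theorem IsAttractor.inter_subset (h : G.IsAttractor z X B A) : B ∩ X ⊆ A := h.1.choose_spec.2.1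

theorem exists_isAttractor [Finite V] (G : ParityGame V c) (z : Player) (X B : Set V) :
    ∃ A, G.IsAttractor z X B A := by
  suffices H : ∀ k, ∀ A f, G.IsPreAttractor z X B A f → (X \ A).ncard ≤ k →
      ∃ A, G.IsAttractor z X B A from H _ _ _ isPreAttractor_inter le_rfl
  intro k
  induction k with
  | zero =>
    intro A f h hk
    refine ⟨A, ⟨f, h⟩, fun v hv => ?_⟩
    by_contra hA
    have := (Set.ncard_eq_zero (Set.toFinite _)).1 (Nat.le_zero.1 hk)
    exact (this ▸ (⟨hv.1, hA⟩ : v ∈ X \ A) : v ∈ (∅ : Set V))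
  | succ k ih =>
    intro A f h hk
    by_cases hc : G.cpreIn z X A ⊆ A
    · exact ⟨A, ⟨f, h⟩, hc⟩
    · obtain ⟨f', h'⟩ := h.union_cpreIn
      obtain ⟨v, hv, hA⟩ := Set.not_subset.1 hc
      refine ih _ f' h' (Nat.lt_succ_iff.1 (lt_of_lt_of_le (Set.ncard_lt_ncard ?_) hk))
      refine ⟨Set.sdiff_subset_sdiff_right Set.subset_union_left, fun hs => ?_⟩
      exact (hs ⟨hv.1, hA⟩).2 (.inr hv)

/-- A vertex all of whose successors in `X` lie in the attractor is itself attracted, whoever owns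
it. -/
theorem IsSubgame.diff_attractor (hX : G.IsSubgame X) (hA : G.IsAttractor z X B A) :
    G.IsSubgame (X \ A) := by
  rintro v ⟨hv, hvA⟩
  by_contra! H
  obtain ⟨w, hw, he⟩ := hX v hv
  have H' : ∀ w ∈ X, G.edge v w → w ∈ A := fun w hw he => by_contra fun hwA => H w ⟨hw, hwA⟩ he
  exact hvA (hA.2 ⟨hv, ⟨w, H' w hw he, he⟩, fun _ => H'⟩)

/-- In the complement of an attractor of `z`, the moves of `z` do not leave this complement. -/
theorem IsAttractor.notMem_of_edge (hA : G.IsAttractor z X B A) {v w : V} (hv : v ∈ X)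
    (hvA : v ∉ A) (ho : G.owner v = z) (he : G.edge v w) : w ∉ A := fun hw =>
  hvA (hA.2 ⟨hv, ⟨w, hw, he⟩, fun ho' => absurd (ho'.symm.trans ho) z.opp_ne⟩)

/-- The only new moves in `X` lead into `A`, and the opponent `z` of the owner of `D` has none from
outside of his own attractor. -/
theorem IsDominion.of_diff_attractor (hA : G.IsAttractor z X B A)
    (hD : G.IsDominion z.opp (X \ A) D) : G.IsDominion z.opp X D := by
  obtain ⟨hDX, σ, h1, h2, h3⟩ := hD
  refine ⟨hDX.trans Set.sdiff_subset, σ, h1, fun v hv ho w hw he => ?_, h3⟩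
  refine h2 v hv ho w ⟨hw, ?_⟩ he
  exact hA.notMem_of_edge (hDX hv).1 (hDX hv).2 (by simpa using Player.ne_iff_eq_opp.1 ho) he

theorem isDominion_empty : G.IsDominion y X ∅ :=
  ⟨Set.empty_subset _, id, fun _ h => h.elim, fun _ h => h.elim, fun _ h => h.elim⟩

-- The owner follows the attractor strategy outside of `D` and the old strategy inside. Outside of
-- `D` the step number decreases and `D` is never left, so every cycle lies in `D`.
open Classical in
theorem IsDominion.attractor (hD : G.IsDominion y X D) (hA : G.IsAttractor y X D A) :
    G.IsDominion y X A := by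
  obtain ⟨hDX, σ, h1, h2, h3⟩ := hD
  obtain ⟨⟨f, hAX, hDA, hf⟩, -⟩ := hA
  rw [Set.inter_eq_left.2 hDX] at hDA
  choose! τ hτ using fun v hv hB => (hf v hv hB).2.1
  have hclosed : ∀ p, ∀ a b, G.stratRel y A (fun v => if v ∈ D then σ v else τ v) p a b →
      a ∈ D → b ∈ D := by
    rintro p a b ⟨ha, hb, he, ho, -⟩ haD
    by_cases hoa : G.owner a = y
    · rw [(ho hoa).trans (if_pos haD)]; exact (h1 a haD hoa).2
    · exact h2 a haD hoa b (hAX hb) he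
  refine ⟨hAX, fun v => if v ∈ D then σ v else τ v, ?_, ?_, ?_⟩
  · intro v hv ho
    by_cases hvD : v ∈ D
    · simpa [hvD] using ⟨(h1 v hvD ho).1, hDA (h1 v hvD ho).2⟩
    · simpa [hvD] using ⟨(hτ v hv hvD).2, (hτ v hv hvD).1.1⟩
  · intro v hv ho w hw he
    by_cases hvD : v ∈ D
    · exact hDA (h2 v hvD ho w hw he)
    · exact ((hf v hv hvD).2.2 (Player.ne_iff_eq_opp.1 ho) w hw he).1
  · intro v hv hodd hcyc
    have hvD : v ∈ D := by
      refine (hcyc.mem_or_lt f (hclosed _) ?_).resolve_right (lt_irrefl _)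
      rintro a b ⟨ha, hb, he, ho, -⟩ haD
      by_cases hoa : G.owner a = y
      · rw [(ho hoa).trans (if_neg haD)]; exact .inr (hτ a ha haD).1.2
      · exact .inr ((hf a ha haD).2.2 (Player.ne_iff_eq_opp.1 hoa) b (hAX hb) he).2
    refine h3 v hvD hodd ((hcyc.restrict_of_mem (hclosed _) hvD).2.lift id ?_)
    rintro a b ⟨⟨-, -, he, ho, hp⟩, ha, hb⟩
    exact ⟨ha, hb, he, fun hoa => (ho hoa).trans (if_pos ha), hp⟩

-- The opponent may move from `D` to `A`, but nobody leaves `A` again under the combined strategy.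
-- Hence a cycle lies entirely in `A` or entirely in `D`.
open Classical in
theorem IsDominion.union (hA : G.IsDominion y X A) (hD : G.IsDominion y (X \ A) D) :
    G.IsDominion y X (A ∪ D) := by
  obtain ⟨hAX, σ, h1, h2, h3⟩ := hA
  obtain ⟨hDX, τ, k1, k2, k3⟩ := hD
  have hclosed : ∀ p, ∀ a b, G.stratRel y (A ∪ D) (fun v => if v ∈ A then σ v else τ v) p a b →
      a ∈ A → b ∈ A := by
    rintro p a b ⟨ha, hb, he, ho, -⟩ haA
    by_cases hoa : G.owner a = y
    · rw [(ho hoa).trans (if_pos haA)]; exact (h1 a haA hoa).2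
    · exact h2 a haA hoa b (hb.elim (fun h => hAX h) fun h => (hDX h).1) he
  refine ⟨Set.union_subset hAX (hDX.trans Set.sdiff_subset), fun v => if v ∈ A then σ v else τ v,
    ?_, ?_, ?_⟩
  · intro v hv ho
    by_cases hvA : v ∈ A
    · simpa [hvA] using ⟨(h1 v hvA ho).1, .inl (h1 v hvA ho).2⟩
    · have hvD := hv.resolve_left hvA
      simpa [hvA] using ⟨(k1 v hvD ho).1, .inr (k1 v hvD ho).2⟩
  · intro v hv ho w hw he
    by_cases hvA : v ∈ A
    · exact .inl (h2 v hvA ho w hw he)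
    · by_cases hwA : w ∈ A
      · exact .inl hwA
      · exact .inr (k2 v (hv.resolve_left hvA) ho w ⟨hw, hwA⟩ he)
  · intro v hv hodd hcyc
    by_cases hvA : v ∈ A
    · refine h3 v hvA hodd ((hcyc.restrict_of_mem (hclosed _) hvA).2.lift id ?_)
      rintro a b ⟨⟨-, -, he, ho, hp⟩, ha, hb⟩
      exact ⟨ha, hb, he, fun hoa => (ho hoa).trans (if_pos ha), hp⟩
    · refine k3 v (hv.resolve_left hvA) hodd
        ((hcyc.restrict_of_notMem (hclosed _) hvA).2.lift id ?_)
      rintro a b ⟨⟨ha', hb', he, ho, hp⟩, ha, hb⟩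
      exact ⟨ha'.resolve_left ha, hb'.resolve_left hb, he,
        fun hoa => (ho hoa).trans (if_neg ha), hp⟩

open Classical in
/-- If `z` wins outside of his attractor to the vertices with the highest priority, and this
priority is good for `z`, then `z` wins everywhere. -/
theorem IsDominion.of_attractor_top (hX : G.IsSubgame X) {p : ℕ} (hp : ∀ v ∈ X, (G.prio v : ℕ) ≤ p)
    (hpz : ∀ v ∈ X, Odd (G.shiftedPrio z v) → (G.prio v : ℕ) ≠ p)
    (hA : G.IsAttractor z X (G.prioSet p) A) (hD : G.IsDominion z (X \ A) (X \ A)) :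
    G.IsDominion z X X := by
  obtain ⟨-, σ, h1, -, h3⟩ := hD
  obtain ⟨⟨f, hAX, hBA, hf⟩, -⟩ := hA
  choose! ν hν using hX
  choose! τ hτ using fun v hv hB => (hf v hv hB).2.1
  refine ⟨subset_rfl, fun v => if v ∈ A then if (G.prio v : ℕ) = p then ν v else τ v else σ v,
    ?_, fun _ _ _ w hw _ => hw, ?_⟩
  · intro v hv ho
    by_cases hvA : v ∈ A
    · by_cases hvp : (G.prio v : ℕ) = p
      · simpa [hvA, hvp] using ⟨(hν v hv).2, (hν v hv).1⟩
      · simpa [hvA, hvp] using ⟨(hτ v hvA hvp).2, hAX (hτ v hvA hvp).1.1⟩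
    · simpa [hvA] using ⟨(h1 v ⟨hv, hvA⟩ ho).1, (h1 v ⟨hv, hvA⟩ ho).2.1⟩
  · intro v hv hodd hcyc
    -- A cycle with bad maximal priority avoids the vertices of priority `p`. Inside `A` it would
    -- then stay in `A` with decreasing step number, so it avoids `A` altogether.
    have hlt : (G.prio v : ℕ) < p := lt_of_le_of_ne (hp v hv) (hpz v hv hodd)
    have hdec : ∀ a b, G.stratRel z X (fun v => if v ∈ A then if (G.prio v : ℕ) = p then ν v
        else τ v else σ v) (G.prio v) a b → a ∈ A → b ∈ A ∧ f b < f a := by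
      rintro a b ⟨ha, hb, he, ho, hpa, -⟩ haA
      have hap : (G.prio a : ℕ) ≠ p := by omega
      by_cases hoa : G.owner a = z
      · rw [(ho hoa).trans ((if_pos haA).trans (if_neg hap))]; exact (hτ a haA hap).1
      · exact (hf a haA hap).2.2 (Player.ne_iff_eq_opp.1 hoa) b hb he
    have hvA : v ∉ A := by
      intro hvA
      have h := (hcyc.restrict_of_mem (fun a b h ha => (hdec a b h ha).1) hvA).2
      refine ((h.mem_or_lt (S := ∅) f (fun _ _ _ h => h.elim) ?_).resolve_left id).ne rfl
      exact fun a b h _ => .inr (hdec a b h.1 h.2.1).2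
    refine h3 v ⟨hv, hvA⟩ hodd
      ((hcyc.restrict_of_notMem (fun a b h ha => (hdec a b h ha).1) hvA).2.lift id ?_)
    rintro a b ⟨⟨ha', hb', he, ho, hp⟩, ha, hb⟩
    exact ⟨⟨ha', ha⟩, ⟨hb', hb⟩, he, fun hoa => (ho hoa).trans (if_neg ha), hp⟩

/-! ### Plays -/

theorem exists_isLimsupPriority [Finite V] (G : ParityGame V c) (ρ : ℕ → V) :
    ∃ p, G.IsLimsupPriority ρ p := by
  have hfin : {i : ℕ | ∃ᶠ k in Filter.atTop, (G.prio (ρ k) : ℕ) = i}.Finite :=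
    (Set.finite_lt_nat c).subset fun i hi => by
      obtain ⟨k, hk⟩ := hi.exists
      exact hk ▸ (G.prio (ρ k)).2
  have hne : {i : ℕ | ∃ᶠ k in Filter.atTop, (G.prio (ρ k) : ℕ) = i}.Nonempty := by
    have h : ∃ᶠ k : ℕ in Filter.atTop, ∃ v, ρ k = v :=
      (Filter.Eventually.of_forall fun k => ⟨_, rfl⟩).frequently
    rw [Filter.frequently_exists] at h
    obtain ⟨v, hv⟩ := h
    exact ⟨G.prio v, hv.mono fun k hk => by rw [hk]⟩
  obtain ⟨p, hp, hmax⟩ := Set.exists_max_image _ id hfin hne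
  exact ⟨p, hp, hmax⟩

/-- From some time on no priority exceeds `p`, and by finiteness a single vertex of priority `p`
recurs. The part of the play between two late visits to it is the cycle. -/
theorem exists_cycle_of_isLimsupPriority [Finite V] {ρ : ℕ → V} {p : ℕ}
    (h : G.IsLimsupPriority ρ p) : ∃ k, (G.prio (ρ k) : ℕ) = p ∧
      TransGen (fun a b => (∃ k, a = ρ k ∧ b = ρ (k + 1)) ∧ (G.prio a : ℕ) ≤ p ∧
        (G.prio b : ℕ) ≤ p) (ρ k) (ρ k) := by
  obtain ⟨hp, hmax⟩ := h
  have hev : ∀ᶠ k in Filter.atTop, (G.prio (ρ k) : ℕ) ≤ p := by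
    by_contra hne
    rw [Filter.not_eventually] at hne
    have h : ∃ᶠ k in Filter.atTop, ∃ i : Fin c, p < (i : ℕ) ∧ (G.prio (ρ k) : ℕ) = i :=
      hne.mono fun k hk => ⟨_, not_le.1 hk, rfl⟩
    rw [Filter.frequently_exists] at h
    obtain ⟨i, hi⟩ := h
    have := hmax (hi.mono fun k hk => hk.2 : (i : ℕ) ∈ _)
    obtain ⟨k, hk, -⟩ := hi.exists
    omega
  have h : ∃ᶠ k in Filter.atTop, ∃ v, ρ k = v ∧ (G.prio v : ℕ) = p :=
    hp.mono fun k hk => ⟨_, rfl, hk⟩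
  rw [Filter.frequently_exists] at h
  obtain ⟨v, hv⟩ := h
  obtain ⟨K, hK⟩ := Filter.eventually_atTop.1 hev
  obtain ⟨k, hk, hkv, hvp⟩ := Filter.frequently_atTop.1 hv K
  obtain ⟨l, hl, hlv, -⟩ := Filter.frequently_atTop.1 hv (k + 1)
  refine ⟨k, hkv ▸ hvp, ?_⟩
  have key : ∀ l ≥ k + 1, TransGen (fun a b => (∃ k, a = ρ k ∧ b = ρ (k + 1)) ∧
      (G.prio a : ℕ) ≤ p ∧ (G.prio b : ℕ) ≤ p) (ρ k) (ρ l) := by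
    intro l hl
    induction l, hl using Nat.le_induction with
    | base => exact .single ⟨⟨k, rfl, rfl⟩, hK _ hk, hK _ (by omega)⟩
    | succ l hl ih => exact ih.tail ⟨⟨l, rfl, rfl⟩, hK _ (by omega), hK _ (by omega)⟩
  have := key l hl
  rwa [hlv, ← hkv] at this

/-- A play that is consistent with the strategy of a dominion is won by its owner. -/
theorem even_shift_of_isLimsupPriority [Finite V] {σ : V → V}
    (h3 : ∀ v ∈ D, Odd (G.shiftedPrio y v) → ¬ TransGen (G.stratRel y D σ (G.prio v)) v v)
    {ρ : ℕ → V} (hρ : ∀ k, ρ k ∈ D) (hstep : ∀ k, G.edge (ρ k) (ρ (k + 1)))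
    (hσ : ∀ k, G.owner (ρ k) = y → ρ (k + 1) = σ (ρ k)) {p : ℕ} (hp : G.IsLimsupPriority ρ p) :
    Even (p + BigStep.shift y) := by
  rw [← Nat.not_odd_iff_even]
  intro hodd
  obtain ⟨k, hk, hcyc⟩ := exists_cycle_of_isLimsupPriority hp
  refine h3 (ρ k) (hρ k) (by rw [shiftedPrio, hk]; exact hodd) (hcyc.lift id ?_)
  rintro _ _ ⟨⟨j, rfl, rfl⟩, h⟩
  exact ⟨hρ _, hρ _, hstep _, hσ _, hk ▸ h⟩

/-- If both players follow their strategies from a common vertex, the play stays in both dominions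
and both would win it. -/
theorem IsDominion.disjoint [Finite V] {E : Set V} (hD : G.IsDominion y X D)
    (hE : G.IsDominion y.opp X E) : Disjoint D E := by
  obtain ⟨hDX, σ, h1, h2, h3⟩ := hD
  obtain ⟨hEX, τ, k1, k2, k3⟩ := hE
  rw [Set.disjoint_left]
  intro v hvD hvE
  classical
  let ρ : ℕ → V := fun k => (fun v => if G.owner v = y then σ v else τ v)^[k] v
  have hs : ∀ k, ρ (k + 1) = if G.owner (ρ k) = y then σ (ρ k) else τ (ρ k) :=
    fun k => Function.iterate_succ_apply' _ _ _
  have hyo : y ≠ y.opp := y.opp_ne.symm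
  have hρ : ∀ k, ρ k ∈ D ∧ ρ k ∈ E := by
    intro k
    induction k with
    | zero => exact ⟨hvD, hvE⟩
    | succ k ih =>
      rw [hs]
      by_cases ho : G.owner (ρ k) = y
      · rw [if_pos ho]
        have := h1 _ ih.1 ho
        exact ⟨this.2, k2 _ ih.2 (ho ▸ hyo) _ (hDX this.2) this.1⟩
      · rw [if_neg ho]
        have := k1 _ ih.2 (Player.ne_iff_eq_opp.1 ho)
        exact ⟨h2 _ ih.1 ho _ (hEX this.2) this.1, this.2⟩
  have hstep : ∀ k, G.edge (ρ k) (ρ (k + 1)) := by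
    intro k
    rw [hs]
    by_cases ho : G.owner (ρ k) = y
    · rw [if_pos ho]; exact (h1 _ (hρ k).1 ho).1
    · rw [if_neg ho]; exact (k1 _ (hρ k).2 (Player.ne_iff_eq_opp.1 ho)).1
  obtain ⟨p, hp⟩ := G.exists_isLimsupPriority ρ
  have e1 := even_shift_of_isLimsupPriority h3 (fun k => (hρ k).1) hstep
    (fun k ho => by rw [hs, if_pos ho]) hp
  have e2 := even_shift_of_isLimsupPriority k3 (fun k => (hρ k).2) hstep
    (fun k ho => by rw [hs, if_neg (ho ▸ hyo.symm)]) hp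
  cases y <;> simp [BigStep.shift, Player.opp, Nat.even_add_one] at e1 e2 <;> grind

theorem disjoint_winningSet : Disjoint (G.winningSet .even) (G.winningSet .odd) := by
  rw [Set.disjoint_left]
  rintro v ⟨f, hf, hf'⟩ ⟨g, hg, hg'⟩
  obtain ⟨p, hp, he⟩ := hf' g hg
  obtain ⟨q, hq, ho⟩ := hg' f hf
  rw [hp.unique hq] at he
  exact (Nat.not_even_iff_odd.2 ho) he

-- Outside of `D` the strategy is completed by arbitrary successors; plays from `D` never get there.
open Classical in
theorem IsDominion.subset_winningSet [Finite V] (hD : G.IsDominion y Set.univ D) :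
    D ⊆ G.winningSet y := by
  obtain ⟨-, σ, h1, h2, h3⟩ := hD
  choose ν hν using G.exists_edge
  let f : V → V := fun v => if v ∈ D then σ v else ν v
  have hf : G.IsStrategy y f := by
    intro v ho
    by_cases hv : v ∈ D
    · simpa [f, hv] using (h1 v hv ho).1
    · simpa [f, hv] using hν v
  intro v hv
  have key : ∀ ρ : ℕ → V, ρ 0 = v → (∀ k, G.edge (ρ k) (ρ (k + 1))) →
      (∀ k, G.owner (ρ k) = y → ρ (k + 1) = f (ρ k)) →
      ∃ p, G.IsLimsupPriority ρ p ∧ Even (p + BigStep.shift y) := by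
    intro ρ h0 hstep hσ
    have hρ : ∀ k, ρ k ∈ D := by
      intro k
      induction k with
      | zero => exact h0 ▸ hv
      | succ k ih =>
        by_cases ho : G.owner (ρ k) = y
        · rw [hσ k ho]; simpa [f, ih] using (h1 _ ih ho).2
        · exact h2 _ ih ho _ trivial (hstep k)
    obtain ⟨p, hp⟩ := G.exists_isLimsupPriority ρ
    exact ⟨p, hp, even_shift_of_isLimsupPriority h3 hρ hstep
      (fun k ho => by rw [hσ k ho]; simp [f, hρ k]) hp⟩
  cases y with
  | even =>
    refine ⟨f, hf, fun g hg => ?_⟩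
    have hstep : ∀ k, G.edge (G.play f g v k) (G.play f g v (k + 1)) := by
      intro k
      cases ho : G.owner (G.play f g v k) with
      | even => simpa [play, ho] using hf _ ho
      | odd => simpa [play, ho] using hg _ ho
    obtain ⟨p, hp, he⟩ := key (G.play f g v) rfl hstep fun k ho => by simp [play, ho]
    exact ⟨p, hp, by simpa [BigStep.shift] using he⟩
  | odd =>
    refine ⟨f, hf, fun g hg => ?_⟩
    have hstep : ∀ k, G.edge (G.play g f v k) (G.play g f v (k + 1)) := by
      intro k
      cases ho : G.owner (G.play g f v k) with
      | even => simpa [play, ho] using hg _ ho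
      | odd => simpa [play, ho] using hf _ ho
    obtain ⟨p, hp, he⟩ := key (G.play g f v) rfl hstep fun k ho => by simp [play, ho]
    exact ⟨p, hp, by simpa [BigStep.shift, Nat.even_add_one] using he⟩

/-! ### Determinacy -/

theorem odd_shiftedPrio_ne_topPlayer {p : ℕ} (v : V)
    (h : Odd (G.shiftedPrio (BigStep.topPlayer (p + 1)) v)) : (G.prio v : ℕ) ≠ p := by
  rintro rfl
  unfold shiftedPrio BigStep.topPlayer at h
  split_ifs at h with h' <;> simp [BigStep.shift, Nat.odd_add_one] at h h' <;> grind

/-- Both players together win everywhere. -/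
def IsDetermined (G : ParityGame V c) (X : Set V) : Prop :=
  ∃ D : Player → Set V, (∀ z, G.IsDominion z X (D z)) ∧ ∀ v ∈ X, ∃ z, v ∈ D z

/-- Zielonka's argument, by induction on the number of priorities and then on the number of
vertices. If the opponent of the top player `z` wins nothing outside of the attractor of `z` to the
top priority, `z` wins everywhere. Otherwise the attractor of what the opponent wins there is
removed and the smaller game is split. -/
theorem IsSubgame.isDetermined [Finite V] {p : ℕ} (hX : G.IsSubgame X)
    (hp : ∀ v ∈ X, (G.prio v : ℕ) < p) : G.IsDetermined X := by
  induction p generalizing X with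
  | zero => exact ⟨fun _ => ∅, fun _ => isDominion_empty, fun v hv => absurd (hp v hv) (by simp)⟩
  | succ p ih =>
    induction hk : X.ncard using Nat.strong_induction_on generalizing X with
    | _ k ihk =>
    subst hk
    let z := BigStep.topPlayer (p + 1)
    obtain ⟨A, hA⟩ := G.exists_isAttractor z X (G.prioSet p)
    obtain ⟨D, hD, hcov⟩ := ih (hX.diff_attractor hA) fun v hv =>
      lt_of_le_of_ne (Nat.lt_succ_iff.1 (hp v hv.1)) fun h => hv.2 (hA.inter_subset ⟨h, hv.1⟩)
    by_cases he : D z.opp = ∅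
    · have hfull : D z = X \ A := by
        refine (hD z).1.antisymm fun v hv => ?_
        obtain ⟨w, hw⟩ := hcov v hv
        by_cases hwz : w = z
        · exact hwz ▸ hw
        · rw [Player.ne_iff_eq_opp.1 hwz, he] at hw; exact hw.elim
      have := IsDominion.of_attractor_top hX (fun v hv => Nat.lt_succ_iff.1 (hp v hv))
        (fun v _ => odd_shiftedPrio_ne_topPlayer v) hA (by have := hD z; rwa [hfull] at this)
      refine ⟨fun w => if w = z then X else ∅, fun w => ?_, fun v hv => ⟨z, by simpa using hv⟩⟩
      by_cases hwz : w = z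
      · subst hwz; simpa using this
      · simpa [hwz] using isDominion_empty
    · obtain ⟨B, hB⟩ := G.exists_isAttractor z.opp X (D z.opp)
      have hDB : G.IsDominion z.opp X B := ((hD z.opp).of_diff_attractor hA).attractor hB
      obtain ⟨v, hv⟩ := Set.nonempty_iff_ne_empty.2 he
      have hvX : v ∈ X := ((hD z.opp).1 hv).1
      obtain ⟨E, hE, hcovE⟩ := ihk (X \ B).ncard
        (Set.ncard_lt_ncard ⟨Set.sdiff_subset, fun h => (h hvX).2 (hB.inter_subset ⟨hv, hvX⟩)⟩)
        (hX.diff_attractor hB) (fun v hv => hp v hv.1) rfl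
      refine ⟨fun w => if w = z then E z else B ∪ E z.opp, fun w => ?_, fun v hv => ?_⟩
      · by_cases hwz : w = z
        · subst hwz
          simpa using IsDominion.of_diff_attractor hB (by simpa using hE z)
        · simpa [hwz, Player.ne_iff_eq_opp.1 hwz, z.opp_ne] using hDB.union (hE z.opp)
      · by_cases hvB : v ∈ B
        · exact ⟨z.opp, by simp [z.opp_ne, hvB]⟩
        · obtain ⟨w, hw⟩ := hcovE v ⟨hv, hvB⟩
          by_cases hwz : w = z
          · exact ⟨z, by simpa [hwz] using hwz ▸ hw⟩
          · exact ⟨z.opp, by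
              rw [Player.ne_iff_eq_opp.1 hwz] at hw
              simp [z.opp_ne, hw]⟩

end ParityGame

/-! ## Total correctness of symbolic programs -/

namespace Prog

variable {V : Type*} {c : ℕ} (G : ParityGame V c) (U : Finset Reg)

/-- The program `p`, started with the register contents `m`, halts, and the returned value, the
register contents and the number of one-step operations satisfy `Q`. -/
def Ensures {α : Type} (p : Prog Reg α) (m : Reg → Set V) (Q : α → (Reg → Set V) → ℕ → Prop) :
    Prop :=
  ∃ a m' t, p.Run G U m a m' t ∧ Q a m' t

variable {G U} {α β : Type} {m : Reg → Set V}

theorem Ensures.mono {p : Prog Reg α} {Q Q' : α → (Reg → Set V) → ℕ → Prop}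
    (h : Ensures G U p m Q) (hQ : ∀ a m' t, Q a m' t → Q' a m' t) : Ensures G U p m Q' := by
  obtain ⟨a, m', t, hr, hq⟩ := h
  exact ⟨a, m', t, hr, hQ _ _ _ hq⟩

@[simp] theorem ensures_pure {a : α} {Q : α → (Reg → Set V) → ℕ → Prop} :
    Ensures G U (pure a) m Q ↔ Q a m 0 := by
  change (∃ a' m' t, (a' = a ∧ m' = m ∧ t = 0) ∧ Q a' m' t) ↔ _
  constructor
  · rintro ⟨_, _, _, ⟨rfl, rfl, rfl⟩, h⟩; exact h
  · exact fun h => ⟨_, _, _, ⟨rfl, rfl, rfl⟩, h⟩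

@[simp] theorem ensures_ret {a : α} {Q : α → (Reg → Set V) → ℕ → Prop} :
    Ensures G U (ret a) m Q ↔ Q a m 0 := ensures_pure

@[simp] theorem ensures_andThen {p : Prog Reg α} {q : α → Prog Reg β}
    {Q : β → (Reg → Set V) → ℕ → Prop} :
    Ensures G U (andThen p q) m Q ↔
      Ensures G U p m fun a m' t => Ensures G U (q a) m' fun b m'' t' => Q b m'' (t + t') := by
  constructor
  · rintro ⟨b, m'', _, ⟨a, m', t, t', hp, hq, rfl⟩, h⟩
    exact ⟨a, m', t, hp, b, m'', t', hq, h⟩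
  · rintro ⟨a, m', t, hp, b, m'', t', hq, h⟩
    exact ⟨b, m'', _, ⟨a, m', t, t', hp, hq, rfl⟩, h⟩

@[simp] theorem ensures_bind {p : Prog Reg α} {q : α → Prog Reg β}
    {Q : β → (Reg → Set V) → ℕ → Prop} :
    Ensures G U (p >>= q) m Q ↔
      Ensures G U p m fun a m' t => Ensures G U (q a) m' fun b m'' t' => Q b m'' (t + t') :=
  ensures_andThen

theorem ensures_instr {i : Instr Reg} {Q : Unit → (Reg → Set V) → ℕ → Prop} :
    Ensures G U (instr i) m Q ↔
      i.UsesOnly U ∧ Q () (Function.update m i.target (i.value G m)) i.oneSteps := by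
  constructor
  · rintro ⟨_, m', _, ⟨hU, hm, rfl⟩, h⟩
    have : m' = Function.update m i.target (i.value G m) := by
      funext r
      by_cases hr : r = i.target
      · rw [(hm r).1 hr, hr, Function.update_self]
      · rw [(hm r).2 hr, Function.update_of_ne hr]
    exact ⟨hU, this ▸ h⟩
  · rintro ⟨hU, h⟩
    refine ⟨(), _, _, ⟨hU, fun r => ⟨?_, fun hr => Function.update_of_ne hr _ _⟩, rfl⟩, h⟩
    rintro rfl
    exact Function.update_self _ _ _

@[simp] theorem ensures_union {d a b : Reg} {Q : Unit → (Reg → Set V) → ℕ → Prop} :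
    Ensures G U (union d a b) m Q ↔
      (d ∈ U ∧ a ∈ U ∧ b ∈ U) ∧ Q () (Function.update m d (m a ∪ m b)) 0 := ensures_instr

@[simp] theorem ensures_inter {d a b : Reg} {Q : Unit → (Reg → Set V) → ℕ → Prop} :
    Ensures G U (inter d a b) m Q ↔
      (d ∈ U ∧ a ∈ U ∧ b ∈ U) ∧ Q () (Function.update m d (m a ∩ m b)) 0 := ensures_instr

@[simp] theorem ensures_diff {d a b : Reg} {Q : Unit → (Reg → Set V) → ℕ → Prop} :
    Ensures G U (diff d a b) m Q ↔
      (d ∈ U ∧ a ∈ U ∧ b ∈ U) ∧ Q () (Function.update m d (m a \ m b)) 0 := ensures_instr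

@[simp] theorem ensures_pre {d a : Reg} {Q : Unit → (Reg → Set V) → ℕ → Prop} :
    Ensures G U (pre d a) m Q ↔
      (d ∈ U ∧ a ∈ U) ∧ Q () (Function.update m d (G.pre (m a))) 1 := ensures_instr

@[simp] theorem ensures_copy {d a : Reg} {Q : Unit → (Reg → Set V) → ℕ → Prop} :
    Ensures G U (copy d a) m Q ↔ (d ∈ U ∧ a ∈ U) ∧ Q () (Function.update m d (m a)) 0 := by
  simp [copy]

@[simp] theorem ensures_clear {d : Reg} {Q : Unit → (Reg → Set V) → ℕ → Prop} :
    Ensures G U (clear d) m Q ↔ d ∈ U ∧ Q () (Function.update m d ∅) 0 := by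
  simp [clear]

-- The test result is described by its truth condition, which avoids choosing a decision procedure
-- for the inclusion.
@[simp] theorem ensures_subset {a b : Reg} {Q : Bool → (Reg → Set V) → ℕ → Prop} :
    Ensures G U (subset a b) m Q ↔
      (a ∈ U ∧ b ∈ U) ∧ ∀ r : Bool, (r = true ↔ m a ⊆ m b) → Q r m 0 := by
  classical
  constructor
  · rintro ⟨x, m', _, ⟨ha, hb, hx, rfl, rfl⟩, h⟩
    refine ⟨⟨ha, hb⟩, fun r hr => ?_⟩
    rwa [Bool.eq_iff_iff.2 (hr.trans hx.symm)]
  · rintro ⟨⟨ha, hb⟩, h⟩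
    exact ⟨_, _, _, ⟨ha, hb, decide_eq_true_iff, rfl, rfl⟩, h _ decide_eq_true_iff⟩

/-- The invariant speaks of the processed prefix of the list and of the one-step operations spent so
far. -/
theorem ensures_forEach {l : List β} {body : β → Prog Reg Unit}
    (I : List β → (Reg → Set V) → ℕ → Prop) (h0 : I [] m 0)
    (h : ∀ l₁ x l₂, l = l₁ ++ x :: l₂ → ∀ m t, I l₁ m t →
      Ensures G U (body x) m fun _ m' t' => I (l₁ ++ [x]) m' (t + t')) :
    Ensures G U (forEach l body) m fun _ => I l := by
  suffices H : ∀ l₂ l₁, l = l₁ ++ l₂ → ∀ m t, I l₁ m t →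
      Ensures G U (forEach l₂ body) m fun _ m' t' => I l m' (t + t') by
    simpa using H l [] rfl m 0 h0
  intro l₂
  induction l₂ with
  | nil =>
    rintro l₁ rfl m t hI
    simpa [forEach] using hI
  | cons x l₂ ih =>
    intro l₁ hl m t hI
    rw [forEach, ensures_andThen]
    refine (h l₁ x l₂ hl m t hI).mono fun _ m' t' hI' => ?_
    simpa [Nat.add_assoc] using ih (l₁ ++ [x]) (by simpa using hl) m' _ hI'

/-- Besides the state and the accumulated cost, the invariant carries a natural number that drops
with each repetition, so that termination and cost are proved together. -/
theorem ensures_loop {σ : Type} {body : σ → Prog Reg (σ ⊕ α)} {s : σ}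
    {Q : α → (Reg → Set V) → ℕ → Prop} (I : σ → (Reg → Set V) → ℕ → ℕ → Prop) {k : ℕ}
    (h0 : I s m 0 k)
    (h : ∀ s m t k, I s m t k → Ensures G U (body s) m fun r m' t' =>
      (∀ s', r = .inl s' → ∃ k' < k, I s' m' (t + t') k') ∧ ∀ a, r = .inr a → Q a m' (t + t')) :
    Ensures G U (loop body s) m Q := by
  suffices H : ∀ k s m t, I s m t k →
      Ensures G U (loop body s) m fun a m' t' => Q a m' (t + t') by
    simpa using H _ s m 0 h0
  intro k
  induction k using Nat.strong_induction_on with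
  | _ k ih =>
  intro s m t hI
  obtain ⟨r, m', t', hr, h1, h2⟩ := h s m t k hI
  cases r with
  | inl s' =>
    obtain ⟨k', hlt, hI'⟩ := h1 s' rfl
    obtain ⟨a, m'', t'', hr', hq⟩ := ih _ hlt s' m' _ hI'
    exact ⟨a, m'', t' + t'', LoopRun.again hr hr', by simpa [Nat.add_assoc] using hq⟩
  | inr a => exact ⟨a, m', t', LoopRun.leave hr, h2 a rfl⟩

theorem ensures_repeatUntil {body : Prog Reg Bool}
    {Q : Unit → (Reg → Set V) → ℕ → Prop} (I : (Reg → Set V) → ℕ → Prop)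
    (μ : (Reg → Set V) → ℕ) (h0 : I m 0)
    (h : ∀ m t, I m t → Ensures G U body m fun r m' t' =>
      (r = false → I m' (t + t') ∧ μ m' < μ m) ∧ (r = true → Q () m' (t + t'))) :
    Ensures G U (repeatUntil body) m Q := by
  refine ensures_loop (fun _ m t k => I m t ∧ μ m = k) ⟨h0, rfl⟩ fun _ m t k hI => ?_
  rw [ensures_bind]
  refine (h m t hI.1).mono fun r m' t' hr => ?_
  cases r <;> simp_all

end Prog

/-! ### Programs for controllable predecessors and attractors -/

namespace Reg

/-- The registers that are not changed by a dominion search or an attractor computation. -/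
def Persistent : Reg → Prop
  | vert | own _ | prio _ | all _ | game _ | win _ _ => True
  | _ => False

/-- The auxiliary registers other than those for the ranks. -/
def IsAux : Reg → Prop
  | top | cur | old | cmp | agree | step | esc | aux | att | dom | own _ => True
  | _ => False

end Reg

namespace BigStep

open Prog Reg ParityGame

variable {V : Type*} {c : ℕ} {G : ParityGame V c} {U : Finset Reg} {m : Reg → Set V}

theorem ensures_cpreIn {z : Player} {X d b : Reg} (hU : ∀ r, r.IsAux → r ∈ U) (hX : X ∈ U)
    (hXp : X.Persistent) (hd : d ∈ U) (hdo : ¬ d.Persistent) (hb : b ∈ U) (hbe : b ≠ esc)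
    (hde : d ≠ esc)
    (hbX : m b ⊆ m X) (ho : m (own z.opp) = {v | G.owner v = z.opp})
    {Q : Unit → (Reg → Set V) → ℕ → Prop}
    (hQ : ∀ m', m' d = G.cpreIn z (m X) (m b) → (∀ r, r ≠ d → r ≠ esc → m' r = m r) →
      Q () m' 2) :
    Ensures G U (cpreIn z X d b) m Q := by
  have hXd : X ≠ d := by rintro rfl; exact hdo hXp
  have hXe : X ≠ esc := by rintro rfl; exact hXp
  have hod : own z.opp ≠ d := by rintro rfl; exact hdo trivial
  have he : esc ∈ U := hU _ trivial
  have ho' : own z.opp ∈ U := hU _ trivial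
  simp only [cpreIn, ensures_bind, ensures_diff, ensures_pre, ensures_inter]
  refine ⟨⟨he, hX, hb⟩, ⟨he, he⟩, ⟨he, he, ho'⟩, ⟨hd, hb⟩, ⟨hd, hd, hX⟩, ⟨hd, hd, he⟩, ?_⟩
  refine hQ _ ?_ fun r h1 h2 => by simp [h1, h2]
  ext v
  simp only [Function.update_self, Function.update_of_ne hde.symm,
    Function.update_of_ne hXd, Function.update_of_ne hXe, Function.update_of_ne hbe,
    Function.update_of_ne (show own z.opp ≠ esc by simp), ho, ParityGame.pre, ParityGame.cpreIn,
    Set.mem_sdiff, Set.mem_inter_iff, Set.mem_ofPred_eq]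
  constructor
  · rintro ⟨⟨h1, h2⟩, h3⟩
    refine ⟨h2, h1, fun hv w hw hvw => ?_⟩
    by_contra hwb
    exact h3 ⟨⟨w, ⟨hw, hwb⟩, hvw⟩, hv⟩
  · rintro ⟨h1, h2, h3⟩
    exact ⟨⟨h2, h1⟩, fun ⟨⟨w, ⟨hw, hwb⟩, hvw⟩, hv⟩ => hwb (h3 hv w hw hvw)⟩

/-- Each round costs two one-step operations and all but the last add a vertex; the summand `1` pays
for the last round. -/
theorem ensures_attractor [Finite V] {z : Player} {X B : Reg} (hU : ∀ r, r.IsAux → r ∈ U)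
    (hX : X ∈ U) (hXp : X.Persistent) (hB : B ∈ U)
    (ho : m (own z.opp) = {v | G.owner v = z.opp}) :
    Ensures G U (attractor z X B) m fun _ m' t =>
      G.IsAttractor z (m X) (m B) (m' att) ∧
        (∀ r, r ≠ att → r ≠ step → r ≠ esc → m' r = m r) ∧ t ≤ 2 * (Nat.card V + 1) := by
  have hXa : X ≠ att := by rintro rfl; exact hXp
  have hXs : X ≠ step := by rintro rfl; exact hXp
  have hXe : X ≠ esc := by rintro rfl; exact hXp
  have hatt : att ∈ U := hU _ trivial
  have hstep : step ∈ U := hU _ trivial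
  simp only [attractor, ensures_bind, ensures_inter]
  refine ⟨⟨hatt, hB, hX⟩, ?_⟩
  refine ensures_repeatUntil
    (fun m' t => (∃ f, G.IsPreAttractor z (m X) (m B) (m' att) f) ∧
      (∀ r, r ≠ att → r ≠ step → r ≠ esc → m' r = m r) ∧ t ≤ 2 * (m' att).ncard)
    (fun m' => Nat.card V - (m' att).ncard) ?_ ?_
  · refine ⟨⟨_, by simpa using isPreAttractor_inter⟩, fun r h _ _ => by simp [h], by simp⟩
  · rintro m₁ t ⟨⟨f, hf⟩, hm, ht⟩
    have hm1X : m₁ X = m X := hm X hXa hXs hXe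
    rw [ensures_bind]
    refine ensures_cpreIn hU hX hXp hstep id hatt (by simp) (by simp) (hm1X ▸ hf.1)
      (by rw [hm _ (by simp) (by simp) (by simp), ho]) fun m₂ hm2 hm2' => ?_
    have h2a : m₂ att = m₁ att := hm2' _ (by simp) (by simp)
    rw [hm1X] at hm2
    simp only [ensures_bind, ensures_subset, ensures_union, ensures_pure]
    refine ⟨⟨hstep, hatt⟩, fun r hr => ⟨⟨hatt, hatt, hstep⟩, fun hfix => ?_, fun hfix => ?_⟩⟩
    · rw [← Bool.not_eq_true, hr, hm2, h2a] at hfix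
      have hlt : (m₁ att).ncard < (m₁ att ∪ G.cpreIn z (m X) (m₁ att)).ncard :=
        Set.ncard_lt_ncard ⟨Set.subset_union_left, fun h => hfix (Set.subset_union_right.trans h)⟩
      have hle := Set.ncard_le_card (m₁ att ∪ G.cpreIn z (m X) (m₁ att))
      simp only [Function.update_self, hm2, h2a]
      refine ⟨⟨hf.union_cpreIn, fun r h1 h2 h3 => ?_, by omega⟩, by omega⟩
      rw [Function.update_of_ne h1, hm2' r h2 h3, hm r h1 h2 h3]
    · rw [hr, hm2, h2a] at hfix
      have hle := Set.ncard_le_card (m₁ att)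
      simp only [Function.update_self, hm2, h2a, Set.union_eq_self_of_subset_right hfix]
      refine ⟨⟨⟨f, hf⟩, hfix⟩, fun r h1 h2 h3 => ?_, by omega⟩
      rw [Function.update_of_ne h1, hm2' r h2 h3, hm r h1 h2 h3]

end BigStep

/-! ### Order, increment and decrement of rank vectors -/

namespace Rank

variable {c : ℕ} {N : Fin c → ℕ} {h l : ℕ} {x y : Rank c}

theorem mem_domain : x ∈ domain N h ↔ (∀ i, x i ≤ N i) ∧ ∑ i, x i ≤ h := by
  constructor
  · intro hx
    obtain ⟨f, hf, rfl⟩ := Finset.mem_map.1 hx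
    simpa [Nat.lt_succ_iff] using hf
  · rintro ⟨h1, h2⟩
    refine Finset.mem_map.2 ⟨ofColex x, ?_, rfl⟩
    simpa [Nat.lt_succ_iff] using ⟨h1, h2⟩

theorem proj_apply (i : Fin c) : proj l x i = if (i : ℕ) < l then 0 else x i := rfl

theorem zero_apply (i : Fin c) : (zero : Rank c) i = 0 := rfl

theorem lt_iff : x < y ↔ ∃ i, (∀ j, i < j → x j = y j) ∧ x i < y i := Iff.rfl

theorem zero_le (x : Rank c) : zero ≤ x := Pi.toColex_monotone fun _ => Nat.zero_le _

theorem proj_le (l : ℕ) (x : Rank c) : proj l x ≤ x := by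
  refine Pi.toColex_monotone (a := ofColex (proj l x)) (b := ofColex x) fun i => ?_
  simp only [Pi.ofColex_apply, proj_apply]
  split_ifs <;> simp

/-- The largest index at which two vectors differ is either erased, and then their projections
agree, or kept, and then it still decides. -/
theorem proj_mono (l : ℕ) : Monotone (proj l : Rank c → Rank c) := by
  intro x y hxy
  rcases hxy.eq_or_lt with rfl | hlt
  · exact le_rfl
  obtain ⟨i, hi, hlt⟩ := lt_iff.1 hlt
  by_cases hil : (i : ℕ) < l
  · refine le_of_eq (funext fun j => ?_)
    simp only [proj_apply]
    split_ifs with hj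
    · rfl
    · exact hi j (Fin.lt_def.2 (by omega))
  · refine le_of_lt (lt_iff.2 ⟨i, fun j hj => ?_, by simpa [proj_apply, hil] using hlt⟩)
    simp only [proj_apply, hi j hj]

theorem proj_proj (k l : ℕ) (x : Rank c) : proj k (proj l x) = proj (max k l) x := by
  funext i
  simp only [proj_apply, lt_max_iff]
  split_ifs <;> first | rfl | omega

@[simp] theorem proj_zero (x : Rank c) : proj 0 x = x := rfl

theorem zero_mem : zero ∈ domain N h := mem_domain.2 ⟨fun _ => Nat.zero_le _, by simp [zero_apply]⟩

theorem proj_mem (l : ℕ) (hx : x ∈ domain N h) : proj l x ∈ domain N h := by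
  rw [mem_domain] at hx ⊢
  have hle : ∀ i, proj l x i ≤ x i := fun i => by rw [proj_apply]; split_ifs <;> simp
  exact ⟨fun i => (hle i).trans (hx.1 i), (Finset.sum_le_sum fun i _ => hle i).trans hx.2⟩

/-- Being fixed by `proj l` passes to smaller `l`, so it suffices that the supremum in `level` is
attained. The bound `l < c` is needed because only such indices enter the supremum. -/
theorem coe_le_level_iff (hl : l < c) : l ≤ level (x : WithTop (Rank c)) ↔ proj l x = x := by
  have hx : proj (level (x : WithTop (Rank c))) x = x := by
    have : level (x : WithTop (Rank c)) ∈ (Finset.range c).filter fun l => proj l x = x := by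
      classical
      obtain ⟨k, hk, he⟩ := Finset.exists_mem_eq_sup ((Finset.range c).filter fun l => proj l x = x)
        ⟨0, by simp [(Nat.zero_le l).trans_lt hl]⟩ id
      have hkl : level (x : WithTop (Rank c)) = k := by
        refine Eq.trans ?_ he
        change (Finset.filter _ _).sup id = _
        congr!
      rwa [hkl]
    simpa using (Finset.mem_filter.1 this).2
  constructor
  · intro h
    calc proj l x = proj l (proj (level (x : WithTop (Rank c))) x) := by rw [hx]
      _ = x := by rw [proj_proj, max_eq_right h, hx]
  · intro h
    have : l ∈ (Finset.range c).filter fun l => proj l x = x := by simp [hl, h]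
    exact Finset.le_sup (f := id) this

/-- The elements of the co-domain of the ranking functions. -/
def IsValue (M : Finset (Rank c)) (r : WithTop (Rank c)) : Prop :=
  ∀ x : Rank c, r = x → x ∈ M

theorem isValue_top {M : Finset (Rank c)} : IsValue M ⊤ := by intro x hx; simp at hx

theorem isValue_coe {M : Finset (Rank c)} : IsValue M x ↔ x ∈ M :=
  ⟨fun h => h x rfl, fun h _ hx => WithTop.coe_injective hx ▸ h⟩

theorem incrAt_le {M : Finset (Rank c)} (hy : y ∈ M) (h : proj l x < proj l y) :
    incrAt M l x ≤ y :=
  Finset.min_le (by simp [hy, h])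

theorem isValue_incrAt {M : Finset (Rank c)} : IsValue M (incrAt M l x) := fun y hy => by
  have := Finset.mem_of_min hy
  simp_all

theorem proj_lt_of_incrAt {M : Finset (Rank c)} (h : incrAt M l x = y) : proj l x < proj l y := by
  have := Finset.mem_of_min h
  simp_all

theorem lt_incrAt {M : Finset (Rank c)} : x < incrAt M l x := by
  cases hr : incrAt M l x with
  | top => exact WithTop.coe_lt_top x
  | coe y => exact WithTop.coe_lt_coe.2 ((proj_mono l).reflect_lt (proj_lt_of_incrAt hr))

theorem incrAt_proj {M : Finset (Rank c)} : incrAt M l (proj l x) = incrAt M l x := by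
  unfold incrAt
  rw [proj_proj, max_self]

/-- The domain is closed under projection, and the projection of a candidate is a candidate too; a
minimal one therefore has zeros below `l`. -/
theorem proj_eq_of_incrAt {r : WithTop (Rank c)} (h' : incrAt (domain N h) l x = r) :
    r.map (proj l) = r := by
  cases r with
  | top => rfl
  | coe y =>
    refine congrArg _ ((proj_le l y).antisymm ?_)
    refine WithTop.coe_le_coe.1 (h' ▸ incrAt_le (proj_mem l (isValue_coe.1 (h' ▸ isValue_incrAt))) ?_)
    rw [proj_proj, max_self]
    exact proj_lt_of_incrAt h'

theorem le_level_iff {r : WithTop (Rank c)} (hl : l < c) :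
    l ≤ level r ↔ r.map (proj l) = r := by
  cases r with
  | top => simpa [level] using hl.le
  | coe y => rw [coe_le_level_iff hl]; simp

theorem decrAt_le_proj {M : Finset (Rank c)} (hx : proj l x ∈ M) :
    decrAt M l (incrAt M l x) ≤ (proj l x : Rank c) := by
  unfold decrAt
  split_ifs with h0
  · exact WithTop.coe_le_coe.2 (zero_le _)
  · exact Finset.min_le (by simpa [hx] using incrAt_proj)

/-- This shows that the minimum in `decrAt` ranges over a nonempty set: the largest vector whose
projection is below `r` is incremented exactly to `r`. -/
theorem exists_decrAt_eq {r : WithTop (Rank c)} (hr : IsValue (domain N h) r)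
    (hl : r.map (proj l) = r) (h0 : r ≠ (zero : Rank c)) :
    ∃ d : Rank c, decrAt (domain N h) l r = d ∧ d ∈ domain N h ∧
      incrAt (domain N h) l d = r := by
  classical
  have key : ∃ d ∈ domain N h, incrAt (domain N h) l d = r := by
    obtain ⟨d, hd, hmax⟩ := Finset.exists_max_image
      ((domain N h).filter fun y => ((proj l y : Rank c) : WithTop (Rank c)) < r) id
      ⟨zero, by
        have hz : proj l (zero : Rank c) = zero := (proj_le l _).antisymm (zero_le _)
        rw [Finset.mem_filter, hz]
        refine ⟨zero_mem, lt_of_le_of_ne ?_ h0.symm⟩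
        cases r with
        | top => exact le_top
        | coe y => exact WithTop.coe_le_coe.2 (zero_le y)⟩
    rw [Finset.mem_filter] at hd
    refine ⟨d, hd.1, ?_⟩
    have hno : ∀ q ∈ domain N h, proj l d < proj l q → r ≤ (proj l q : Rank c) := by
      intro q hq hlt
      by_contra hlt'
      exact (proj_mono l (hmax q (Finset.mem_filter.2 ⟨hq, not_le.1 hlt'⟩))).not_gt hlt
    refine le_antisymm ?_ ?_
    · cases r with
      | top => exact le_top
      | coe y =>
        have hy : proj l y = y := WithTop.coe_injective hl
        exact incrAt_le (hr y rfl) (hy.symm ▸ WithTop.coe_lt_coe.1 hd.2)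
    · cases hi : incrAt (domain N h) l d with
      | top => exact le_top
      | coe q =>
        have hq := isValue_coe.1 (hi ▸ isValue_incrAt)
        exact (hno q hq (proj_lt_of_incrAt hi)).trans (WithTop.coe_le_coe.2 (proj_le l q))
  unfold decrAt
  rw [if_neg (by rwa [hl])]
  obtain ⟨d, hd, he⟩ := key
  obtain ⟨e, hem⟩ := Finset.min_of_nonempty (s := (domain N h).filter fun y =>
    incrAt (domain N h) l y = r) ⟨d, by simp [hd, he]⟩
  have := Finset.mem_filter.1 (Finset.mem_of_min hem)
  exact ⟨e, by convert hem, this.1, this.2⟩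

theorem decrAt_lt {r : WithTop (Rank c)} (hr : IsValue (domain N h) r)
    (hl : r.map (proj l) = r) (h0 : r ≠ (zero : Rank c)) : decrAt (domain N h) l r < r := by
  obtain ⟨d, hd, -, hi⟩ := exists_decrAt_eq hr hl h0
  exact hd.trans_lt (lt_incrAt.trans_eq hi)

theorem isValue_decrAt {r : WithTop (Rank c)} (hr : IsValue (domain N h) r)
    (hl : r.map (proj l) = r) (h0 : r ≠ (zero : Rank c)) :
    IsValue (domain N h) (decrAt (domain N h) l r) := by
  obtain ⟨d, hd, hM, -⟩ := exists_decrAt_eq hr hl h0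
  rw [hd]
  exact isValue_coe.2 hM

theorem map_proj_zero (r : WithTop (Rank c)) : r.map (proj 0) = r := by cases r <;> rfl

/-- No value lies strictly between `decr` of `r` and `r`, since a vector above the former is at
least its increment. -/
theorem le_decr {r s : WithTop (Rank c)} (hr : IsValue (domain N h) r)
    (h0 : r ≠ (zero : Rank c)) (hs : IsValue (domain N h) s) (hlt : s < r) :
    s ≤ decr (domain N h) r := by
  obtain ⟨d, hd, -, hi⟩ := exists_decrAt_eq hr (map_proj_zero r) h0
  rw [decr, hd]
  cases s with
  | top => exact absurd hlt not_top_lt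
  | coe x =>
    by_contra hdx
    exact ((hi ▸ incrAt_le (hs x rfl) (WithTop.coe_lt_coe.1 (not_le.1 hdx)) : r ≤ x)).not_gt hlt

theorem decr_lt {r : WithTop (Rank c)} (hr : IsValue (domain N h) r)
    (h0 : r ≠ (zero : Rank c)) : decr (domain N h) r < r :=
  decrAt_lt hr (map_proj_zero r) h0

theorem isValue_decr {r : WithTop (Rank c)} (hr : IsValue (domain N h) r)
    (h0 : r ≠ (zero : Rank c)) : IsValue (domain N h) (decr (domain N h) r) :=
  isValue_decrAt hr (map_proj_zero r) h0

theorem incr_le {M : Finset (Rank c)} {r s : WithTop (Rank c)} (hs : IsValue M s) (hlt : r < s) :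
    incr M r ≤ s := by
  cases r with
  | top => exact absurd hlt not_top_lt
  | coe x =>
    cases s with
    | top => exact le_top
    | coe y => exact incrAt_le (hs y rfl) (WithTop.coe_lt_coe.1 hlt)

theorem lt_incr {M : Finset (Rank c)} {r : WithTop (Rank c)} (hr : r ≠ ⊤) : r < incr M r := by
  cases r with
  | top => exact absurd rfl hr
  | coe x => exact lt_incrAt

theorem isValue_incr {M : Finset (Rank c)} {r : WithTop (Rank c)} : IsValue M (incr M r) := by
  cases r with
  | top => exact isValue_top
  | coe x => exact isValue_incrAt

theorem zero_lt_incr {M : Finset (Rank c)} (r : WithTop (Rank c)) :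
    ((zero : Rank c) : WithTop (Rank c)) < incr M r := by
  cases r with
  | top => exact WithTop.coe_lt_top _
  | coe x => exact (WithTop.coe_le_coe.2 (zero_le x)).trans_lt lt_incrAt

theorem coe_zero_le (r : WithTop (Rank c)) : ((zero : Rank c) : WithTop (Rank c)) ≤ r := by
  cases r with
  | top => exact le_top
  | coe x => exact WithTop.coe_le_coe.2 (zero_le x)

open Classical in
/-- The number of rank vectors below `r`. -/
noncomputable def index (M : Finset (Rank c)) (r : WithTop (Rank c)) : ℕ :=
  (M.filter fun x : Rank c => (x : WithTop (Rank c)) < r).card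

open Classical in
theorem index_le_card (M : Finset (Rank c)) (r : WithTop (Rank c)) : index M r ≤ M.card :=
  Finset.card_filter_le _ _

open Classical in
theorem index_mono (M : Finset (Rank c)) : Monotone (index M) := fun r s hrs =>
  Finset.card_le_card fun x hx => by
    rw [Finset.mem_filter] at hx ⊢
    exact ⟨hx.1, hx.2.trans_le hrs⟩

open Classical in
theorem index_lt_index {M : Finset (Rank c)} {r s : WithTop (Rank c)} (hr : IsValue M r)
    (hlt : r < s) : index M r < index M s := by
  cases r with
  | top => exact absurd hlt not_top_lt
  | coe x =>
    refine Finset.card_lt_card (Finset.ssubset_iff_of_subset (fun y hy => ?_) |>.2 ⟨x, ?_, ?_⟩)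
    · rw [Finset.mem_filter] at hy ⊢
      exact ⟨hy.1, hy.2.trans hlt⟩
    · exact Finset.mem_filter.2 ⟨hr x rfl, hlt⟩
    · simp

end Rank

/-! ### Progress measures and dominions -/

namespace ParityGame

open Relation BigStep Rank

variable {V : Type*} {c c' : ℕ} {G : ParityGame V c} {y : Player} {A D : Set V}

/-- The condition of the progress measure along a move from a vertex of priority `p`. -/
def IsProgress (p : ℕ) (x x' : Rank c') : Prop :=
  proj p x' ≤ proj p x ∧ (Odd p → proj p x' < proj p x)

/-- `μ` is a progress measure for player `y` in the subgame induced by `A`. -/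
def IsMeasure (G : ParityGame V c) (y : Player) (A : Set V) (μ : V → WithTop (Rank c')) : Prop :=
  ∀ v ∈ A, ∀ x : Rank c', μ v = x →
    (G.owner v = y → ∃ w ∈ A, G.edge v w ∧
      ∃ x' : Rank c', μ w = x' ∧ IsProgress (G.shiftedPrio y v) x x') ∧
    (G.owner v ≠ y → ∀ w ∈ A, G.edge v w →
      ∃ x' : Rank c', μ w = x' ∧ IsProgress (G.shiftedPrio y v) x x')

/-- The set `T` is closed under the updates for the rank `r`. -/
def IsUpdateClosed (G : ParityGame V c) (y : Player) (A : Set V) (M : Finset (Rank c'))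
    (ρ : V → WithTop (Rank c')) (r : WithTop (Rank c')) (T : Set V) : Prop :=
  (∀ j : Fin c', Odd (j : ℕ) → (j : ℕ) ≤ level r →
    ∀ v ∈ G.cpreIn y.opp A {w | w ∈ A ∧ decrAt M j r ≤ ρ w}, G.shiftedPrio y v = j → v ∈ T) ∧
  ∀ v ∈ G.cpreIn y.opp A T, G.shiftedPrio y v ≤ level r → v ∈ T

/-- The strategy picks the successors given by the measure. Along a cycle whose maximal shifted
priority `p` is odd and is attained at `v`, the projection at `p` never increases and drops when
leaving `v`, which is impossible. -/
theorem IsMeasure.isDominion {μ : V → WithTop (Rank c')} (h : G.IsMeasure y A μ) :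
    G.IsDominion y A {v | v ∈ A ∧ μ v ≠ ⊤} := by
  classical
  choose! x hx using fun v (hv : μ v ≠ ⊤) => WithTop.ne_top_iff_exists.1 hv
  choose! σ hσ using fun v (hv : v ∈ A ∧ μ v ≠ ⊤) (ho : G.owner v = y) =>
    (h v hv.1 (x v) (hx v hv.2).symm).1 ho
  refine ⟨fun v hv => hv.1, σ, fun v hv ho => ?_, fun v hv ho w hw he => ?_, fun v hv hodd hcyc => ?_⟩
  · obtain ⟨h1, h2, x', h3, -⟩ := hσ v hv ho
    exact ⟨h2, h1, by simp [h3]⟩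
  · obtain ⟨x', h3, -⟩ := (h v hv.1 (x v) (hx v hv.2).symm).2 ho w hw he
    exact ⟨hw, by simp [h3]⟩
  · have hstep : ∀ a b, G.stratRel y {v | v ∈ A ∧ μ v ≠ ⊤} σ (G.prio v) a b →
        G.shiftedPrio y a ≤ G.shiftedPrio y v ∧ IsProgress (G.shiftedPrio y a) (x a) (x b) := by
      rintro a b ⟨ha, hb, he, ho, hp, -⟩
      refine ⟨by unfold shiftedPrio; omega, ?_⟩
      by_cases hoa : G.owner a = y
      · obtain ⟨-, -, x', h3, h4⟩ := hσ a ha hoa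
        rw [← ho hoa] at h3
        rw [← hx b hb.2] at h3
        rwa [WithTop.coe_injective h3]
      · obtain ⟨x', h3, h4⟩ := (h a ha.1 (x a) (hx a ha.2).symm).2 hoa b hb.1 he
        rw [← hx b hb.2] at h3
        rwa [WithTop.coe_injective h3]
    have hle : ∀ a b, G.stratRel y {v | v ∈ A ∧ μ v ≠ ⊤} σ (G.prio v) a b →
        proj (G.shiftedPrio y v) (x b) ≤ proj (G.shiftedPrio y v) (x a) := by
      intro a b hab
      obtain ⟨h1, h2, -⟩ := hstep a b hab
      have := proj_mono (G.shiftedPrio y v) h2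
      rwa [proj_proj, proj_proj, max_eq_left h1] at this
    have hlt : ∀ b, TransGen (G.stratRel y {v | v ∈ A ∧ μ v ≠ ⊤} σ (G.prio v)) v b →
        proj (G.shiftedPrio y v) (x b) < proj (G.shiftedPrio y v) (x v) := by
      intro b hb
      induction hb with
      | single hb => exact (hstep _ _ hb).2.2 hodd
      | tail _ hb ih => exact (hle _ _ hb).trans_lt ih
    exact lt_irrefl _ (hlt v hcyc)

/-- The search replaces a level set by the least update-closed set above it. As the level set of any
measure above `ρ` is such a set, raising ranks never overtakes a measure. -/
theorem IsMeasure.isUpdateClosed {μ ρ : V → WithTop (Rank c')} {N : Fin c' → ℕ} {h : ℕ}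
    (hμ : G.IsMeasure y A μ) (hM : ∀ v, IsValue (domain N h) (μ v)) (hle : ∀ v ∈ A, ρ v ≤ μ v)
    (hc : ∀ v ∈ A, G.shiftedPrio y v < c')
    {r : WithTop (Rank c')} (hr : IsValue (domain N h) r) (h0 : r ≠ (zero : Rank c')) :
    G.IsUpdateClosed y A (domain N h) ρ r {v | v ∈ A ∧ r ≤ μ v} := by
  -- If the opponent can force the move into `B`, then a vertex of finite rank has a successor in
  -- `B` that satisfies the progress condition: at a vertex of `y` every successor is in `B`, and at
  -- a vertex of the opponent every successor satisfies the condition.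
  have key : ∀ B ⊆ A, ∀ v ∈ G.cpreIn y.opp A B, ∀ x : Rank c', μ v = x →
      ∃ w ∈ B, ∃ x' : Rank c', μ w = x' ∧ IsProgress (G.shiftedPrio y v) x x' := by
    rintro B hBA v ⟨hv, ⟨w, hw, he⟩, hB⟩ x hx
    by_cases ho : G.owner v = y
    · obtain ⟨w, hw, he, hp⟩ := (hμ v hv x hx).1 ho
      exact ⟨w, hB (by simpa using ho) w hw he, hp⟩
    · exact ⟨w, hw, (hμ v hv x hx).2 ho w (hBA hw) he⟩
  refine ⟨fun j hj hjr v hv hp => ⟨hv.1, ?_⟩, fun v hv hp => ⟨hv.1, ?_⟩⟩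
  · cases hx : μ v with
    | top => exact le_top
    | coe x =>
      obtain ⟨w, hw, x', hx', hpr⟩ := key _ (fun w hw => hw.1) v hv x hx
      obtain ⟨d, hd, hdM, hdr⟩ := exists_decrAt_eq hr ((le_level_iff j.2).1 hjr) h0
      rw [← hdr]
      refine incrAt_le (isValue_coe.1 (hx ▸ hM v)) (lt_of_le_of_lt ?_ (hp ▸ hpr.2 (hp ▸ hj)))
      refine proj_mono _ (WithTop.coe_le_coe.1 ?_)
      rw [← hx', ← hd]
      exact hw.2.trans (hle w hw.1)
  · cases hx : μ v with
    | top => exact le_top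
    | coe x =>
      obtain ⟨w, hw, x', hx', hpr⟩ := key _ (fun w hw => hw.1) v hv x hx
      have h1 := (le_level_iff (hc v hv.1)).1 hp
      rw [← h1]
      have h2 : r ≤ (x' : Rank c') := hx' ▸ hw.2
      refine ((WithTop.monotone_map_iff.2 (proj_mono (G.shiftedPrio y v))) h2).trans ?_
      exact WithTop.coe_le_coe.2 (hpr.1.trans (proj_le _ _))

/-- If progress fails at `v` with rank `x` and shifted priority `p`, then the update for the next
value after `x` with respect to the indices from `p` on forces `v` to have at least that rank, which
exceeds `x`. Odd priorities are handled by the first half of `IsUpdateClosed`, even ones by the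
second. -/
theorem isMeasure_of_isUpdateClosed {ρ : V → WithTop (Rank c')} {N : Fin c' → ℕ} {h : ℕ}
    (hA : G.IsSubgame A) (hM : ∀ v, IsValue (domain N h) (ρ v))
    (hc : ∀ v ∈ A, G.shiftedPrio y v < c')
    (hclosed : ∀ r, IsValue (domain N h) r → r ≠ (zero : Rank c') →
      G.IsUpdateClosed y A (domain N h) ρ r {v | v ∈ A ∧ r ≤ ρ v}) : G.IsMeasure y A ρ := by
  intro v hv x hx
  have hpc := hc v hv
  set p := G.shiftedPrio y v with hp
  set r := incrAt (domain N h) p x with hr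
  have hxr : (x : WithTop (Rank c')) < r := lt_incrAt
  have hpr : p ≤ level r := (le_level_iff hpc).2 (proj_eq_of_incrAt hr.symm)
  have h0 : r ≠ (zero : Rank c') := fun h0 => not_lt.2 (coe_zero_le _) (h0 ▸ hxr)
  have hval : IsValue (domain N h) r := isValue_incrAt
  obtain ⟨h1, h2⟩ := hclosed r hval h0
  -- the successors whose rank is too large belong to the sets that are used in the update
  have key : ∀ w ∈ A, ¬ (∃ x' : Rank c', ρ w = x' ∧ IsProgress p x x') →
      if Odd p then decrAt (domain N h) p r ≤ ρ w else r ≤ ρ w := by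
    intro w hw hno
    cases hx' : ρ w with
    | top => split_ifs <;> exact le_top
    | coe x' =>
      have hno' : ¬ IsProgress p x x' := fun h => hno ⟨x', hx', h⟩
      have hx'M : x' ∈ domain N h := isValue_coe.1 (hx' ▸ hM w)
      split_ifs with hodd
      · have hle : proj p x ≤ proj p x' := by
          by_contra hlt
          exact hno' ⟨(not_le.1 hlt).le, fun _ => not_le.1 hlt⟩
        refine (decrAt_le_proj (proj_mem p (isValue_coe.1 (hx ▸ hM v)))).trans ?_
        exact WithTop.coe_le_coe.2 (hle.trans (proj_le p x'))
      · refine incrAt_le hx'M ?_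
        by_contra hle
        exact hno' ⟨not_lt.1 hle, fun ho => absurd ho hodd⟩
  have hcontra : ∀ B : Set V, v ∈ G.cpreIn y.opp A B →
      (∀ w ∈ B, w ∈ A ∧ if Odd p then decrAt (domain N h) p r ≤ ρ w else r ≤ ρ w) → False := by
    intro B hvB hB
    have : r ≤ ρ v := by
      by_cases hodd : Odd p
      · refine (h1 ⟨p, hpc⟩ hodd hpr v (cpreIn_mono (fun w hw => ?_) hvB) rfl).2
        simpa [hodd] using hB w hw
      · refine (h2 v (cpreIn_mono (fun w hw => ?_) hvB) hpr).2
        simpa [hodd] using hB w hw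
    exact (hx ▸ this).not_gt hxr
  constructor
  · intro ho
    by_contra! hno
    obtain ⟨w, hw, he⟩ := hA v hv
    have hno' : ∀ w ∈ A, G.edge v w → ¬ ∃ x' : Rank c', ρ w = x' ∧ IsProgress p x x' :=
      fun w hw he ⟨x', h1, h2⟩ => hno w hw he x' h1 h2
    refine hcontra {w | w ∈ A ∧ G.edge v w} ⟨hv, ⟨w, ⟨hw, he⟩, he⟩, fun _ w hw he => ⟨hw, he⟩⟩
      fun w hw => ⟨hw.1, key w hw.1 (hno' w hw.1 hw.2)⟩
  · intro ho w hw he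
    by_contra hno
    refine hcontra {w} ⟨hv, ⟨w, rfl, he⟩, fun ho' => absurd (by simpa using ho') ho⟩ ?_
    rintro _ rfl
    exact ⟨hw, key _ hw hno⟩

-- The entry of the rank of `v` at an odd index `j` is the number of vertices of priority `j` that
-- are reachable from `v` in `D`, under the strategy, through priorities at most `j`. A move can
-- only shrink these sets at indices from the priority of `v` on. If this priority is odd, `v`
-- itself is lost from its set, since otherwise it would lie on a bad cycle.
open Classical in
theorem IsDominion.exists_isMeasure [Fintype V] {N : Fin c' → ℕ} {h : ℕ}
    (hD : G.IsDominion y A D) (hcard : D.ncard ≤ h) (hc : ∀ v ∈ A, G.shiftedPrio y v < c')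
    (hN : ∀ j : Fin c', Odd (j : ℕ) → {v | G.shiftedPrio y v = j}.ncard ≤ N j) :
    ∃ μ : V → WithTop (Rank c'), G.IsMeasure y A μ ∧ (∀ v, IsValue (domain N h) (μ v)) ∧
      ∀ v ∈ D, μ v ≠ ⊤ := by
  obtain ⟨hDA, σ, h1, h2, h3⟩ := hD
  let R : ℕ → V → V → Prop := fun j a b => a ∈ D ∧ b ∈ D ∧ G.edge a b ∧ (G.owner a = y → b = σ a) ∧
    G.shiftedPrio y a ≤ j ∧ G.shiftedPrio y b ≤ j
  let S : V → ℕ → Set V := fun v j =>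
    {u | u ∈ D ∧ G.shiftedPrio y u = j ∧ G.shiftedPrio y v ≤ j ∧ ReflTransGen (R j) v u}
  let x : V → Rank c' := fun v => toColex fun j : Fin c' => if Odd (j : ℕ) then (S v j).ncard else 0
  have hx : ∀ v (j : Fin c'), x v j = if Odd (j : ℕ) then (S v j).ncard else 0 := fun _ _ => rfl
  have hxM : ∀ v, x v ∈ domain N h := by
    intro v
    refine mem_domain.2 ⟨fun j => ?_, ?_⟩
    · rw [hx]
      split_ifs with hj
      · exact (Set.ncard_le_ncard fun u hu => hu.2.1).trans (hN j hj)
      · exact Nat.zero_le _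
    -- A vertex is counted only at the index of its own priority, so the entries sum up to at most
    -- the size of `D`.
    · calc ∑ j, x v j ≤ ∑ j : Fin c', (D.toFinset.filter fun u => G.shiftedPrio y u = j).card := by
            refine Finset.sum_le_sum fun j _ => ?_
            rw [hx]
            split_ifs
            · rw [Set.ncard_eq_toFinset_card']
              exact Finset.card_le_card fun u hu => by simp_all [S]
            · exact Nat.zero_le _
        _ = (Finset.univ.biUnion fun j : Fin c' =>
              D.toFinset.filter fun u => G.shiftedPrio y u = j).card := by
            rw [Finset.card_biUnion]
            intro i _ j _ hij
            rw [Function.onFun, Finset.disjoint_left]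
            intro u hu hu'
            simp only [Finset.mem_filter] at hu hu'
            exact hij (Fin.ext (hu.2.symm.trans hu'.2))
        _ ≤ D.toFinset.card := Finset.card_le_card fun u hu => by
            simp only [Finset.mem_biUnion, Finset.mem_filter] at hu
            exact hu.choose_spec.2.1
        _ ≤ h := by rwa [← Set.ncard_eq_toFinset_card']
  have hprog : ∀ v w, v ∈ D → w ∈ D → G.edge v w → (G.owner v = y → w = σ v) →
      IsProgress (G.shiftedPrio y v) (x v) (x w) := by
    intro v w hv hw he ho
    have hsub : ∀ j, G.shiftedPrio y v ≤ j → S w j ⊆ S v j := by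
      rintro j hj u ⟨hu, hup, hwp, hr⟩
      exact ⟨hu, hup, hj, .head ⟨hv, hw, he, ho, hj, hwp⟩ hr⟩
    have hle : ∀ i, ofColex (proj (G.shiftedPrio y v) (x w)) i ≤
        ofColex (proj (G.shiftedPrio y v) (x v)) i := by
      intro i
      simp only [Pi.ofColex_apply, proj_apply, hx]
      split_ifs with hi
      · exact le_rfl
      · exact Set.ncard_le_ncard (hsub i (not_lt.1 hi))
      · exact le_rfl
    refine ⟨Pi.toColex_monotone hle, fun hodd => Pi.toColex_strictMono (Pi.lt_def.2 ⟨hle, ?_⟩)⟩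
    refine ⟨⟨G.shiftedPrio y v, hc v (hDA hv)⟩, ?_⟩
    simp only [hx, lt_irrefl, if_false, if_pos hodd]
    refine Set.ncard_lt_ncard ⟨hsub _ le_rfl, fun hss => ?_⟩
    obtain ⟨-, -, hwp, hr⟩ := hss (⟨hv, rfl, le_rfl, .refl⟩ : v ∈ S v (G.shiftedPrio y v))
    have hcyc : TransGen (R (G.shiftedPrio y v)) v v :=
      TransGen.head' ⟨hv, hw, he, ho, le_rfl, hwp⟩ hr
    refine h3 v hv hodd (hcyc.lift id ?_)
    rintro a b ⟨ha, hb, hab, hoa, hpa, hpb⟩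
    unfold shiftedPrio at hpa hpb
    exact ⟨ha, hb, hab, hoa, Nat.le_of_add_le_add_right hpa, Nat.le_of_add_le_add_right hpb⟩
  refine ⟨fun v => if v ∈ D then x v else ⊤, ?_, fun v => ?_, fun v hv => by simp [hv]⟩
  · intro v hv q hq
    have hvD : v ∈ D := by by_contra hvD; simp [hvD] at hq
    have hqx : x v = q := by simpa [hvD] using hq
    subst hqx
    refine ⟨fun ho => ?_, fun ho w hw he => ?_⟩
    · obtain ⟨he, hw⟩ := h1 v hvD ho
      exact ⟨σ v, hDA hw, he, x (σ v), by simp [hw], hprog v _ hvD hw he fun _ => rfl⟩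
    · have hwD := h2 v hvD ho w hw he
      exact ⟨x w, by simp [hwD], hprog v w hvD hwD he fun h => absurd h ho⟩
  · by_cases hv : v ∈ D
    · simpa [hv] using isValue_coe.2 (hxM v)
    · simpa [hv] using isValue_top

end ParityGame

/-! ### Programs that read and update level sets -/

namespace Reg

/-- The registers that are used during an update for one rank. -/
def IsScratch : Reg → Prop
  | cur | old | cmp | agree | step | esc | aux => True
  | _ => False

theorem Persistent.not_isScratch {r : Reg} (h : r.Persistent) : ¬ r.IsScratch := by
  cases r <;> simp_all [Persistent, IsScratch]

end Reg

namespace BigStep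

open Prog Reg ParityGame Rank

variable {V : Type*} {c c' : ℕ} {G : ParityGame V c} {U : Finset Reg} {m : Reg → Set V}
  {N : Fin c' → ℕ} {h : ℕ} {X : Reg} {A : Set V} {ρ : V → WithTop (Rank c')}
  {r : WithTop (Rank c')} {y : Player}

/-- The registers `m` represent the ranking function `ρ` on the game `A` that is stored in `X`. -/
structure Encodes (N : Fin c' → ℕ) (X : Reg) (A : Set V) (ρ : V → WithTop (Rank c'))
    (m : Reg → Set V) : Prop where
  game : m X = A
  top : m top = {v | v ∈ A ∧ ρ v = ⊤}
  coord : ∀ j : Fin c', Odd (j : ℕ) → ∀ x ≤ N j,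
    m (coord j x) = {v | v ∈ A ∧ ∃ q : Rank c', ρ v = q ∧ q j = x}

/-- The registers that are needed for a dominion search in the game that is stored in `X`. -/
structure HasRegs (U : Finset Reg) (y : Player) (N : Fin c' → ℕ) (X : Reg) : Prop where
  aux : ∀ r, r.IsAux → r ∈ U
  mem : X ∈ U
  persistent : X.Persistent
  prio : ∀ k < c', prio (k - shift y) ∈ U
  coord : ∀ j : Fin c', Odd (j : ℕ) → ∀ x ≤ N j, coord j x ∈ U

/-- The input registers contain the description of the game. -/
def HasInput (G : ParityGame V c) (m : Reg → Set V) : Prop :=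
  (∀ z, m (own z) = {v | G.owner v = z}) ∧ ∀ i, m (prio i) = G.prioSet i

theorem Encodes.congr {m' : Reg → Set V} (hE : Encodes N X A ρ m) (hX : X.Persistent)
    (hm : ∀ s, ¬ s.IsScratch → m' s = m s) : Encodes N X A ρ m' :=
  ⟨by rw [hm X hX.not_isScratch, hE.game], by rw [hm _ id, hE.top],
    fun j hj x hx => by rw [hm _ id, hE.coord j hj x hx]⟩

theorem HasInput.congr {m' : Reg → Set V} (hI : HasInput G m)
    (hm : ∀ s, s.Persistent → m' s = m s) : HasInput G m' :=
  ⟨fun z => by rw [hm (own z) trivial, hI.1], fun i => by rw [hm (prio i) trivial, hI.2]⟩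

theorem mem_oddIndices {j : Fin c'} : j ∈ oddIndices c' ↔ Odd (j : ℕ) := by
  simp [oddIndices]

/-- The odd indices as natural numbers. -/
theorem oddIndices_coe :
    (do let a ← oddIndices c'; pure (a : ℕ) : List ℕ) = (oddIndices c').map Fin.val := by
  exact List.map_eq_flatMap.symm

theorem length_oddIndices_le : (oddIndices c').length ≤ c' :=
  (List.length_filter_le _ _).trans (by simp)

theorem pairwise_oddIndices_reverse : (oddIndices c').reverse.Pairwise (· > ·) := by
  rw [List.pairwise_reverse]
  exact (List.pairwise_lt_finRange c').filter _

/-- The lexicographic comparison is carried out from the most significant odd index downwards: `d`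
collects `⊤` and the vectors that exceed `r` at the first difference, `agree` keeps those still
equal. The even entries vanish and cannot matter. -/
theorem ensures_loadRank (hU : HasRegs U y N X) (hE : Encodes N X A ρ m)
    (hρ : ∀ v, IsValue (domain N h) (ρ v)) (hN : ∀ j : Fin c', ¬ Odd (j : ℕ) → N j = 0)
    (hr : IsValue (domain N h) r) {d : Reg} (hd : d = cur ∨ d = cmp) :
    Ensures G U (loadRank N X d r) m fun _ m' t =>
      m' d = {v | v ∈ A ∧ r ≤ ρ v} ∧ (∀ s, s ≠ d → s ≠ agree → s ≠ aux → m' s = m s) ∧ t = 0 := by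
  have hdU : d ∈ U := hU.aux _ (by rcases hd with rfl | rfl <;> trivial)
  have htop : top ∈ U := hU.aux _ trivial
  have hag : agree ∈ U := hU.aux _ trivial
  have haux : aux ∈ U := hU.aux _ trivial
  have hda : d ≠ agree := by rcases hd with rfl | rfl <;> simp
  have hdx : d ≠ aux := by rcases hd with rfl | rfl <;> simp
  have hdt : d ≠ top := by rcases hd with rfl | rfl <;> simp
  have hXd : X ≠ d := by
    have := hU.persistent
    rcases hd with rfl | rfl <;> rintro rfl <;> exact this
  have hdc : ∀ j x, coord j x ≠ d := by rcases hd with rfl | rfl <;> simp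
  cases r with
  | top =>
    simp only [loadRank, ensures_copy]
    refine ⟨⟨hdU, htop⟩, ?_, fun s hs _ _ => by simp [hs], trivial⟩
    simp [hE.top]
  | coe r =>
    have hrM := mem_domain.1 (hr r rfl)
    simp only [loadRank, ensures_bind, ensures_copy, ensures_union]
    refine ⟨⟨hdU, htop⟩, ⟨hag, hU.mem⟩, ?_⟩
    -- Before the first index `agree` is the whole game and includes the vertices of rank `⊤`, hence
    -- the case `l = []`. Intersecting with a coordinate set removes them; if there is no odd index
    -- they are harmless, as `d` contains them anyway.
    refine (ensures_forEach (fun l m' t =>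
      m' agree = {v | v ∈ A ∧ ∃ q : Rank c', ρ v = q ∧ ∀ k ∈ l, q k = r k} ∪
        {v | v ∈ A ∧ ρ v = ⊤ ∧ l = []} ∧
      m' d = {v | v ∈ A ∧ (ρ v = ⊤ ∨ ∃ q : Rank c', ρ v = q ∧
        ∃ j ∈ l, r j < q j ∧ ∀ k ∈ l, j < k → q k = r k)} ∧
      (∀ s, s ≠ d → s ≠ agree → s ≠ aux → m' s = m s) ∧ t = 0) ?_ ?_).mono ?_
    · refine ⟨?_, ?_, fun s h1 h2 _ => by simp [h1, h2], rfl⟩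
      · ext v
        simp only [Function.update_self, Function.update_of_ne hXd, hE.game]
        cases hv : ρ v with
        | top => simp [hv]
        | coe q => simpa [hv] using fun _ => ⟨q, rfl⟩
      · rw [Function.update_of_ne hda, Function.update_self, hE.top]
        simp
    · rintro l₁ j l₂ hl m₁ t ⟨hagree, hmd, hm, rfl⟩
      have hj : Odd (j : ℕ) := mem_oddIndices.1 (by rw [← List.mem_reverse, hl]; simp)
      have hpw := pairwise_oddIndices_reverse (c' := c')
      rw [hl, List.pairwise_append] at hpw
      have hgt : ∀ k ∈ l₁, j < k := fun k hk => hpw.2.2 k hk j (by simp)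
      have hcoord : ∀ x ≤ N j, m₁ (coord j x) = {v | v ∈ A ∧ ∃ q : Rank c', ρ v = q ∧ q j = x} :=
        fun x hx => by rw [hm _ (hdc _ _) (by simp) (by simp), hE.coord j hj x hx]
      rw [ensures_bind]
      refine (ensures_forEach (fun l m' t =>
        m' d = m₁ d ∪ {v | v ∈ m₁ agree ∧ ∃ q : Rank c', ρ v = q ∧ q j ∈ l} ∧
        (∀ s, s ≠ d → s ≠ aux → m' s = m₁ s) ∧ t = 0) ⟨by simp, fun _ _ _ => rfl, rfl⟩ ?_).mono ?_
      · rintro l₃ x l₄ hl' m₂ t ⟨h1, h2, rfl⟩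
        have hx : x ≤ N j := by
          have : x ∈ (List.range (N j + 1)).filter fun x => r j < x := by rw [hl']; simp
          exact Nat.lt_succ_iff.1 (List.mem_range.1 (List.mem_filter.1 this).1)
        simp only [ensures_bind, ensures_inter, ensures_union]
        refine ⟨⟨haux, hag, hU.coord j hj x hx⟩, ⟨hdU, hdU, haux⟩, ?_, fun s hs hs' => ?_, trivial⟩
        · rw [Function.update_self, Function.update_of_ne hdx, Function.update_self, h1,
            h2 _ hda.symm (by simp), h2 _ (hdc _ _) (by simp), hcoord x hx]
          ext v
          simp only [Set.mem_union, Set.mem_inter_iff, Set.mem_ofPred_eq, List.mem_append,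
            List.mem_singleton]
          have hAv : v ∈ m₁ agree → v ∈ A := by
            rw [hagree]; rintro (h | h) <;> exact h.1
          constructor
          · rintro ((h | ⟨h, q, hq, hq'⟩) | ⟨h, -, q, hq, hq'⟩)
            · exact .inl h
            · exact .inr ⟨h, q, hq, .inl hq'⟩
            · exact .inr ⟨h, q, hq, .inr hq'⟩
          · rintro (h | ⟨h, q, hq, hq' | hq'⟩)
            · exact .inl (.inl h)
            · exact .inl (.inr ⟨h, q, hq, hq'⟩)
            · exact .inr ⟨h, hAv h, q, hq, hq'⟩
        · rw [Function.update_of_ne hs, Function.update_of_ne hs', h2 s hs hs']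
      · rintro _ m₂ t ⟨h1, h2, rfl⟩
        rw [ensures_inter]
        refine ⟨⟨hag, hag, hU.coord j hj _ (hrM.1 j)⟩, ?_, ?_, fun s h3 h4 h5 => ?_, rfl⟩
        · rw [Function.update_self, h2 _ hda.symm (by simp), h2 _ (hdc _ _) (by simp),
            hcoord _ (hrM.1 j), hagree]
          ext v
          simp only [Set.mem_union, Set.mem_inter_iff, Set.mem_ofPred_eq, List.mem_append,
            List.mem_singleton]
          constructor
          · rintro ⟨⟨hv, q, hq, hql⟩ | ⟨hv, hq, -⟩, -, q', hq', hqj⟩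
            · rw [hq] at hq'
              obtain rfl := WithTop.coe_injective hq'
              exact .inl ⟨hv, q, hq, fun k hk => hk.elim (hql k) fun hk => hk ▸ hqj⟩
            · simp [hq] at hq'
          · rintro (⟨hv, q, hq, hql⟩ | ⟨-, -, hl⟩)
            · exact ⟨.inl ⟨hv, q, hq, fun k hk => hql k (.inl hk)⟩, hv, q, hq, hql j (.inr rfl)⟩
            · simp at hl
        · rw [Function.update_of_ne hda, h1, hmd, hagree]
          ext v
          simp only [Set.mem_union, Set.mem_ofPred_eq, List.mem_append, List.mem_singleton,
            List.mem_filter, List.mem_range, decide_eq_true_eq]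
          constructor
          · rintro (⟨hv, hq | ⟨q, hq, i, hi, hlt, hik⟩⟩ | ⟨⟨hv, q, hq, hql⟩ | ⟨hv, hq, -⟩,
              q', hq', -, hlt⟩)
            · exact ⟨hv, .inl hq⟩
            · refine ⟨hv, .inr ⟨q, hq, i, .inl hi, hlt, fun k hk hik' => ?_⟩⟩
              rcases hk with hk | rfl
              · exact hik k hk hik'
              · exact absurd (hgt i hi) hik'.not_gt
            · rw [hq] at hq'
              obtain rfl := WithTop.coe_injective hq'
              refine ⟨hv, .inr ⟨q, hq, j, .inr rfl, hlt, fun k hk hjk => ?_⟩⟩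
              exact hk.elim (hql k) fun hk => absurd hjk (hk ▸ lt_irrefl _)
            · simp [hq] at hq'
          · rintro ⟨hv, hq | ⟨q, hq, i, hi | rfl, hlt, hik⟩⟩
            · exact .inl ⟨hv, .inl hq⟩
            · exact .inl ⟨hv, .inr ⟨q, hq, i, hi, hlt, fun k hk => hik k (.inl hk)⟩⟩
            · refine .inr ⟨.inl ⟨hv, q, hq, fun k hk => hik k (.inl hk) (hgt k hk)⟩, q, hq, ?_, hlt⟩
              exact Nat.lt_succ_iff.2 ((mem_domain.1 (hρ v q hq)).1 _)
        · rw [Function.update_of_ne h4, h2 s h3 h5, hm s h3 h4 h5]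
    · rintro _ m₁ t ⟨hagree, hmd, hm, rfl⟩
      refine ⟨⟨hdU, hdU, hag⟩, ?_, fun s h1 h2 h3 => by rw [Function.update_of_ne h1, hm s h1 h2 h3],
        rfl⟩
      rw [Function.update_self, hmd, hagree]
      ext v
      simp only [Set.mem_union, Set.mem_ofPred_eq, List.mem_reverse, mem_oddIndices]
      have heven : ∀ q : Rank c', q ∈ domain N h → ∀ j : Fin c', ¬ Odd (j : ℕ) → q j = 0 :=
        fun q hq j hj => Nat.le_zero.1 (hN j hj ▸ (mem_domain.1 hq).1 j)
      cases hv : ρ v with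
      | top => simpa using fun h _ => h
      | coe q =>
        have hqM := isValue_coe.1 (hv ▸ hρ v)
        have hrM' := isValue_coe.1 hr
        simp only [WithTop.coe_ne_top, false_or, false_and, and_false, or_false,
          WithTop.coe_le_coe]
        constructor
        · rintro (⟨hvA, q', hq', j, hj, hlt, hk⟩ | ⟨hvA, q', hq', hk⟩)
          · obtain rfl := WithTop.coe_injective hq'
            refine ⟨hvA, le_of_lt (lt_iff.2 ⟨j, fun k hjk => ?_, hlt⟩)⟩
            by_cases hk' : Odd (k : ℕ)
            · exact (hk k hk' hjk).symm
            · rw [heven _ hqM k hk', heven _ hrM' k hk']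
          · obtain rfl := WithTop.coe_injective hq'
            refine ⟨hvA, le_of_eq (funext fun k => ?_)⟩
            by_cases hk' : Odd (k : ℕ)
            · exact (hk k hk').symm
            · rw [heven _ hqM k hk', heven _ hrM' k hk']
        · rintro ⟨hvA, hle⟩
          rcases hle.eq_or_lt with rfl | hlt
          · exact .inr ⟨hvA, r, rfl, fun _ _ => rfl⟩
          · obtain ⟨j, hj, hlt⟩ := lt_iff.1 hlt
            refine .inl ⟨hvA, q, rfl, j, ?_, hlt, fun k _ hk => (hj k hk).symm⟩
            by_contra hodd
            rw [heven _ hqM j hodd] at hlt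
            exact absurd hlt (Nat.not_lt_zero _)

/-- The condition on `k` rules out truncated subtraction: for player odd, index `0` would be read as
priority `0`, whose shifted value is `1`. -/
theorem mem_prioSet_sub_shift {k : ℕ} (hk : 1 ≤ k) {v : V} :
    v ∈ G.prioSet (k - shift y) ↔ G.shiftedPrio y v = k := by
  have : shift y ≤ 1 := by cases y <;> simp [shift]
  unfold prioSet shiftedPrio
  simp only [Set.mem_ofPred_eq]
  omega

/-- The result is the least update-closed set above the old level set. The pass over the odd indices
costs at most `2 * c'`; in the final loop each round costs two and all but the last add a vertex,
which is paid for by the growth of `cur`. -/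
theorem ensures_updateRank [Finite V] (hU : HasRegs U y N X) (hE : Encodes N X A ρ m)
    (hI : HasInput G m) (hρ : ∀ v, IsValue (domain N h) (ρ v))
    (hN : ∀ j : Fin c', ¬ Odd (j : ℕ) → N j = 0) (hr : IsValue (domain N h) r)
    (h0 : r ≠ (zero : Rank c')) (hc : ∀ v ∈ A, G.shiftedPrio y v < c') :
    Ensures G U (updateRank y N (domain N h) X r) m fun _ m' t =>
      m' old = {v | v ∈ A ∧ r ≤ ρ v} ∧ {v | v ∈ A ∧ r ≤ ρ v} ⊆ m' cur ∧ m' cur ⊆ A ∧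
      G.IsUpdateClosed y A (domain N h) ρ r (m' cur) ∧
      (∀ T, {v | v ∈ A ∧ r ≤ ρ v} ⊆ T → G.IsUpdateClosed y A (domain N h) ρ r T → m' cur ⊆ T) ∧
      (∀ s, ¬ s.IsScratch → m' s = m s) ∧
      t + 2 * {v | v ∈ A ∧ r ≤ ρ v}.ncard ≤ 2 * c' + 2 + 2 * (m' cur).ncard := by
  set S := {v | v ∈ A ∧ r ≤ ρ v} with hS
  have hSA : S ⊆ A := fun v hv => hv.1
  have hcur : cur ∈ U := hU.aux _ trivial
  have hold : old ∈ U := hU.aux _ trivial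
  have hstep : step ∈ U := hU.aux _ trivial
  have hcmp : cmp ∈ U := hU.aux _ trivial
  simp only [updateRank, oddIndices_coe, ensures_bind, ensures_copy]
  refine (ensures_loadRank hU hE hρ hN hr (.inl rfl)).mono ?_
  rintro _ m₁ t ⟨hm1, hm1', rfl⟩
  refine ⟨⟨hold, hcur⟩, ?_⟩
  have hfr1 : ∀ s, ¬ s.IsScratch → Function.update m₁ old (m₁ cur) s = m s := by
    intro s hs
    rw [Function.update_of_ne (by rintro rfl; exact hs trivial), hm1' s] <;>
    · rintro rfl; exact hs trivial
  refine (ensures_forEach (fun l m' t =>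
      m' old = S ∧ S ⊆ m' cur ∧ m' cur ⊆ A ∧
      (∀ j ∈ l, ∀ v ∈ G.cpreIn y.opp A {w | w ∈ A ∧ decrAt (domain N h) j r ≤ ρ w},
        G.shiftedPrio y v = j → v ∈ m' cur) ∧
      (∀ T, S ⊆ T → G.IsUpdateClosed y A (domain N h) ρ r T → m' cur ⊆ T) ∧
      (∀ s, ¬ s.IsScratch → m' s = m s) ∧ t ≤ 2 * l.length) ?_ ?_).mono ?_
  · simp only [Function.update_self, Function.update_of_ne (show cur ≠ old by simp), hm1]
    exact ⟨rfl, subset_rfl, hSA, by simp, fun T hT _ => hT, by rwa [hm1] at hfr1, by simp⟩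
  · rintro l₁ j l₂ hl m₂ t ⟨h1, h2, h3, h4, h5, h6, ht⟩
    have hj : j ∈ ((oddIndices c').map Fin.val).filter fun j => j ≤ level r := by rw [hl]; simp
    rw [List.mem_filter, List.mem_map, decide_eq_true_eq] at hj
    obtain ⟨⟨j, hj', rfl⟩, hjr⟩ := hj
    replace hj : Odd (j : ℕ) ∧ (j : ℕ) ≤ level r := ⟨mem_oddIndices.1 hj', hjr⟩
    have hmap := (le_level_iff j.2).1 hj.2
    simp only [ensures_bind]
    have hE2 := hE.congr hU.persistent h6
    refine (ensures_loadRank hU hE2 hρ hN (isValue_decrAt hr hmap h0) (.inr rfl)).mono ?_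
    rintro _ m₃ _ ⟨hm3, hm3', rfl⟩
    have hfr3 : ∀ s, ¬ s.IsScratch → m₃ s = m s := by
      intro s hs
      rw [hm3' s, h6 s hs] <;>
      · rintro rfl; exact hs trivial
    have hE3 := hE.congr hU.persistent hfr3
    refine ensures_cpreIn hU.aux hU.mem hU.persistent hstep id hcmp (by simp) (by simp)
      (by rw [hm3, hE3.game]; exact fun v hv => hv.1) (by rw [hfr3 _ id, hI.1])
      fun m₄ hm4 hm4' => ?_
    simp only [ensures_inter, ensures_union]
    have hpU : prio (j - shift y) ∈ U := hU.prio j j.2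
    refine ⟨⟨hstep, hstep, hpU⟩, ⟨hcur, hcur, hstep⟩, ?_⟩
    have e1 : m₄ cur = m₂ cur := by
      rw [hm4' _ (by simp) (by simp), hm3' _ (by simp) (by simp) (by simp)]
    have e2 : m₄ old = m₂ old := by
      rw [hm4' _ (by simp) (by simp), hm3' _ (by simp) (by simp) (by simp)]
    have e3 : m₄ (prio (j - shift y)) = G.prioSet (j - shift y) := by
      rw [hm4' _ (by simp) (by simp), hfr3 _ id, hI.2]
    have hj1 : 1 ≤ (j : ℕ) := hj.1.pos
    simp only [Function.update_self, Function.update_of_ne (show cur ≠ step by simp),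
      Function.update_of_ne (show old ≠ step by simp),
      Function.update_of_ne (show old ≠ cur by simp), e1, e2, e3, hm4, hm3, hE3.game]
    refine ⟨h1, h2.trans Set.subset_union_left, Set.union_subset h3 fun v hv => hv.1.1, ?_, ?_,
      ?_, ?_⟩
    · intro k hk v hv hp
      rcases List.mem_append.1 hk with hk | hk
      · exact .inl (h4 k hk v hv hp)
      · obtain rfl := List.mem_singleton.1 hk
        exact .inr ⟨hv, (mem_prioSet_sub_shift hj1).2 hp⟩
    · intro T hT hclosed
      refine Set.union_subset (h5 T hT hclosed) fun v hv => ?_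
      exact hclosed.1 j hj.1 hj.2 v hv.1 ((mem_prioSet_sub_shift hj1).1 hv.2)
    · intro s hs
      rw [Function.update_of_ne, Function.update_of_ne, hm4' s, hfr3 s hs] <;>
      · rintro rfl; exact hs trivial
    · simp only [List.length_append, List.length_singleton]
      omega
  · rintro _ m₂ t ⟨h1, h2, h3, h4, h5, h6, ht⟩
    have hlen : (((oddIndices c').map Fin.val).filter fun j => j ≤ level r).length ≤ c' :=
      (List.length_filter_le _ _).trans (by simpa using length_oddIndices_le)
    refine ensures_repeatUntil (fun m' t' =>
      m' old = S ∧ S ⊆ m' cur ∧ m' cur ⊆ A ∧ m₂ cur ⊆ m' cur ∧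
      (∀ T, S ⊆ T → G.IsUpdateClosed y A (domain N h) ρ r T → m' cur ⊆ T) ∧
      (∀ s, ¬ s.IsScratch → m' s = m s) ∧ t' + 2 * S.ncard ≤ 2 * (m' cur).ncard)
      (fun m' => Nat.card V - (m' cur).ncard)
      ⟨h1, h2, h3, subset_rfl, h5, h6, by have := Set.ncard_le_ncard h2; omega⟩ ?_
    rintro m₃ t₃ ⟨k1, k2, k3, k4, k5, k6, kt⟩
    have hE3 := hE.congr hU.persistent k6
    rw [ensures_bind]
    refine ensures_cpreIn hU.aux hU.mem hU.persistent hstep id hcur (by simp) (by simp)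
      (by rwa [hE3.game]) (by rw [k6 _ id, hI.1]) fun m₄ hm4 hm4' => ?_
    rw [ensures_bind]
    refine (ensures_forEach (fun l m' t =>
      m' step = {v | v ∈ G.cpreIn y.opp A (m₃ cur) ∧ ∀ k ∈ l, G.shiftedPrio y v ≠ k} ∧
      (∀ s, s ≠ step → s ≠ esc → m' s = m₃ s) ∧ t = 0) ?_ ?_).mono ?_
    · exact ⟨by rw [hm4, hE3.game]; simp, hm4', rfl⟩
    · rintro l₁ k l₂ hl m₅ _ ⟨h7, h8, rfl⟩
      have hk : k ∈ (List.range c').filter fun k => level r < k := by rw [hl]; simp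
      rw [List.mem_filter, List.mem_range, decide_eq_true_eq] at hk
      rw [ensures_diff]
      refine ⟨⟨hstep, hstep, hU.prio k hk.1⟩, ?_, fun s h9 h10 => ?_, rfl⟩
      · rw [Function.update_self, h7, h8 _ (by simp) (by simp), k6 (prio (k - shift y)) id, hI.2]
        ext v
        simp only [Set.mem_sdiff, mem_prioSet_sub_shift (show 1 ≤ k by omega), Set.mem_ofPred_eq,
          List.mem_append, List.mem_singleton]
        constructor
        · rintro ⟨⟨hv, h11⟩, h12⟩
          exact ⟨hv, fun i hi => hi.elim (h11 i) fun hi => hi ▸ h12⟩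
        · rintro ⟨hv, h11⟩
          exact ⟨⟨hv, fun i hi => h11 i (.inl hi)⟩, h11 k (.inr rfl)⟩
      · rw [Function.update_of_ne h9, h8 s h9 h10]
    · rintro _ m₅ _ ⟨h7, h8, rfl⟩
      have hs : m₅ step =
          {v | v ∈ G.cpreIn y.opp A (m₃ cur) ∧ G.shiftedPrio y v ≤ level r} := by
        rw [h7]
        ext v
        simp only [Set.mem_ofPred_eq, List.mem_filter, List.mem_range, decide_eq_true_eq]
        refine and_congr_right fun hv => ⟨fun h9 => ?_, fun h9 k hk => by omega⟩
        by_contra hlt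
        exact h9 _ ⟨hc v hv.1, not_le.1 hlt⟩ rfl
      have e1 : m₅ cur = m₃ cur := h8 _ (by simp) (by simp)
      have e2 : m₅ old = m₃ old := h8 _ (by simp) (by simp)
      simp only [ensures_bind, ensures_subset, ensures_union, ensures_pure]
      refine ⟨⟨hstep, hcur⟩, fun b hb => ⟨⟨hcur, hcur, hstep⟩, fun hfix => ?_, fun hfix => ?_⟩⟩ <;>
      simp only [Function.update_self, Function.update_of_ne (show old ≠ cur by simp), e1, e2]
      · rw [← Bool.not_eq_true, hb, e1] at hfix
        have hlt : (m₃ cur).ncard < (m₃ cur ∪ m₅ step).ncard :=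
          Set.ncard_lt_ncard ⟨Set.subset_union_left,
            fun h => hfix (Set.subset_union_right.trans h)⟩
        have hle := Set.ncard_le_card (m₃ cur ∪ m₅ step)
        refine ⟨⟨k1, k2.trans Set.subset_union_left, Set.union_subset k3 fun v hv => ?_,
          k4.trans Set.subset_union_left, fun T hT hcl => ?_, fun s hs => ?_, by omega⟩, by omega⟩
        · rw [hs] at hv; exact hv.1.1
        · refine Set.union_subset (k5 T hT hcl) fun v hv => ?_
          rw [hs] at hv
          exact hcl.2 v (cpreIn_mono (k5 T hT hcl) hv.1) hv.2
        · rw [Function.update_of_ne, h8 s, k6 s hs] <;>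
          · rintro rfl; exact hs trivial
      · rw [hb, e1] at hfix
        rw [Set.union_eq_self_of_subset_right hfix]
        refine ⟨k1, k2, k3, ⟨fun j hj hjr v hv hp => k4 (h4 j ?_ v hv hp), fun v hv hp => ?_⟩, k5,
          fun s hs => ?_, by omega⟩
        · rw [List.mem_filter, List.mem_map, decide_eq_true_eq]
          exact ⟨⟨j, mem_oddIndices.2 hj, rfl⟩, hjr⟩
        · exact hfix (hs ▸ ⟨hv, hp⟩)
        · rw [Function.update_of_ne, h8 s, k6 s hs] <;>
          · rintro rfl; exact hs trivial

end BigStep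

/-! ### Initialising and saving ranks -/

namespace BigStep

open Prog Reg ParityGame Rank

variable {V : Type*} {c c' : ℕ} {G : ParityGame V c} {U : Finset Reg} {m : Reg → Set V}
  {N : Fin c' → ℕ} {h : ℕ} {X : Reg} {A : Set V} {ρ : V → WithTop (Rank c')}
  {r : WithTop (Rank c')} {y : Player}

theorem ensures_initRanks (hU : HasRegs U y N X) :
    Ensures G U (initRanks N X) m fun _ m' t =>
      Encodes N X (m X) (fun _ => ((zero : Rank c') : WithTop (Rank c'))) m' ∧
      (∀ s, s.Persistent → m' s = m s) ∧ t = 0 := by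
  have htop : top ∈ U := hU.aux _ trivial
  have hXc : ∀ j x, X ≠ coord j x := by rintro j x rfl; exact hU.persistent
  rw [initRanks, ensures_bind]
  refine (ensures_forEach (fun l m' t =>
    (∀ j ∈ l, ∀ x ≤ N j, m' (coord j x) = {v | v ∈ m X ∧ x = 0}) ∧
    (∀ s, (∀ j x, s ≠ coord j x) → m' s = m s) ∧ t = 0) ⟨by simp, fun _ _ => rfl, rfl⟩ ?_).mono ?_
  · rintro l₁ j l₂ hl m₁ _ ⟨h1, h2, rfl⟩
    have hj : Odd (j : ℕ) := mem_oddIndices.1 (by rw [hl]; simp)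
    rw [ensures_bind]
    refine (ensures_forEach (fun l m' t =>
      (∀ x ∈ l, m' (coord j x) = ∅) ∧ (∀ s, (∀ x, s ≠ coord j x) → m' s = m₁ s) ∧ t = 0)
      ⟨by simp, fun _ _ => rfl, rfl⟩ ?_).mono ?_
    · rintro l₃ x l₄ hl' m₂ _ ⟨h3, h4, rfl⟩
      have hx : x ∈ List.range (N j + 1) := by rw [hl']; simp
      rw [ensures_clear]
      refine ⟨hU.coord j hj x (Nat.lt_succ_iff.1 (List.mem_range.1 hx)), fun i hi => ?_,
        fun s hs => by rw [Function.update_of_ne (hs x), h4 s hs], rfl⟩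
      by_cases hix : i = x
      · rw [hix, Function.update_self]
      · rw [Function.update_of_ne (by simpa using hix)]
        exact h3 i ((List.mem_append.1 hi).resolve_right (by simpa using hix))
    · rintro _ m₂ _ ⟨h3, h4, rfl⟩
      rw [ensures_copy]
      refine ⟨⟨hU.coord j hj 0 (Nat.zero_le _), hU.mem⟩, fun i hi x hx => ?_, fun s hs => ?_, rfl⟩
      · by_cases hij : i = j
        · subst hij
          by_cases hx0 : x = 0
          · subst hx0
            rw [Function.update_self, h4 _ (hXc _), h2 _ hXc]
            simp
          · rw [Function.update_of_ne (by simpa using hx0),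
              h3 x (List.mem_range.2 (Nat.lt_succ_iff.2 hx))]
            simp [hx0]
        · have hne : (i : ℕ) ≠ j := fun h => hij (Fin.ext h)
          rw [Function.update_of_ne (by simp [hne]), h4 _ (by simp [hne])]
          exact h1 i ((List.mem_append.1 hi).resolve_right (by simpa using hij)) x hx
      · rw [Function.update_of_ne (hs _ _), h4 s (hs _), h2 s hs]
  · rintro _ m₁ _ ⟨h1, h2, rfl⟩
    rw [ensures_clear]
    refine ⟨htop, ⟨?_, by simp, fun j hj x hx => ?_⟩, fun s hs => ?_, rfl⟩
    · rw [Function.update_of_ne, h2 X hXc]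
      rintro rfl
      exact hU.persistent
    · rw [Function.update_of_ne (by simp), h1 j (mem_oddIndices.2 hj) x hx]
      ext v
      refine and_congr_right fun _ => ⟨fun h => ⟨zero, rfl, h.symm⟩, ?_⟩
      rintro ⟨q, hq, rfl⟩
      rw [← WithTop.coe_injective hq, zero_apply]
    · rw [Function.update_of_ne, h2 s]
      · rintro j x rfl; exact hs
      · rintro rfl; exact hs

-- The vertices of `a` are first removed from all coordinate sets and then added to those of `r`. By
-- `hatop` none of them had rank `⊤`, so nothing is ever removed from `top`.
open Classical in
theorem ensures_saveRank (hU : HasRegs U y N X) (hE : Encodes N X A ρ m)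
    (hr : IsValue (domain N h) r) {a : Set V} (ha : m cur \ m old = a) (haA : a ⊆ A)
    (hatop : ∀ v ∈ a, ρ v ≠ ⊤) :
    Ensures G U (saveRank N r) m fun _ m' t =>
      Encodes N X A (fun v => if v ∈ a then r else ρ v) m' ∧
      (∀ s, s.Persistent → m' s = m s) ∧ t = 0 := by
  have haux : aux ∈ U := hU.aux _ trivial
  have hcurU : cur ∈ U := hU.aux _ trivial
  have holdU : old ∈ U := hU.aux _ trivial
  have htopU : top ∈ U := hU.aux _ trivial
  have hXc : ∀ j x, X ≠ coord j x := by rintro j x rfl; exact hU.persistent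
  have hXa : X ≠ aux := by rintro rfl; exact hU.persistent
  have hXt : X ≠ top := by rintro rfl; exact hU.persistent
  simp only [saveRank, ensures_bind, ensures_diff, ha]
  refine ⟨⟨haux, hcurU, holdU⟩, ?_⟩
  -- remove the vertices from the sets for their old ranks
  refine (ensures_forEach (fun l m' t =>
    (∀ j ∈ l, ∀ x ≤ N j, m' (coord j x) = m (coord j x) \ a) ∧
    (∀ s, (∀ j ∈ l, ∀ x ≤ N j, s ≠ coord j x) → m' s = Function.update m aux a s) ∧ t = 0)
    ⟨by simp, fun _ _ => rfl, rfl⟩ ?_).mono ?_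
  · rintro l₁ j l₂ hl m₁ _ ⟨h1, h2, rfl⟩
    have hj : Odd (j : ℕ) := mem_oddIndices.1 (by rw [hl]; simp)
    have hjl : j ∉ l₁ := by
      have hnd : (oddIndices c').Nodup := (List.nodup_finRange c').filter _
      rw [hl, List.nodup_append] at hnd
      exact fun hj => hnd.2.2 j hj j (by simp) rfl
    refine (ensures_forEach (fun l m' t =>
      (∀ x ∈ l, m' (coord j x) = m (coord j x) \ a) ∧
      (∀ s, (∀ x ∈ l, s ≠ coord j x) → m' s = m₁ s) ∧ t = 0)
      ⟨by simp, fun _ _ => rfl, rfl⟩ ?_).mono ?_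
    · rintro l₃ x l₄ hl' m₂ _ ⟨h3, h4, rfl⟩
      have hx : x ∈ List.range (N j + 1) := by rw [hl']; simp
      have hxl : x ∉ l₃ := by
        have hnd : (List.range (N j + 1)).Nodup := List.nodup_range
        rw [hl', List.nodup_append] at hnd
        exact fun hx => hnd.2.2 x hx x (by simp) rfl
      have hjx := hU.coord j hj x (Nat.lt_succ_iff.1 (List.mem_range.1 hx))
      rw [ensures_diff]
      refine ⟨⟨hjx, hjx, haux⟩, fun i hi => ?_, fun s hs => ?_, rfl⟩
      · by_cases hix : i = x
        · subst hix
          rw [Function.update_self, h4 _ (fun k hk => by simpa using fun h : i = k => hxl (h ▸ hk)),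
            h4 aux (by simp), h2 aux (by simp), Function.update_self, h2, Function.update_of_ne]
          · simp
          · intro k hk x' _
            have hkj : j ≠ k := fun h => hjl (h ▸ hk)
            simp [Fin.val_inj, hkj]
        · rw [Function.update_of_ne (by simpa using hix)]
          exact h3 i ((List.mem_append.1 hi).resolve_right (by simpa using hix))
      · rw [Function.update_of_ne (hs x (by simp)), h4 s fun k hk => hs k (by simp [hk])]
    · rintro _ m₂ _ ⟨h3, h4, rfl⟩
      refine ⟨fun i hi x hx => ?_, fun s hs => ?_, rfl⟩
      · by_cases hij : i = j
        · subst hij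
          exact h3 x (List.mem_range.2 (Nat.lt_succ_iff.2 hx))
        · have hne : (i : ℕ) ≠ j := fun h => hij (Fin.ext h)
          rw [h4 _ (by simp [hne])]
          exact h1 i ((List.mem_append.1 hi).resolve_right (by simpa using hij)) x hx
      · rw [h4 s fun x hx => hs j (by simp) x (Nat.lt_succ_iff.1 (List.mem_range.1 hx)),
          h2 s fun i hi => hs i (by simp [hi])]
  rintro _ m₁ _ ⟨h1, h2, rfl⟩
  have h1' : ∀ j : Fin c', Odd (j : ℕ) → ∀ x ≤ N j, m₁ (coord j x) =
      {v | v ∈ A ∧ v ∉ a ∧ ∃ q : Rank c', ρ v = q ∧ q j = x} := by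
    intro j hj x hx
    rw [h1 j (mem_oddIndices.2 hj) x hx, hE.coord j hj x hx]
    ext v
    simp only [Set.mem_sdiff, Set.mem_ofPred_eq]
    tauto
  have h2' : ∀ s, s ≠ aux → (∀ j x, s ≠ coord j x) → m₁ s = m s := fun s hs hs' => by
    rw [h2 s fun j _ x _ => hs' j x, Function.update_of_ne hs]
  have h3 : m₁ aux = a := by rw [h2 aux (by simp), Function.update_self]
  have hfr : ∀ s, s.Persistent → m₁ s = m s := by
    intro s hs
    refine h2' s ?_ ?_
    · rintro rfl; exact hs
    · rintro j x rfl; exact hs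
  cases r with
  | top =>
    simp only [ensures_union]
    refine ⟨⟨htopU, htopU, haux⟩, ⟨?_, ?_, fun j hj x hx => ?_⟩, fun s hs => ?_, trivial⟩
    · rw [Function.update_of_ne hXt, hfr X hU.persistent, hE.game]
    · rw [Function.update_self, h3, h2' top (by simp) (by simp), hE.top]
      ext v
      have := @haA v
      by_cases hv : v ∈ a <;> simp_all
    · rw [Function.update_of_ne (by simp), h1' j hj x hx]
      ext v
      by_cases hv : v ∈ a <;> simp [hv]
    · rw [Function.update_of_ne, hfr s hs]
      rintro rfl; exact hs
  | coe r =>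
    have hrM := (mem_domain.1 (hr r rfl)).1
    refine (ensures_forEach (fun l m' t =>
      (∀ j ∈ l, ∀ x ≤ N j, m' (coord j x) = {v | v ∈ m₁ (coord j x) ∨ v ∈ a ∧ r j = x}) ∧
      (∀ s, (∀ j ∈ l, s ≠ coord j (r j)) → m' s = m₁ s) ∧ t = 0)
      ⟨by simp, fun _ _ => rfl, rfl⟩ ?_).mono ?_
    · rintro l₁ j l₂ hl m₂ _ ⟨h4, h5, rfl⟩
      have hj : Odd (j : ℕ) := mem_oddIndices.1 (by rw [hl]; simp)
      have hjl : j ∉ l₁ := by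
        have hnd : (oddIndices c').Nodup := (List.nodup_finRange c').filter _
        rw [hl, List.nodup_append] at hnd
        exact fun hj => hnd.2.2 j hj j (by simp) rfl
      have hjx := hU.coord j hj _ (hrM j)
      rw [ensures_union]
      have h6 : ∀ x, m₂ (coord j x) = m₁ (coord j x) := fun x => h5 _ fun k hk => by
        have hkj : j ≠ k := fun h => hjl (h ▸ hk)
        simp [Fin.val_inj, hkj]
      refine ⟨⟨hjx, hjx, haux⟩, fun i hi x hx => ?_, fun s hs => ?_, rfl⟩
      · by_cases hij : i = j
        · subst hij
          by_cases hxr : x = r i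
          · subst hxr
            rw [Function.update_self, h6, h5 aux (by simp), h3]
            ext v
            simp
          · rw [Function.update_of_ne (by simpa using hxr), h6]
            ext v
            simp [Ne.symm hxr]
        · have hne : (i : ℕ) ≠ j := fun h => hij (Fin.ext h)
          rw [Function.update_of_ne (by simp [hne])]
          exact h4 i ((List.mem_append.1 hi).resolve_right (by simpa using hij)) x hx
      · rw [Function.update_of_ne (hs j (by simp)), h5 s fun i hi => hs i (by simp [hi])]
    · rintro _ m₂ _ ⟨h4, h5, rfl⟩
      refine ⟨⟨?_, ?_, fun j hj x hx => ?_⟩, fun s hs => ?_, rfl⟩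
      · rw [h5 X fun _ _ => hXc _ _, hfr X hU.persistent, hE.game]
      · rw [h5 top (by simp), h2' top (by simp) (by simp), hE.top]
        ext v
        by_cases hv : v ∈ a
        · simp [hv, hatop v hv]
        · simp [hv]
      · rw [h4 j (mem_oddIndices.2 hj) x hx, h1' j hj x hx]
        ext v
        have := @haA v
        by_cases hv : v ∈ a
        · simp only [Set.mem_ofPred_eq, hv, this hv, not_true_eq_false, false_and, and_false,
            true_and, false_or, if_true]
          exact ⟨fun h => ⟨r, rfl, h⟩, fun ⟨q, hq, h⟩ => by rwa [WithTop.coe_injective hq]⟩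
        · simp [hv]
      · rw [h5 s, hfr s hs]
        rintro j - rfl
        exact hs

end BigStep

/-! ### The dominion search: invariant, potential and cost -/

namespace BigStep

open Prog Reg ParityGame Rank

variable {V : Type*} {c c' : ℕ} {G : ParityGame V c} {U : Finset Reg} {m : Reg → Set V}
  {N : Fin c' → ℕ} {h : ℕ} {X : Reg} {A : Set V} {ρ : V → WithTop (Rank c')}
  {r : WithTop (Rank c')} {y : Player}

/-- The sum of the positions of the ranks of all vertices. -/
noncomputable def totalIndex [Fintype V] (M : Finset (Rank c')) (ρ : V → WithTop (Rank c')) : ℕ :=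
  ∑ v, index M (ρ v)

theorem totalIndex_le [Fintype V] (M : Finset (Rank c')) (ρ : V → WithTop (Rank c')) :
    totalIndex M ρ ≤ Fintype.card V * M.card := by
  simpa [totalIndex] using Finset.sum_le_card_nsmul Finset.univ _ _
    fun v _ => index_le_card M (ρ v)

open Classical in
/-- Raising the rank of the vertices in `a` to `r`. -/
noncomputable def raise (a : Set V) (r : WithTop (Rank c')) (ρ : V → WithTop (Rank c')) (v : V) :
    WithTop (Rank c') :=
  if v ∈ a then r else ρ v

section raise

variable {a : Set V} {r₀ : WithTop (Rank c')}

theorem isValue_raise {M : Finset (Rank c')} (hr : IsValue M r) (hρ : ∀ v, IsValue M (ρ v))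
    (v : V) : IsValue M (raise a r ρ v) := by
  unfold raise
  split_ifs
  exacts [hr, hρ v]

theorem totalIndex_raise [Fintype V] {M : Finset (Rank c')} (hρ : ∀ v, IsValue M (ρ v))
    (ha : ∀ v ∈ a, ρ v < r) : totalIndex M ρ + a.ncard ≤ totalIndex M (raise a r ρ) := by
  classical
  have : a.ncard = ∑ v : V, if v ∈ a then 1 else 0 := by
    rw [Finset.sum_boole, Set.ncard_eq_toFinset_card']
    simp [Set.toFinset]
  rw [this, totalIndex, ← Finset.sum_add_distrib]
  refine Finset.sum_le_sum fun v _ => ?_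
  unfold raise
  split_ifs with hv
  · exact index_lt_index (hρ v) (ha v hv)
  · exact le_rfl

/-- A single vertex lifted from a rank at most `r₀` to `r` gains the whole difference of the
positions. This pays for a return of the search from `r` to just above `r₀`. -/
theorem totalIndex_raise_of_le [Fintype V] {M : Finset (Rank c')} (ha : ∀ v ∈ a, ρ v < r) {v : V}
    (hv : v ∈ a) (hr₀ : ρ v ≤ r₀) :
    totalIndex M ρ + index M r ≤ totalIndex M (raise a r ρ) + index M r₀ := by
  classical
  rw [totalIndex, totalIndex, ← Finset.add_sum_erase _ _ (Finset.mem_univ v),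
    ← Finset.add_sum_erase _ (fun v => index M (raise a r ρ v)) (Finset.mem_univ v)]
  have h1 : index M (raise a r ρ v) = index M r := by simp [raise, hv]
  have h2 : index M (ρ v) ≤ index M r₀ := index_mono M hr₀
  have h3 : ∑ w ∈ Finset.univ.erase v, index M (ρ w) ≤
      ∑ w ∈ Finset.univ.erase v, index M (raise a r ρ w) := by
    refine Finset.sum_le_sum fun w _ => index_mono M ?_
    unfold raise
    split_ifs with hw
    exacts [(ha w hw).le, le_rfl]
  omega

/-- Raising vertices whose ranks are already at least `r₀` leaves all level sets up to `r₀`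
unchanged, so the ranks up to `r₀` need not be processed again. -/
theorem le_raise_iff (ha : ∀ v ∈ a, r₀ ≤ ρ v) (hr : r₀ < r) {q : WithTop (Rank c')} (hq : q ≤ r₀)
    (v : V) : q ≤ raise a r ρ v ↔ q ≤ ρ v := by
  unfold raise
  split_ifs with hv
  · exact ⟨fun _ => hq.trans (ha v hv), fun _ => hq.trans hr.le⟩
  · rfl

theorem isUpdateClosed_raise {M : Finset (Rank c')} (ha : ∀ v ∈ a, r₀ ≤ ρ v) (hr : r₀ < r)
    {s : WithTop (Rank c')} (hs : ∀ j : Fin c', (j : ℕ) ≤ level s → decrAt M j s ≤ r₀) {T : Set V}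
    (h : G.IsUpdateClosed y A M ρ s T) : G.IsUpdateClosed y A M (raise a r ρ) s T := by
  refine ⟨fun j hj hjs v hv => h.1 j hj hjs v ?_, h.2⟩
  simpa only [le_raise_iff ha hr (hs j hjs)] using hv

end raise

theorem bounds_eq_zero (size : ℕ → ℕ) (j : Fin (c' + shift y)) (hj : ¬ Odd (j : ℕ)) :
    bounds y size c' j = 0 := by simp [bounds, hj]

/-- The state of the dominion search when the ranks in `P` have been processed. -/
structure IsSearchState [Fintype V] (G : ParityGame V c) (y : Player) (N : Fin c' → ℕ) (h : ℕ)
    (X : Reg) (A : Set V) (ρ : V → WithTop (Rank c')) (P : Set (WithTop (Rank c')))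
    (m : Reg → Set V) : Prop where
  encodes : Encodes N X A ρ m
  value : ∀ v, IsValue (domain N h) (ρ v)
  le_measure : ∀ μ : V → WithTop (Rank c'), G.IsMeasure y A μ →
    (∀ v, IsValue (domain N h) (μ v)) → ∀ v ∈ A, ρ v ≤ μ v
  closed : ∀ s, IsValue (domain N h) s → s ≠ (zero : Rank c') → s ∈ P →
    G.IsUpdateClosed y A (domain N h) ρ s {v | v ∈ A ∧ s ≤ ρ v}

/-- Minimality of `C` keeps the ranking below every measure. Ranks up to `r₀` remain closed because
their level sets do not change. The rank `r` itself is closed, with level set `C`, if the ranks read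
by its update are at most `r₀`. -/
theorem IsSearchState.raise [Fintype V] (hS : IsSearchState G y N h X A ρ (Set.Iio r) m)
    (hr : IsValue (domain N h) r) (h0 : r ≠ (zero : Rank c'))
    (hc : ∀ v ∈ A, G.shiftedPrio y v < c')
    {C : Set V} (hC : {v | v ∈ A ∧ r ≤ ρ v} ⊆ C) (hCA : C ⊆ A)
    (hmin : ∀ T, {v | v ∈ A ∧ r ≤ ρ v} ⊆ T →
      G.IsUpdateClosed y A (domain N h) ρ r T → C ⊆ T)
    {r₀ : WithTop (Rank c')} (hr₀ : r₀ < r) (hCr₀ : ∀ v ∈ C, r₀ ≤ ρ v) {m' : Reg → Set V}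
    (hE : Encodes N X A (BigStep.raise (C \ {v | v ∈ A ∧ r ≤ ρ v}) r ρ) m')
    {P : Set (WithTop (Rank c'))} (hr' : ∀ s, IsValue (domain N h) s → s ∈ P → s ≠ (zero : Rank c') →
      s ≤ r₀ ∨ s = r ∧ G.IsUpdateClosed y A (domain N h) ρ r C ∧
        ∀ j : Fin c', (j : ℕ) ≤ level r → decrAt (domain N h) j r ≤ r₀) :
    IsSearchState G y N h X A (BigStep.raise (C \ {v | v ∈ A ∧ r ≤ ρ v}) r ρ) P m' := by
  have ha : ∀ v ∈ C \ {v | v ∈ A ∧ r ≤ ρ v}, r₀ ≤ ρ v := fun v hv => hCr₀ v hv.1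
  refine ⟨hE, isValue_raise hr hS.value, fun μ hμ hM v hv => ?_, fun s hs hs0 hlt => ?_⟩
  · have hle := hS.le_measure μ hμ hM
    unfold BigStep.raise
    split_ifs with hva
    · have hcl := hμ.isUpdateClosed hM hle hc hr h0
      exact (hmin {v | v ∈ A ∧ r ≤ μ v} (fun v hv => ⟨hv.1, hv.2.trans (hle v hv.1)⟩) hcl hva.1).2
    · exact hle v hv
  · rcases hr' s hs hlt hs0 with hsr | ⟨rfl, hcl, hd⟩
    · simp only [le_raise_iff ha hr₀ hsr]
      refine isUpdateClosed_raise ha hr₀ (fun j hj => ?_) (hS.closed s hs hs0 (hsr.trans_lt hr₀))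
      exact (decrAt_lt hs ((le_level_iff j.2).1 hj) hs0).le.trans hsr
    · have : {v | v ∈ A ∧ s ≤ BigStep.raise (C \ {v | v ∈ A ∧ s ≤ ρ v}) s ρ v} = C := by
        ext v
        unfold BigStep.raise
        constructor
        · rintro ⟨hv, hle⟩
          split_ifs at hle with hva
          exacts [hva.1, hC ⟨hv, hle⟩]
        · intro hv
          refine ⟨hCA hv, ?_⟩
          split_ifs with hva
          · exact le_rfl
          · by_contra hle
            exact hva ⟨hv, fun h => hle h.2⟩
      rw [this]
      exact isUpdateClosed_raise ha hr₀ hd hcl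

/-- The potential is `index M r + 2 * totalIndex M ρ`. A round that raises the vertices in `C \ S`
costs at most `K + 2 * (C \ S).ncard`, while the potential grows by at least `1 + (C \ S).ncard`
unless the search ends. Of the two copies of the total, one pays for the added vertices and the
other for going back to a smaller rank. -/
theorem ensures_dominion [Fintype V] {size : ℕ → ℕ} {k : ℕ}
    (hU : HasRegs U y (bounds y size k) X) (hI : HasInput G m)
    (hsize : ∀ i, size i = (G.prioSet i).ncard) (hA : G.IsSubgame (m X))
    (hk : ∀ v ∈ m X, (G.prio v : ℕ) < k) :
    Ensures G U (dominion size y k h X) m fun _ m' t =>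
      G.IsDominion y (m X) (m' dom) ∧
      (∀ D, G.IsDominion y (m X) D → D.ncard ≤ h → D ⊆ m' dom) ∧
      (∀ s, s.Persistent → m' s = m s) ∧
      t ≤ (2 * (k + shift y) + 2) *
        ((2 * Fintype.card V + 1) * (domain (bounds y size k) h).card + 1) := by
  set N := bounds y size k with hNdef
  set M := domain N h with hMdef
  set K := 2 * (k + shift y) + 2 with hK
  obtain ⟨A, hAX⟩ : ∃ A, m X = A := ⟨_, rfl⟩
  rw [hAX] at hA hk ⊢
  have hc : ∀ v ∈ A, G.shiftedPrio y v < k + shift y := fun v hv =>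
    Nat.add_lt_add_right (hk v hv) _
  have hN : ∀ j : Fin (k + shift y), ¬ Odd (j : ℕ) → N j = 0 := bounds_eq_zero size
  have hXd : X ≠ dom := by rintro rfl; exact hU.persistent
  have hdom : dom ∈ U := hU.aux _ trivial
  have htop : top ∈ U := hU.aux _ trivial
  have hcur : cur ∈ U := hU.aux _ trivial
  have hcmp : Reg.cmp ∈ U := hU.aux _ trivial
  simp only [dominion, ensures_bind]
  refine (ensures_initRanks hU).mono ?_
  rintro _ m₁ _ ⟨hE1, hm1, rfl⟩
  rw [hAX] at hE1
  have htot : ∀ (ρ : V → WithTop (Rank (k + shift y))) r, index M r + 2 * totalIndex M ρ ≤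
      (2 * Fintype.card V + 1) * M.card := by
    intro ρ r
    have h1 := totalIndex_le M ρ
    have h2 := index_le_card M r
    nlinarith
  refine (ensures_loop (Q := fun _ m' t =>
      (∃ ρ, IsSearchState G y N h X A ρ Set.univ m') ∧
      (∀ s, s.Persistent → m' s = m s) ∧ t ≤ K * ((2 * Fintype.card V + 1) * M.card + 1))
    (fun r m' t i => ∃ ρ, IsSearchState G y N h X A ρ (Set.Iio r) m' ∧ IsValue M r ∧
      r ≠ (zero : Rank (k + shift y)) ∧ (∀ s, s.Persistent → m' s = m s) ∧
      t ≤ K * (index M r + 2 * totalIndex M ρ) ∧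
      index M r + 2 * totalIndex M ρ + i = (2 * Fintype.card V + 1) * M.card)
    (k := (2 * Fintype.card V + 1) * M.card - (index M (incr M (zero : Rank (k + shift y))) +
      2 * totalIndex M fun _ : V => ((zero : Rank (k + shift y)) : WithTop _)))
    ⟨_, ⟨hE1, fun _ => isValue_coe.2 zero_mem, fun μ _ _ v _ => coe_zero_le _, ?_⟩, isValue_incr,
      (zero_lt_incr _).ne', hm1, Nat.zero_le _, Nat.add_sub_cancel' (htot _ _)⟩ ?_).mono ?_
  -- Nothing has to be checked at the start, since no nonzero value lies below the first rank to be
  -- processed.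
  · intro s hs hs0 hlt
    exact absurd (incr_le hs (lt_of_le_of_ne (coe_zero_le s) hs0.symm)) hlt.not_ge
  · rintro r m₂ t i ⟨ρ, hS, hr, h0, hm2, ht, hi⟩
    have hI2 := hI.congr hm2
    simp only [ensures_bind]
    refine (ensures_updateRank hU hS.encodes hI2 hS.value hN hr h0 hc).mono ?_
    rintro _ m₃ t₃ ⟨hold, hSC, hCA, hcl, hmin, hm3, ht3⟩
    have hE3 := hS.encodes.congr hU.persistent hm3
    have hdr := isValue_decr hr h0
    refine (ensures_loadRank hU hE3 hS.value hN hdr (.inr rfl)).mono ?_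
    rintro _ m₄ _ ⟨hm4, hm4', rfl⟩
    set C := m₃ cur with hCdef
    set S := {v | v ∈ A ∧ r ≤ ρ v} with hSdef
    have hfr4 : ∀ s, ¬ s.IsScratch → m₄ s = m₂ s := by
      intro s hs
      rw [hm4' s, hm3 s hs] <;>
      · rintro rfl; exact hs trivial
    have hE4 := hS.encodes.congr hU.persistent hfr4
    have hcur4 : m₄ cur = C := hm4' _ (by simp) (by simp) (by simp)
    have hold4 : m₄ old = S := (hm4' _ (by simp) (by simp) (by simp)).trans hold
    have hsub : ∀ v ∈ C \ S, ρ v < r := fun v hv => by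
      by_contra hle
      exact hv.2 ⟨hCA hv.1, not_lt.1 hle⟩
    have hcard : (C \ S).ncard + S.ncard = C.ncard := Set.ncard_sdiff_add_ncard_of_subset hSC
    have htot1 := totalIndex_raise (M := M) hS.value hsub
    rw [ensures_subset]
    refine ⟨⟨hcur, hcmp⟩, fun b hb => ?_⟩
    rw [hcur4, hm4] at hb
    cases b with
    -- All of `C` already had rank at least `decr M r`, so no smaller level set is affected and the
    -- search moves on.
    | true =>
      have hCd : ∀ v ∈ C, decr M r ≤ ρ v := fun v hv => (hb.1 rfl hv).2
      simp only [if_true, ensures_bind, ensures_pure]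
      refine (ensures_saveRank hU hE4 hr (a := C \ S) (by rw [hcur4, hold4])
        (Set.sdiff_subset.trans hCA) fun v hv => ((hsub v hv).trans_le le_top).ne).mono ?_
      rintro _ m₅ _ ⟨hE5, hm5, rfl⟩
      have hdrr : decr M r < r := decr_lt hr h0
      have hS5 : ∀ P : Set (WithTop (Rank (k + shift y))), (∀ s, IsValue M s → s ∈ P → s ≤ r) →
          IsSearchState G y N h X A (raise (C \ S) r ρ) P m₅ := by
        intro P hr'
        refine hS.raise hr h0 hc hSC hCA hmin hdrr hCd hE5 fun s hs hsr' hs0 => ?_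
        rcases (hr' s hs hsr').eq_or_lt with rfl | hlt
        · refine .inr ⟨rfl, hcl, fun j hj => ?_⟩
          have hmap := (le_level_iff j.2).1 hj
          exact le_decr hr h0 (isValue_decrAt hr hmap h0) (decrAt_lt hr hmap h0)
        · exact .inl (le_decr hr h0 hs hlt)
      have hm5' : ∀ s, s.Persistent → m₅ s = m s := fun s hs => by
        rw [hm5 s hs, hfr4 s hs.not_isScratch, hm2 s hs]
      refine ⟨fun r' hr' => ?_, fun _ hr' => ?_⟩
      · split_ifs at hr' with hrt
        obtain rfl := Sum.inl.inj hr'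
        have hlt := index_lt_index hr (lt_incr (M := M) hrt)
        refine ⟨(2 * Fintype.card V + 1) * M.card - (index M (incr M r) +
          2 * totalIndex M (raise (C \ S) r ρ)), ?_, _, hS5 _ ?_, isValue_incr,
          (zero_lt_incr _).ne', hm5', ?_, Nat.add_sub_cancel' (htot _ _)⟩
        · have := htot (raise (C \ S) r ρ) (incr M r)
          omega
        · intro s hs hlt'
          by_contra hle
          exact (incr_le hs (not_le.1 hle)).not_gt hlt'
        · have : index M r + 2 * totalIndex M ρ + (1 + (C \ S).ncard) ≤
              index M (incr M r) + 2 * totalIndex M (raise (C \ S) r ρ) := by omega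
          refine le_trans ?_ (Nat.mul_le_mul_left K this)
          rw [Nat.mul_add K _ (1 + _)]
          have h2 : K + 2 * (C \ S).ncard ≤ K * (1 + (C \ S).ncard) := by
            rw [Nat.mul_add, Nat.mul_one]
            exact Nat.add_le_add_left (Nat.mul_le_mul_right _ (by omega)) _
          omega
      · split_ifs at hr' with hrt
        subst hrt
        refine ⟨⟨_, hS5 _ fun s _ _ => le_top⟩, hm5', ?_⟩
        · have h1 := htot (raise (C \ S) ⊤ ρ) ⊤
          -- Since `⊤` has no successor, the index does not grow in the last round; this is the
          -- reason for the extra `1` in the bound.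
          have : index M ⊤ + 2 * totalIndex M ρ + (1 + (C \ S).ncard) ≤
              (2 * Fintype.card V + 1) * M.card + 1 := by omega
          refine le_trans ?_ (Nat.mul_le_mul_left K this)
          rw [Nat.mul_add K _ (1 + _)]
          have h2 : K + 2 * (C \ S).ncard ≤ K * (1 + (C \ S).ncard) := by
            rw [Nat.mul_add, Nat.mul_one]
            exact Nat.add_le_add_left (Nat.mul_le_mul_right _ (by omega)) _
          omega
    -- Some vertex of `C` had a rank below `decr M r`. The search returns to the largest value `r''`
    -- such that all of `C` had rank at least `r''`, and continues with its successor. The vertex of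
    -- `C` with rank at most `r''` is the one for `totalIndex_raise_of_le`.
    | false =>
      simp only [Bool.false_eq_true, if_false, ensures_bind, ensures_pure]
      refine (ensures_loop (Q := fun r'' m' t =>
          IsValue M r'' ∧ r'' < r ∧ (∀ v ∈ C, r'' ≤ ρ v) ∧ (∃ v ∈ C, ρ v ≤ r'') ∧
          (∀ s, s ≠ Reg.cmp → s ≠ agree → s ≠ aux → m' s = m₄ s) ∧ t = 0)
        (fun r' m' t i => IsValue M r' ∧ r' < r ∧ (∃ v ∈ C, ρ v < r') ∧
          (∀ s, s ≠ Reg.cmp → s ≠ agree → s ≠ aux → m' s = m₄ s) ∧ t = 0 ∧ index M r' = i)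
        (k := index M (decr M r)) ⟨hdr, decr_lt hr h0, ?_, fun _ _ _ _ => rfl, rfl, rfl⟩ ?_).mono ?_
      · by_contra! hno
        exact absurd (hb.2 fun v hv => ⟨hCA hv, not_lt.1 (hno v hv)⟩) (by simp)
      · rintro r' m₅ t₅ i ⟨hr', hlt, ⟨v, hvC, hv⟩, hm5, rfl, rfl⟩
        have h0' : r' ≠ (zero : Rank (k + shift y)) := fun h0' =>
          (coe_zero_le (ρ v)).not_gt (h0' ▸ hv)
        have hfr5 : ∀ s, ¬ s.IsScratch → m₅ s = m₂ s := by
          intro s hs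
          rw [hm5 s, hfr4 s hs] <;>
          · rintro rfl; exact hs trivial
        have hE5 := hS.encodes.congr hU.persistent hfr5
        simp only [ensures_bind, ensures_pure, ensures_subset]
        refine (ensures_loadRank hU hE5 hS.value hN (isValue_decr hr' h0') (.inr rfl)).mono ?_
        rintro _ m₆ _ ⟨hm6, hm6', rfl⟩
        refine ⟨⟨hcur, hcmp⟩, fun b hb => ?_⟩
        rw [hm6, hm6' _ (by simp) (by simp) (by simp), hm5 _ (by simp) (by simp) (by simp),
          hcur4] at hb
        have hm6'' : ∀ s, s ≠ Reg.cmp → s ≠ agree → s ≠ aux → m₆ s = m₄ s :=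
          fun s h1 h2 h3 => by rw [hm6' s h1 h2 h3, hm5 s h1 h2 h3]
        have hlt' : decr M r' < r' := decr_lt hr' h0'
        refine ⟨fun r'' hr'' => ?_, fun r'' hr'' => ?_⟩ <;> split_ifs at hr'' with hbt
        · obtain rfl := Sum.inl.inj hr''
          refine ⟨_, index_lt_index (isValue_decr hr' h0') hlt', isValue_decr hr' h0',
            hlt'.trans hlt, ?_, hm6'', rfl, rfl⟩
          by_contra! hno
          exact hbt (hb.2 fun v hv => ⟨hCA hv, not_lt.1 (hno v hv)⟩)
        · obtain rfl := Sum.inr.inj hr''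
          exact ⟨isValue_decr hr' h0', hlt'.trans hlt, fun v hv => (hb.1 hbt hv).2,
            ⟨v, hvC, le_decr hr' h0' (hS.value v) hv⟩, hm6'', rfl⟩
      · rintro r'' m₅ _ ⟨hr'', hlt, hCr, ⟨v, hvC, hv⟩, hm5, rfl⟩
        have hfr5 : ∀ s, ¬ s.IsScratch → m₅ s = m₂ s := by
          intro s hs
          rw [hm5 s, hfr4 s hs] <;>
          · rintro rfl; exact hs trivial
        have hE5 := hS.encodes.congr hU.persistent hfr5
        have hcur5 : m₅ cur = C := by rw [hm5 _ (by simp) (by simp) (by simp), hcur4]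
        have hold5 : m₅ old = S := by rw [hm5 _ (by simp) (by simp) (by simp), hold4]
        refine (ensures_saveRank hU hE5 hr (a := C \ S) (by rw [hcur5, hold5])
          (Set.sdiff_subset.trans hCA) fun v hv => ((hsub v hv).trans_le le_top).ne).mono ?_
        rintro _ m₆ _ ⟨hE6, hm6, rfl⟩
        refine ⟨fun r' hr' => ?_, fun _ hr' => by simp at hr'⟩
        obtain rfl := Sum.inl.inj hr'
        have hvS : v ∈ C \ S := ⟨hvC, fun h => (h.2.trans hv).not_gt hlt⟩
        have htot2 := totalIndex_raise_of_le (M := M) hsub hvS hv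
        have hlt2 := index_lt_index hr'' (lt_incr (M := M) (hlt.trans_le le_top).ne)
        refine ⟨(2 * Fintype.card V + 1) * M.card - (index M (incr M r'') +
          2 * totalIndex M (raise (C \ S) r ρ)), ?_, _,
          hS.raise hr h0 hc hSC hCA hmin hlt hCr hE6 fun s hs hlt' _ => ?_, isValue_incr,
          (zero_lt_incr _).ne', fun s hs => ?_, ?_, Nat.add_sub_cancel' (htot _ _)⟩
        · have := htot (raise (C \ S) r ρ) (incr M r'')
          omega
        · left
          by_contra hle
          exact (incr_le hs (not_le.1 hle)).not_gt hlt'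
        · rw [hm6 s hs, hfr5 s hs.not_isScratch, hm2 s hs]
        · have : index M r + 2 * totalIndex M ρ + (1 + (C \ S).ncard) ≤
              index M (incr M r'') + 2 * totalIndex M (raise (C \ S) r ρ) := by omega
          refine le_trans ?_ (Nat.mul_le_mul_left K this)
          rw [Nat.mul_add K _ (1 + _)]
          have h2 : K + 2 * (C \ S).ncard ≤ K * (1 + (C \ S).ncard) := by
            rw [Nat.mul_add, Nat.mul_one]
            exact Nat.add_le_add_left (Nat.mul_le_mul_right _ (by omega)) _
          omega
  · rintro _ m₂ t ⟨⟨ρ, hS⟩, hm2, ht⟩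
    rw [ensures_diff]
    refine ⟨⟨hdom, hU.mem, htop⟩, ?_, ?_, ?_, by simpa using ht⟩
    · have hμ : G.IsMeasure y A ρ := by
        exact isMeasure_of_isUpdateClosed hA hS.value hc fun s hs hs0 => hS.closed s hs hs0 trivial
      convert hμ.isDominion using 1
      rw [Function.update_self, hS.encodes.game, hS.encodes.top]
      ext v
      simp only [Set.mem_sdiff, Set.mem_ofPred_eq]
      tauto
    · intro D hD hcardD
      obtain ⟨μ, hμ, hM, hne⟩ := hD.exists_isMeasure hcardD hc (N := N) fun j hj => by
        rw [hNdef, bounds, if_pos hj, hsize]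
        refine le_of_eq (congrArg _ ?_)
        ext v
        exact (mem_prioSet_sub_shift hj.pos).symm
      rw [Function.update_self, hS.encodes.game, hS.encodes.top]
      intro v hv
      refine ⟨hD.1 hv, fun hvt => hne v hv ?_⟩
      exact top_le_iff.1 (hvt.2 ▸ hS.le_measure μ hμ hM v (hD.1 hv))
    · intro s hs
      rw [Function.update_of_ne, hm2 s hs]
      rintro rfl; exact hs

end BigStep

/-! ### Attractor-closed sets and complements of largest dominions -/

namespace ParityGame

variable {V : Type*} {c : ℕ} {G : ParityGame V c} {y z : Player} {X A B D : Set V}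

theorem isAttractor_self (hBX : B ⊆ X) (hB : G.cpreIn y X B ⊆ B) : G.IsAttractor y X B B :=
  ⟨⟨fun _ => 0, hBX, Set.inter_subset_left, fun _ h h' => absurd h h'⟩, hB⟩

/-- Closedness under controllable predecessors for a set and for a set in its complement. -/
theorem cpreIn_union_subset (hA : G.cpreIn y X A ⊆ A) (hB : G.cpreIn y (X \ A) B ⊆ B) :
    G.cpreIn y X (A ∪ B) ⊆ A ∪ B := by
  rintro v ⟨hv, ⟨w, hw, he⟩, ho⟩
  by_cases hvA : v ∈ A
  · exact .inl hvA
  refine .inr ?_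
  by_cases hex : ∃ w ∈ B, G.edge v w
  · exact hB ⟨⟨hv, hvA⟩, hex, fun ho' w hw he => (ho ho' w hw.1 he).resolve_left hw.2⟩
  · refine absurd (hA ⟨hv, ⟨w, hw.resolve_right fun hB => hex ⟨w, hB, he⟩, he⟩, ?_⟩) hvA
    exact fun ho' w hw he => (ho ho' w hw he).resolve_right fun hB => hex ⟨w, hB, he⟩

theorem IsSubgame.isDominion_even (hX : G.IsSubgame X) (hp : ∀ v ∈ X, (G.prio v : ℕ) < 1) :
    G.IsDominion .even X X := by
  choose! σ hσ using hX
  refine ⟨subset_rfl, σ, fun v hv _ => ⟨(hσ v hv).2, (hσ v hv).1⟩, fun _ _ _ w hw _ => hw,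
    fun v hv hodd => ?_⟩
  have := hp v hv
  have h0 : G.shiftedPrio .even v = 0 := by simp only [shiftedPrio, BigStep.shift]; omega
  simp [h0] at hodd

/-- A dominion that contains the other dominions of the player is his winning set. -/
theorem IsSubgame.isDominion_compl [Finite V] {p : ℕ} (hX : G.IsSubgame X)
    (hp : ∀ v ∈ X, (G.prio v : ℕ) < p) (hD : G.IsDominion y X D)
    (hmax : ∀ E, G.IsDominion y X E → E ⊆ D) : G.IsDominion y.opp X (X \ D) := by
  obtain ⟨E, hE, hcov⟩ := hX.isDetermined hp
  convert hE y.opp using 1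
  ext v
  constructor
  · rintro ⟨hv, hvD⟩
    obtain ⟨w, hw⟩ := hcov v hv
    by_cases hwy : w = y
    · exact absurd (hmax _ (hE y) (hwy ▸ hw)) hvD
    · exact Player.ne_iff_eq_opp.1 hwy ▸ hw
  · exact fun hv => ⟨(hE y.opp).1 hv, fun hvD => Set.disjoint_left.1 (hD.disjoint (hE y.opp)) hvD hv⟩

end ParityGame

/-- The registers that are not changed by the call for `c` priorities. -/
def Reg.Outside (c : ℕ) : Reg → Prop
  | vert | own _ | prio _ => True
  | all i | game i | win _ i => c < i
  | _ => False

theorem Reg.Outside.persistent {c : ℕ} {s : Reg} (h : s.Outside c) : s.Persistent := by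
  cases s <;> simp_all [Outside, Persistent]

theorem Reg.Outside.mono {c c' : ℕ} {s : Reg} (hc : c ≤ c') (h : s.Outside c') : s.Outside c := by
  cases s <;> simp_all [Outside] <;> omega

/-! ### Correctness and cost of the recursion on the priorities -/

namespace BigStep

open Prog Reg ParityGame Rank

variable {V : Type*} {c : ℕ} {G : ParityGame V c} {U : Finset Reg} {m : Reg → Set V}
  {size : ℕ → ℕ}

/-- The registers that are needed by the call for `k` priorities. -/
structure HasSolveRegs (U : Finset Reg) (size : ℕ → ℕ) (k : ℕ) : Prop where
  aux : ∀ r, r.IsAux → r ∈ U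
  all : ∀ i ≤ k, all i ∈ U
  game : ∀ i ≤ k, game i ∈ U
  win : ∀ z, ∀ i ≤ k, win z i ∈ U
  prio : ∀ i < k, prio i ∈ U
  coord : ∀ y, ∀ i ≤ k, ∀ j : Fin (i + shift y), Odd (j : ℕ) → ∀ x ≤ bounds y size i j,
    coord j x ∈ U

theorem HasSolveRegs.mono {k l : ℕ} (hU : HasSolveRegs U size l) (h : k ≤ l) :
    HasSolveRegs U size k :=
  ⟨hU.aux, fun i hi => hU.all i (hi.trans h), fun i hi => hU.game i (hi.trans h),
    fun z i hi => hU.win z i (hi.trans h), fun i hi => hU.prio i (hi.trans_le h),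
    fun y i hi => hU.coord y i (hi.trans h)⟩

theorem HasSolveRegs.hasRegs {k : ℕ} (hU : HasSolveRegs U size k) (hk : 1 ≤ k) (y : Player)
    {X : Reg} (hX : X ∈ U) (hXp : X.Persistent) : HasRegs U y (bounds y size k) X :=
  ⟨hU.aux, hX, hXp, fun i hi => hU.prio _ (by omega), hU.coord y k le_rfl⟩

/-- A bound for the number of one-step operations in one iteration of the main loop for `k`
priorities, apart from the recursive call, where `h` is the parameter of the dominion search of
player `y`. -/
noncomputable def iterationCost (n : ℕ) (size : ℕ → ℕ) (y : Player) (k h : ℕ) : ℕ :=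
  (2 * (k + shift y) + 2) * ((2 * n + 1) * (domain (bounds y size k) h).card + 1) + 6 * (n + 1)

/-- A bound for the number of one-step operations for a game with `m` vertices and `k` priorities,
where `D k` bounds the cost of an iteration. -/
def solveCost (D h : ℕ → ℕ) (k m : ℕ) : ℕ :=
  if k ≤ 1 then 0
  else if k ≤ 3 then D k
  else D k + solveCost D h (k - 1) m +
    if m ≤ h k then 0 else solveCost D h k (m - (h k + 1))
termination_by (k, m)

theorem solveCost_mono (D h : ℕ → ℕ) (k : ℕ) : Monotone (solveCost D h k) := by
  induction k using Nat.strong_induction_on with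
  | _ k ihk =>
  intro m m' hmm
  induction m using Nat.strong_induction_on generalizing m' with
  | _ m ihm =>
  rw [solveCost.eq_def D h k m, solveCost.eq_def D h k m']
  split_ifs with h1 h2 h3 h4 h4
  · exact le_rfl
  · exact le_rfl
  · have := ihk (k - 1) (by omega) hmm
    omega
  · have := ihk (k - 1) (by omega) hmm
    omega
  · omega
  · have := ihk (k - 1) (by omega) hmm
    have := ihm (m - (h k + 1)) (by omega) (m' := m' - (h k + 1)) (by omega)
    omega

/-- The cost of an iteration of the call for `k` priorities in the Big-Step algorithm. -/
noncomputable def levelCost (n : ℕ) (size h : ℕ → ℕ) (k : ℕ) : ℕ :=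
  if k ≤ 3 then iterationCost n size .even k n
  else iterationCost n size (topPlayer k).opp k (h k)

/-- In `m'`, the game that is described by `m` has been solved by the call for `k` priorities. -/
def IsSolved (G : ParityGame V c) (k : ℕ) (m m' : Reg → Set V) : Prop :=
  (∀ z, G.IsDominion z (m (all k)) (m' (win z k))) ∧
  (∀ v ∈ m (all k), ∃ z, v ∈ m' (win z k)) ∧ ∀ s, s.Outside k → m' s = m s

/-- The state of the main loop for `k` priorities for the game `A`. -/
structure IsLoopState (G : ParityGame V c) (y : Player) (k : ℕ) (A : Set V) (m : Reg → Set V) :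
    Prop where
  all : m (all k) = A
  dominion : G.IsDominion y A (m (win y k))
  closed : G.cpreIn y A (m (win y k)) ⊆ m (win y k)
  game : m (game k) = A \ m (win y k)

theorem IsLoopState.isSubgame {y : Player} {k : ℕ} {A : Set V} (hS : IsLoopState G y k A m)
    (hA : G.IsSubgame A) : G.IsSubgame (m (Reg.game k)) := by
  rw [hS.game]
  exact hA.diff_attractor (isAttractor_self hS.dominion.1 hS.closed)

/-- The searched dominion together with a nonempty winning set from the recursive call is a dominion
the search has missed, so it has more than `h` vertices and all of them are removed. If the
recursive winning set is empty, the top player wins all that is left. -/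
theorem ensures_iteration [Fintype V] {k h : ℕ} {rec : Prog Reg Unit} {R : ℕ → ℕ}
    (hR : Monotone R) (hU : HasSolveRegs U size (k + 1)) (hI : HasInput G m)
    (hsize : ∀ i, size i = (G.prioSet i).ncard) {A : Set V} (hA : G.IsSubgame A)
    (hk : ∀ v ∈ A, (G.prio v : ℕ) < k + 1)
    (hS : IsLoopState G (topPlayer (k + 1)).opp (k + 1) A m)
    (hrec : ∀ m, HasInput G m → G.IsSubgame (m (all k)) → (∀ v ∈ m (all k), (G.prio v : ℕ) < k) →
      Ensures G U rec m fun _ m' t => IsSolved G k m m' ∧ t ≤ R (m (all k)).ncard) :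
    Ensures G U (iteration size h (k + 1) rec) m fun b m' t =>
      IsLoopState G (topPlayer (k + 1)).opp (k + 1) A m' ∧
      (∀ s, s.Outside (k + 1) → m' s = m s) ∧
      t ≤ iterationCost (Fintype.card V) size (topPlayer (k + 1)).opp (k + 1) h +
        R (m (game (k + 1))).ncard ∧
      (b = true → G.IsDominion (topPlayer (k + 1)) A (m' (game (k + 1)))) ∧
      (b = false → (m' (game (k + 1))).ncard + h + 1 ≤ (m (game (k + 1))).ncard) := by
  set z := topPlayer (k + 1) with hz
  set y := z.opp with hy
  have hgame : Reg.game (k + 1) ∈ U := hU.game _ le_rfl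
  have hwin : Reg.win y (k + 1) ∈ U := hU.win _ _ le_rfl
  have hwin' : Reg.win y k ∈ U := hU.win _ _ (Nat.le_succ k)
  have hall' : Reg.all k ∈ U := hU.all _ (Nat.le_succ k)
  have hprio : Reg.prio k ∈ U := hU.prio _ (Nat.lt_succ_self k)
  have hatt : att ∈ U := hU.aux _ trivial
  have haux : aux ∈ U := hU.aux _ trivial
  have hdom : dom ∈ U := hU.aux _ trivial
  obtain ⟨W, hW⟩ : ∃ W, m (Reg.win y (k + 1)) = W := ⟨_, rfl⟩
  obtain ⟨X, hX⟩ : ∃ X, m (Reg.game (k + 1)) = X := ⟨_, rfl⟩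
  have hXsub : G.IsSubgame X := hX ▸ hS.isSubgame hA
  have hXA : X = A \ W := by rw [← hX, ← hW, hS.game]
  have hWdom := hS.dominion
  have hWcl := hS.closed
  rw [hW] at hWdom hWcl
  simp only [iteration, ensures_bind, ensures_union, ensures_diff, ensures_clear, ensures_subset,
    ← hz, ← hy, Nat.add_sub_cancel]
  -- the dominion search and the attractor of its result
  refine (ensures_dominion (hU.hasRegs (by omega) y hgame trivial) hI hsize (by rwa [hX])
    (fun v hv => hk v (by rw [hX, hXA] at hv; exact hv.1))).mono ?_
  rintro _ m₁ t₁ ⟨hdom1, hmax, hm1, ht1⟩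
  rw [hX] at hdom1 hmax
  have hI1 := hI.congr hm1
  refine (ensures_attractor hU.aux hgame trivial hdom (hI1.1 _)).mono ?_
  rintro _ m₂ t₂ ⟨hatt2, hm2, ht2⟩
  rw [hm1 _ (by exact trivial), hX] at hatt2
  refine ⟨⟨hwin, hwin, hatt⟩, ⟨hgame, hgame, hatt⟩, ?_⟩
  obtain ⟨A₁, hA₁⟩ : ∃ A₁, m₂ att = A₁ := ⟨_, rfl⟩
  rw [hA₁] at hatt2
  have hA₁dom : G.IsDominion y X A₁ := hdom1.attractor hatt2
  have hp2 : ∀ s, s.Persistent → m₂ s = m s := by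
    intro s hs
    rw [hm2 s, hm1 s hs] <;>
    · rintro rfl; exact hs
  have hX1sub : G.IsSubgame (X \ A₁) := hXsub.diff_attractor hatt2
  -- the state after removing the first attractor
  obtain ⟨m₃, hm₃⟩ : ∃ m₃, m₃ = Function.update (Function.update m₂ (Reg.win y (k + 1))
    (m₂ (Reg.win y (k + 1)) ∪ m₂ att)) (Reg.game (k + 1))
    (Function.update m₂ (Reg.win y (k + 1)) (m₂ (Reg.win y (k + 1)) ∪ m₂ att) (Reg.game (k + 1)) \
      Function.update m₂ (Reg.win y (k + 1)) (m₂ (Reg.win y (k + 1)) ∪ m₂ att) att) := ⟨_, rfl⟩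
  rw [← hm₃]
  have h3win : m₃ (Reg.win y (k + 1)) = W ∪ A₁ := by
    rw [hm₃]; simp [hp2 (Reg.win y (k + 1)) trivial, hW, hA₁]
  have h3game : m₃ (Reg.game (k + 1)) = X \ A₁ := by
    rw [hm₃]; simp [hp2 (Reg.game (k + 1)) trivial, hX, hA₁]
  have hp3 : ∀ s, s.Persistent → s ≠ Reg.win y (k + 1) → s ≠ Reg.game (k + 1) → m₃ s = m s := by
    intro s hs h1 h2
    rw [hm₃, Function.update_of_ne h2, Function.update_of_ne h1, hp2 s hs]
  have hI3 : HasInput G m₃ := ⟨fun w => by rw [hp3 _ (by exact trivial) (by simp) (by simp), hI.1],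
    fun i => by rw [hp3 _ (by exact trivial) (by simp) (by simp), hI.2]⟩
  refine (ensures_attractor hU.aux hgame trivial hprio (hI3.1 _)).mono ?_
  rintro _ m₄ t₄ ⟨hatt4, hm4, ht4⟩
  rw [h3game, hI3.2] at hatt4
  refine ⟨⟨hall', hgame, hatt⟩, ?_⟩
  obtain ⟨A₂, hA₂⟩ : ∃ A₂, m₄ att = A₂ := ⟨_, rfl⟩
  rw [hA₂] at hatt4
  have hp4 : ∀ s, s.Persistent → m₄ s = m₃ s := by
    intro s hs
    rw [hm4 s] <;>
    · rintro rfl; exact hs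
  obtain ⟨m₅, hm₅⟩ : ∃ m₅, m₅ = Function.update m₄ (Reg.all k) (m₄ (Reg.game (k + 1)) \ m₄ att) :=
    ⟨_, rfl⟩
  rw [← hm₅]
  have h5all : m₅ (Reg.all k) = (X \ A₁) \ A₂ := by
    rw [hm₅]; simp [hp4 (Reg.game (k + 1)) trivial, h3game, hA₂]
  have hp5 : ∀ s, s.Persistent → s ≠ Reg.all k → m₅ s = m₃ s := by
    intro s hs h1
    rw [hm₅, Function.update_of_ne h1, hp4 s hs]
  have hI5 : HasInput G m₅ := ⟨fun w => by rw [hp5 _ (by exact trivial) (by simp), hI3.1],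
    fun i => by rw [hp5 _ (by exact trivial) (by simp), hI3.2]⟩
  refine (hrec m₅ hI5 (by rw [h5all]; exact hX1sub.diff_attractor hatt4) ?_).mono ?_
  · rw [h5all]
    rintro v ⟨⟨hv, hv1⟩, hv2⟩
    have := hk v (by rw [hXA] at hv; exact hv.1)
    have hne : (G.prio v : ℕ) ≠ k := fun h => hv2 (hatt4.inter_subset ⟨h, hv, hv1⟩)
    omega
  rintro _ m₆ t₆ ⟨⟨hsol, hcov, hm6⟩, ht6⟩
  rw [h5all] at hsol hcov ht6
  have h6game : m₆ (Reg.game (k + 1)) = X \ A₁ := by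
    rw [hm6 _ (by exact Nat.lt_succ_self k), hp5 _ (by exact trivial) (by simp), h3game]
  have h6win : m₆ (Reg.win y (k + 1)) = W ∪ A₁ := by
    rw [hm6 _ (by exact Nat.lt_succ_self k), hp5 _ (by exact trivial) (by simp), h3win]
  have h6all : m₆ (Reg.all (k + 1)) = A := by
    rw [hm6 _ (by exact Nat.lt_succ_self k), hp5 _ (by exact trivial) (by simp), hp3 _ (by exact trivial) (by simp) (by simp),
      hS.all]
  have h6out : ∀ s, s.Outside (k + 1) → m₆ s = m s := by
    intro s hs
    rw [hm6 s (hs.mono (Nat.le_succ k)), hp5 s hs.persistent, hp3 s hs.persistent] <;>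
    · rintro rfl
      simp [Outside] at hs
  refine (ensures_attractor hU.aux hgame trivial hwin' (by
    rw [hm6 _ (by exact trivial), hI5.1])).mono ?_
  rintro _ m₇ t₇ ⟨hatt7, hm7, ht7⟩
  rw [h6game] at hatt7
  obtain ⟨A₃, hA₃⟩ : ∃ A₃, m₇ att = A₃ := ⟨_, rfl⟩
  obtain ⟨W', hW'⟩ : ∃ W', m₆ (Reg.win y k) = W' := ⟨_, rfl⟩
  rw [hA₃, hW'] at hatt7
  have hp7 : ∀ s, s.Persistent → m₇ s = m₆ s := by
    intro s hs
    rw [hm7 s] <;>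
    · rintro rfl; exact hs
  refine ⟨⟨hwin, hwin, hatt⟩, ⟨hgame, hgame, hatt⟩, haux, ⟨hwin', haux⟩, fun b hb => ?_⟩
  obtain ⟨m₈, hm₈⟩ : ∃ m₈, m₈ = Function.update (Function.update (Function.update m₇
    (Reg.win y (k + 1)) (m₇ (Reg.win y (k + 1)) ∪ m₇ att)) (Reg.game (k + 1))
    (Function.update m₇ (Reg.win y (k + 1)) (m₇ (Reg.win y (k + 1)) ∪ m₇ att) (Reg.game (k + 1)) \
      Function.update m₇ (Reg.win y (k + 1)) (m₇ (Reg.win y (k + 1)) ∪ m₇ att) att)) aux ∅ :=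
    ⟨_, rfl⟩
  rw [← hm₈] at hb ⊢
  have h8win : m₈ (Reg.win y (k + 1)) = W ∪ (A₁ ∪ A₃) := by
    rw [hm₈]; simp [hp7 (Reg.win y (k + 1)) trivial, h6win, hA₃, Set.union_assoc]
  have h8game : m₈ (Reg.game (k + 1)) = (X \ A₁) \ A₃ := by
    rw [hm₈]; simp [hp7 (Reg.game (k + 1)) trivial, h6game, hA₃]
  have hp8 : ∀ s, s.Persistent → s ≠ Reg.win y (k + 1) → s ≠ Reg.game (k + 1) → m₈ s = m₆ s := by
    intro s hs h1 h2
    rw [hm₈, Function.update_of_ne (by rintro rfl; exact hs), Function.update_of_ne h2,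
      Function.update_of_ne h1, hp7 s hs]
  have h8W' : m₈ (Reg.win y k) = W' := by
    rw [hp8 _ (by exact trivial) (by simp) (by simp), hW']
  have h8aux : m₈ aux = ∅ := by rw [hm₈, Function.update_self]
  rw [h8W', h8aux] at hb
  have hW'dom : G.IsDominion y (X \ A₁) W' := by
    have := hsol y
    rw [hW'] at this
    exact this.of_diff_attractor hatt4
  have hA₃dom : G.IsDominion y (X \ A₁) A₃ := hW'dom.attractor hatt7
  have hA₁₃dom : G.IsDominion y X (A₁ ∪ A₃) := hA₁dom.union hA₃dom
  have hdom8 : G.IsDominion y A (W ∪ (A₁ ∪ A₃)) := hWdom.union (hXA ▸ hA₁₃dom)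
  have hcl8 : G.cpreIn y A (W ∪ (A₁ ∪ A₃)) ⊆ W ∪ (A₁ ∪ A₃) :=
    cpreIn_union_subset hWcl (hXA ▸ cpreIn_union_subset hatt2.2 hatt7.2)
  have hgame8 : (X \ A₁) \ A₃ = A \ (W ∪ (A₁ ∪ A₃)) := by
    rw [hXA, Set.sdiff_sdiff, Set.sdiff_sdiff]
  refine ⟨⟨?_, by rwa [h8win], by rwa [h8win], by rw [h8game, h8win, hgame8]⟩, fun s hs => ?_, ?_,
    fun hbt => ?_, fun hbf => ?_⟩
  · rw [hp8 _ (by exact trivial) (by simp) (by simp), h6all]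
  · rw [hp8 s hs.persistent, h6out s hs] <;>
    · rintro rfl
      simp [Outside] at hs
  · have h1 : R ((X \ A₁) \ A₂).ncard ≤ R X.ncard :=
      hR (Set.ncard_le_ncard (Set.sdiff_subset.trans Set.sdiff_subset))
    rw [Nat.card_eq_fintype_card] at ht2 ht4 ht7
    rw [hX, iterationCost]
    omega
  · have hW'e : W' = ∅ := Set.subset_empty_iff.1 (hb.1 hbt)
    have hfull : m₆ (Reg.win z k) = (X \ A₁) \ A₂ := by
      refine (hsol z).1.antisymm fun v hv => ?_
      obtain ⟨w, hw⟩ := hcov v hv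
      by_cases hwz : w = z
      · exact hwz ▸ hw
      · rw [Player.ne_iff_eq_opp.1 hwz, ← hy, hW', hW'e] at hw
        exact hw.elim
    have hzdom : G.IsDominion z (X \ A₁) (X \ A₁) := by
      refine IsDominion.of_attractor_top hX1sub (fun v hv => ?_)
        (fun v _ => odd_shiftedPrio_ne_topPlayer v) hatt4 (by have := hsol z; rwa [hfull] at this)
      have := hk v (by have := hv.1; rw [hXA] at this; exact this.1)
      omega
    -- The second attractor starts from the empty set; its emptiness is read off from disjointness
    -- with the dominion of `z`, which is now the whole remaining game.
    have hA₃e : A₃ = ∅ := by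
      have h1 := hzdom.disjoint hA₃dom
      exact Set.subset_empty_iff.1 fun v hv => Set.disjoint_left.1 h1 (hA₃dom.1 hv) hv
    rw [h8game, hA₃e, Set.sdiff_empty]
    have : X \ A₁ = A \ (W ∪ (A₁ ∪ A₃)) := by rw [← hgame8, hA₃e, Set.sdiff_empty]
    rw [this] at hzdom ⊢
    have hzy : z = y.opp := by simp [hy]
    rw [hzy] at hzdom ⊢
    exact hzdom.of_diff_attractor (isAttractor_self hdom8.1 hcl8)
  · have hne : W'.Nonempty := by
      rw [Set.nonempty_iff_ne_empty]
      rintro rfl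
      simp [hbf] at hb
    obtain ⟨v, hv⟩ := hne
    have hdomu : G.IsDominion y X (A₁ ∪ W') := hA₁dom.union hW'dom
    -- A union with at most `h` vertices would be contained in the result of the search and hence in
    -- `A₁`, although `W'` is nonempty and disjoint from `A₁`.
    have hlt : h < (A₁ ∪ W').ncard := by
      by_contra hle
      have := hmax _ hdomu (not_lt.1 hle) (.inr hv)
      exact (hW'dom.1 hv).2 (hatt2.inter_subset ⟨this, hdomu.1 (.inr hv)⟩)
    have hsub : A₁ ∪ W' ⊆ A₁ ∪ A₃ := Set.union_subset_union_right _ fun v hv =>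
      hatt7.inter_subset ⟨hv, hW'dom.1 hv⟩
    have h1 := Set.ncard_le_ncard hsub
    have h2 := Set.ncard_sdiff_add_ncard_of_subset hA₁₃dom.1
    rw [h8game, Set.sdiff_sdiff, hX]
    omega

/-- For two or three priorities the search with parameter `n` finds every dominion of player even,
and determinacy assigns the complement to odd. For more priorities the invariant of the main loop
adds, to the cost so far, the cost bound for the remaining game; the recursion of `solveCost` on the
number of vertices mirrors one iteration. -/
theorem ensures_solve [Fintype V] {h : ℕ → ℕ} (hsize : ∀ i, size i = (G.prioSet i).ncard) {k : ℕ}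
    (hk : 1 ≤ k) (hU : HasSolveRegs U size k) (hI : HasInput G m) (hA : G.IsSubgame (m (all k)))
    (hp : ∀ v ∈ m (all k), (G.prio v : ℕ) < k) :
    Ensures G U (solve (Fintype.card V) size h k) m fun _ m' t => IsSolved G k m m' ∧
      t ≤ solveCost (levelCost (Fintype.card V) size h) h k (m (all k)).ncard := by
  induction k generalizing m with
  | zero => omega
  | succ k ih =>
  have hallU := hU.all _ le_rfl
  have hwinU := fun z => hU.win z _ le_rfl
  cases k with
  | zero =>
    simp only [solve, ensures_bind, ensures_copy, ensures_clear]
    refine ⟨⟨hwinU _, hallU⟩, hwinU _, ⟨fun z => ?_, fun v hv => ⟨.even, ?_⟩, fun s hs => ?_⟩,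
      Nat.zero_le _⟩
    · cases z with
      | even => simpa using hA.isDominion_even hp
      | odd => simpa using isDominion_empty
    · simpa using hv
    · rw [Function.update_of_ne, Function.update_of_ne] <;>
      · rintro rfl
        simp [Outside] at hs
  | succ k =>
    rw [solve]
    split_ifs with hk3
    · have hdomU : dom ∈ U := hU.aux _ trivial
      simp only [ensures_bind, ensures_copy, ensures_diff]
      refine (ensures_dominion (hU.hasRegs (by omega) _ hallU trivial) hI hsize hA hp).mono ?_
      rintro _ m₁ t ⟨hdom, hmax, hm1, ht⟩
      refine ⟨⟨hwinU _, hdomU⟩, ⟨hwinU _, hallU, hdomU⟩, ⟨fun z => ?_, fun v hv => ?_,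
        fun s hs => ?_⟩, ?_⟩
      · cases z with
        | even => simpa using hdom
        | odd =>
          simpa [hm1 (Reg.all (k + 1 + 1)) trivial, Player.opp] using hA.isDominion_compl hp hdom fun E hE =>
            hmax E hE (by simpa using Set.ncard_le_card E)
      · by_cases hvd : v ∈ m₁ dom
        · exact ⟨.even, by simpa using hvd⟩
        · exact ⟨.odd, by simpa [hm1 (Reg.all (k + 1 + 1)) trivial, hvd] using hv⟩
      · rw [Function.update_of_ne, Function.update_of_ne, hm1 s hs.persistent] <;>
        · rintro rfl
          simp [Outside] at hs
      · rw [solveCost, if_neg (by omega), if_pos hk3, levelCost, if_pos hk3, iterationCost]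
        omega
    · have hgameU := hU.game _ le_rfl
      obtain ⟨A, hAm⟩ : ∃ A, m (Reg.all (k + 1 + 1)) = A := ⟨_, rfl⟩
      rw [hAm] at hA hp ⊢
      set z := topPlayer (k + 2) with hz
      have hzo : z ≠ z.opp := z.opp_ne.symm
      have hzo' : ∀ i j, Reg.win z i ≠ Reg.win z.opp j := fun i j h => hzo (by simpa using And.left (Reg.win.inj h))
      simp only [ensures_bind, ensures_copy, ensures_clear, ensures_diff]
      refine ⟨⟨hgameU, hallU⟩, hwinU _, ?_⟩
      obtain ⟨m₁, hm₁⟩ : ∃ m₁, m₁ = Function.update (Function.update m (Reg.game (k + 2))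
        (m (Reg.all (k + 2)))) (Reg.win z.opp (k + 2)) ∅ := ⟨_, rfl⟩
      rw [← hm₁]
      have h1win : m₁ (Reg.win z.opp (k + 2)) = ∅ := by rw [hm₁]; simp
      have h1game : m₁ (Reg.game (k + 2)) = A := by rw [hm₁]; simpa using hAm
      have h1all : m₁ (Reg.all (k + 2)) = A := by rw [hm₁]; simpa using hAm
      have h1out : ∀ s, s.Outside (k + 2) → m₁ s = m s := by
        intro s hs
        rw [hm₁, Function.update_of_ne, Function.update_of_ne] <;>
        · rintro rfl
          simp [Outside] at hs
      have hcost : ∀ i, solveCost (levelCost (Fintype.card V) size h) h (k + 2) i =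
          iterationCost (Fintype.card V) size z.opp (k + 2) (h (k + 2)) +
          solveCost (levelCost (Fintype.card V) size h) h (k + 1) i +
          if i ≤ h (k + 2) then 0 else
            solveCost (levelCost (Fintype.card V) size h) h (k + 2) (i - (h (k + 2) + 1)) := by
        intro i
        rw [solveCost, if_neg (by omega), if_neg hk3, levelCost, if_neg hk3]
        rfl
      refine (ensures_repeatUntil (Q := fun _ m' t => IsLoopState G z.opp (k + 2) A m' ∧
          (∀ s, s.Outside (k + 2) → m' s = m s) ∧ G.IsDominion z A (m' (Reg.game (k + 2))) ∧
          t ≤ solveCost (levelCost (Fintype.card V) size h) h (k + 2) A.ncard)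
        (fun m' t => IsLoopState G z.opp (k + 2) A m' ∧ (∀ s, s.Outside (k + 2) → m' s = m s) ∧
          t + solveCost (levelCost (Fintype.card V) size h) h (k + 2)
            (m' (Reg.game (k + 2))).ncard ≤
          solveCost (levelCost (Fintype.card V) size h) h (k + 2) A.ncard)
        (fun m' => (m' (Reg.game (k + 2))).ncard) ⟨⟨h1all, ?_, ?_, ?_⟩, h1out, ?_⟩ ?_).mono ?_
      · rw [h1win]; exact isDominion_empty
      · rw [h1win]
        rintro v ⟨-, ⟨w, hw, -⟩, -⟩
        exact hw
      · rw [h1win, h1game, Set.sdiff_empty]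
      · rw [h1game, Nat.zero_add]
      · rintro m₂ t ⟨hS, hout, ht⟩
        have hI2 : HasInput G m₂ := ⟨fun w => by rw [hout _ (by exact trivial), hI.1],
          fun i => by rw [hout _ (by exact trivial), hI.2]⟩
        refine (ensures_iteration (solveCost_mono _ h (k + 1)) hU hI2 hsize hA hp hS
          fun m' hI' hA' hp' => ih (by omega) (hU.mono (Nat.le_succ _)) hI' hA' hp').mono ?_
        rintro b m₃ t₃ ⟨hS3, hout3, ht3, htrue, hfalse⟩
        rw [hcost] at ht
        have ht3' : t₃ ≤ iterationCost (Fintype.card V) size z.opp (k + 2) (h (k + 2)) +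
          solveCost (levelCost (Fintype.card V) size h) h (k + 1)
            (m₂ (Reg.game (k + 2))).ncard := ht3
        refine ⟨fun hb => ?_, fun hb => ?_⟩
        · have h2 := hfalse hb
          have h2' : (m₃ (Reg.game (k + 2))).ncard + h (k + 2) + 1 ≤
            (m₂ (Reg.game (k + 2))).ncard := h2
          refine ⟨⟨hS3, fun s hs => by rw [hout3 s hs, hout s hs], ?_⟩, by omega⟩
          rw [if_neg (by omega)] at ht
          have h3 := solveCost_mono (levelCost (Fintype.card V) size h) h (k + 2)
            (show (m₃ (Reg.game (k + 2))).ncard ≤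
              (m₂ (Reg.game (k + 2))).ncard - (h (k + 2) + 1) by omega)
          omega
        · exact ⟨hS3, fun s hs => by rw [hout3 s hs, hout s hs], htrue hb, by omega⟩
      · rintro _ m₂ t ⟨hS, hout, hdom, ht⟩
        refine ⟨⟨hwinU _, hallU, hwinU _⟩, ⟨fun w => ?_, fun v hv => ?_, fun s hs => ?_⟩, ?_⟩
        · by_cases hwz : w = z
          · rw [hwz, Function.update_self, hAm, hS.all, ← hS.game]
            exact hdom
          · rw [Player.ne_iff_eq_opp.1 hwz, Function.update_of_ne (hzo' _ _).symm, hAm]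
            exact hS.dominion
        · rw [hAm] at hv
          by_cases hvw : v ∈ m₂ (Reg.win z.opp (k + 2))
          · exact ⟨z.opp, by rwa [Function.update_of_ne (hzo' _ _).symm]⟩
          · exact ⟨z, by rw [Function.update_self, hS.all]; exact ⟨hv, hvw⟩⟩
        · rw [Function.update_of_ne, hout s hs]
          rintro rfl
          simp [Outside] at hs
        · simpa only [Nat.zero_add, Nat.add_zero] using ht

end BigStep

/-! ### Size of the co-domain -/

namespace Rank

variable {c : ℕ}

theorem card_filter_odd (c : ℕ) : (Finset.univ.filter fun i : Fin c => Odd (i : ℕ)).card = c / 2 := by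
  induction c with
  | zero => rfl
  | succ c ih =>
    have h0 : ((Finset.univ.filter fun i : Fin c => Odd (i : ℕ)).map Fin.castSuccEmb).card =
        c / 2 := by rw [Finset.card_map, ih]
    by_cases h : Odd c
    · have : (Finset.univ.filter fun i : Fin (c + 1) => Odd (i : ℕ)) =
          insert (Fin.last c) ((Finset.univ.filter fun i : Fin c => Odd (i : ℕ)).map
            Fin.castSuccEmb) := by
        ext i
        induction i using Fin.lastCases <;> simp [h, Fin.castSucc_ne_last]
      rw [this, Finset.card_insert_of_notMem (by simp [Fin.castSucc_ne_last]), h0]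
      obtain ⟨a, rfl⟩ := h; omega
    · have : (Finset.univ.filter fun i : Fin (c + 1) => Odd (i : ℕ)) =
          (Finset.univ.filter fun i : Fin c => Odd (i : ℕ)).map Fin.castSuccEmb := by
        ext i
        induction i using Fin.lastCases <;> simp [h, Fin.castSucc_ne_last]
      rw [this, h0]
      obtain ⟨a, rfl⟩ := Nat.not_odd_iff_even.1 h; omega

/-- Stars and bars: an additional slack entry `h - ∑ i, x i` turns the vectors into those with sum
exactly `h`, supported on the odd indices and the slack. -/
theorem card_domain_le {N : Fin c → ℕ} (hN : ∀ i : Fin c, ¬ Odd (i : ℕ) → N i = 0) (h : ℕ) :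
    (domain N h).card ≤ (h + c / 2).choose (c / 2) := by
  have key : (domain N h).card ≤ ((Finset.univ.filter fun i : Fin c =>
      Odd (i : ℕ)).insertNone.finsuppAntidiag h).card := by
    refine Finset.card_le_card_of_injOn
      (fun x => Finsupp.equivFunOnFinite.symm fun o : Option (Fin c) => o.elim (h - ∑ i, x i) x)
      (fun x hx => ?_) fun x _ y _ hxy => ?_
    · obtain ⟨h1, h2⟩ := mem_domain.1 hx
      have h0 : ∀ i : Fin c, ¬ Odd (i : ℕ) → x i = 0 := fun i hi => Nat.le_zero.1 (hN i hi ▸ h1 i)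
      rw [Finset.mem_coe, Finset.mem_finsuppAntidiag]
      constructor
      · simp only [Finset.sum_insertNone, Finsupp.equivFunOnFinite_symm_apply_apply, Option.elim]
        rw [Finset.sum_filter_of_ne fun i _ hi => not_imp_comm.1 (h0 i) hi]
        omega
      · intro o ho
        cases o with
        | none => simp
        | some i =>
          simpa using not_imp_comm.1 (h0 i) (show x i ≠ 0 from Finsupp.mem_support_iff.1 ho)
    · have := Finsupp.equivFunOnFinite.symm.injective hxy
      exact funext fun i => congrFun this (some i)
  rw [Finset.card_finsuppAntidiag_nat_eq_choose, Finset.card_insertNone, card_filter_odd] at key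
  rwa [show c / 2 + 1 + h - 1 = h + c / 2 by omega, Nat.choose_symm_add] at key

end Rank

/-! ### The cost recursion and the bound with exponent of order `√n` -/

namespace BigStep

open Rank Real

theorem card_domain_bounds_le (y : Player) (size : ℕ → ℕ) (k h : ℕ) :
    (domain (bounds y size k) h).card ≤ (h + (k + shift y) / 2).choose ((k + shift y) / 2) :=
  card_domain_le (bounds_eq_zero size) h

theorem shift_topPlayer (k : ℕ) : (k + shift (topPlayer k).opp) / 2 = (k + 1) / 2 := by
  by_cases h : Odd k
  · simp [topPlayer, h, Player.opp, shift]
  · obtain ⟨a, rfl⟩ := Nat.not_odd_iff_even.1 h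
    simp only [topPlayer, h, Player.opp, shift, if_false]
    omega

theorem shift_le_one (y : Player) : shift y ≤ 1 := by cases y <;> simp [shift]

theorem iterationCost_le {n : ℕ} {size : ℕ → ℕ} {y : Player} {k h P : ℕ}
    (hP : (domain (bounds y size k) h).card ≤ P) :
    iterationCost n size y k h ≤ (2 * k + 4) * ((2 * n + 1) * P + 1) + 6 * (n + 1) := by
  have := shift_le_one y
  unfold iterationCost
  gcongr ?_ * ((2 * n + 1) * ?_ + 1) + _
  omega

/-- The number of iterations of the main loop is at most `m / (h k + 1) + 1`. -/
theorem solveCost_le_mul (D h : ℕ → ℕ) {k n m : ℕ} (hk : 4 ≤ k) (hm : m ≤ n) :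
    solveCost D h k m ≤ (m / (h k + 1) + 1) * (D k + solveCost D h (k - 1) n) := by
  induction m using Nat.strong_induction_on with
  | _ m ih =>
  have h1 := solveCost_mono D h (k - 1) hm
  rw [solveCost, if_neg (by omega), if_neg (by omega)]
  split_ifs with h2
  · rw [add_mul, one_mul]
    exact (Nat.add_le_add_left h1 _).trans (Nat.le_add_left _ _)
  · have h3 := ih (m - (h k + 1)) (by omega) (by omega)
    have h4 : m / (h k + 1) = (m - (h k + 1)) / (h k + 1) + 1 :=
      Nat.div_eq_sub_div (by omega) (by omega)
    rw [h4, add_mul _ 1 (_ + _), one_mul]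
    omega

/-- Here `q` bounds how often `s + 1` vertices can still be removed. One step lowers either `k` or
`q`, and the resulting sum closes because `1 + k ^ (q + 2) + (k + 1) ^ (q + 1) ≤ (k + 1) ^ (q + 2)`.
-/
theorem solveCost_const_le {D : ℕ → ℕ} {s E : ℕ} {k q m : ℕ} (hD : ∀ i, 2 ≤ i → i ≤ k → D i ≤ E)
    (hm : m < (q + 1) * (s + 1)) :
    solveCost D (fun _ => s) k m ≤ E * (k + 1) ^ (q + 1) := by
  induction k using Nat.strong_induction_on generalizing q m with
  | _ k ihk =>
  induction q generalizing m with
  | zero =>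
    rw [solveCost]
    split_ifs with h1 h2 h3
    · exact Nat.zero_le _
    · exact (hD k (by omega) le_rfl).trans (Nat.le_mul_of_pos_right _ (by positivity))
    · have := ihk (k - 1) (by omega) (fun i hi hi' => hD i hi (by omega)) hm
      have := hD k (by omega) le_rfl
      rw [show k - 1 + 1 = k by omega] at *
      simp only [zero_add, pow_one] at *
      linarith
    · omega
  | succ q ihq =>
    rw [solveCost]
    by_cases h1 : k ≤ 1
    · simp [h1]
    rw [if_neg h1]
    by_cases h2 : k ≤ 3
    · rw [if_pos h2]
      exact (hD k (by omega) le_rfl).trans (Nat.le_mul_of_pos_right _ (by positivity))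
    rw [if_neg h2]
    have h4 := ihk (k - 1) (by omega) (fun i hi hi' => hD i hi (by omega)) hm
    have h5 := hD k (by omega) le_rfl
    have h6 : (if m ≤ s then 0 else solveCost D (fun _ => s) k (m - (s + 1))) ≤
        E * (k + 1) ^ (q + 1) := by
      split_ifs with h
      · exact Nat.zero_le _
      · refine ihq ?_
        rw [add_mul _ 1 (s + 1)] at hm
        omega
    rw [show k - 1 + 1 = k by omega] at h4
    have h7 : k ^ (q + 1) + 1 ≤ (k + 1) ^ (q + 1) := by
      have := pow_lt_pow_left₀ (Nat.lt_succ_self k) (Nat.zero_le k) (n := q + 1) (by omega)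
      exact this
    have h8 : 1 + k ^ (q + 1 + 1) + (k + 1) ^ (q + 1) ≤ (k + 1) ^ (q + 1 + 1) := by
      rw [pow_succ k, pow_succ (k + 1) (q + 1)]
      nlinarith [Nat.mul_le_mul_right k h7]
    calc _ ≤ E + E * k ^ (q + 1 + 1) + E * (k + 1) ^ (q + 1) := by omega
      _ = E * (1 + k ^ (q + 1 + 1) + (k + 1) ^ (q + 1)) := by ring
      _ ≤ _ := Nat.mul_le_mul_left _ h8

theorem iterationCost_le_pow {n : ℕ} {size : ℕ → ℕ} {y : Player} {k h p : ℕ} (hn : 2 ≤ n)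
    (hk : k ≤ n + 1) (hP : (domain (bounds y size k) h).card ≤ n ^ p) :
    iterationCost n size y k h ≤ n ^ (p + 7) := by
  refine (iterationCost_le hP).trans ?_
  have h1 : 1 ≤ n ^ p := Nat.one_le_pow _ _ (by omega)
  have h2 : 32 ≤ n ^ 5 := Nat.pow_le_pow_left hn 5
  rw [pow_add]
  generalize n ^ p = P at *
  calc (2 * k + 4) * ((2 * n + 1) * P + 1) + 6 * (n + 1)
      ≤ (2 * (n + 1) + 4) * ((2 * n + 1) * P + P) + 6 * (n + 1) * P := by
        have h3 := Nat.le_mul_of_pos_right (6 * (n + 1)) h1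
        gcongr
    _ = P * ((2 * n + 2) * (2 * n + 9)) := by ring
    _ ≤ P * ((4 * n) * (8 * n)) := by gcongr <;> omega
    _ = P * (32 * n ^ 2) := by ring
    _ ≤ P * (n ^ 5 * n ^ 2) := by gcongr
    _ = P * n ^ 7 := by ring

theorem levelCost_le_pow_of_le_three {n : ℕ} {size h : ℕ → ℕ} {k : ℕ} (hn : 2 ≤ n) (hk : 2 ≤ k)
    (hk' : k ≤ 3) : levelCost n size h k ≤ n ^ 9 := by
  rw [levelCost, if_pos hk']
  refine iterationCost_le_pow (p := 2) hn (by omega) ((card_domain_bounds_le _ _ _ _).trans ?_)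
  rw [show (k + shift .even) / 2 = 1 by simp only [shift]; omega, Nat.choose_one_right]
  nlinarith

theorem levelCost_le_pow {n s : ℕ} {size : ℕ → ℕ} {k : ℕ} (hn : 2 ≤ n) (hs : 1 ≤ s) (hsn : s ≤ n)
    (hk : 2 ≤ k) (hkn : k ≤ n + 1) : levelCost n size (fun _ => s) k ≤ n ^ (2 * s + 7) := by
  by_cases hk' : k ≤ 3
  · exact (levelCost_le_pow_of_le_three hn hk hk').trans
      (Nat.pow_le_pow_right (by omega) (by omega))
  · rw [levelCost, if_neg hk']
    refine iterationCost_le_pow hn hkn ((card_domain_bounds_le _ _ _ _).trans ?_)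
    -- The binomial coefficient is reflected so that the small number `s`, and not the number of odd
    -- indices, becomes the exponent.
    rw [shift_topPlayer, Nat.choose_symm_add.symm, pow_mul]
    refine (Nat.choose_le_pow _ _).trans (Nat.pow_le_pow_left ?_ s)
    nlinarith [show s + (k + 1) / 2 ≤ 2 * n by omega]

theorem solveCost_le_pow {n s : ℕ} {size : ℕ → ℕ} {k : ℕ} (hn : 2 ≤ n) (hs : 1 ≤ s) (hsn : s ≤ n)
    (hk : k ≤ n + 1) : solveCost (levelCost n size fun _ => s) (fun _ => s) k n ≤
      n ^ (2 * s + 2 * (n / (s + 1)) + 9) := by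
  refine (solveCost_const_le (q := n / (s + 1))
    (fun i hi hik => levelCost_le_pow hn hs hsn hi (hik.trans hk))
    (by rw [mul_comm]; exact Nat.lt_mul_div_succ n (by omega))).trans ?_
  calc n ^ (2 * s + 7) * (k + 1) ^ (n / (s + 1) + 1)
      ≤ n ^ (2 * s + 7) * (n ^ 2) ^ (n / (s + 1) + 1) := by
        gcongr; nlinarith
    _ = _ := by rw [← pow_mul, ← pow_add]; congr 1; ring

theorem rpow_nat_le_rpow_sqrt {n e : ℕ} {C : ℝ} (hn : 1 ≤ n) (he : (e : ℝ) ≤ C * √n) :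
    ((n ^ e : ℕ) : ℝ) ≤ (n : ℝ) ^ (C * √n) := by
  rw [Nat.cast_pow, ← rpow_natCast]
  exact rpow_le_rpow_of_exponent_le (by exact_mod_cast hn) he

theorem one_le_sqrt_natCast {n : ℕ} (hn : 1 ≤ n) : 1 ≤ √(n : ℝ) :=
  one_le_sqrt.2 (by exact_mod_cast hn)

theorem ceil_sqrt_mem {n : ℕ} (hn : 1 ≤ n) : 1 ≤ ⌈√(n : ℝ)⌉₊ ∧ ⌈√(n : ℝ)⌉₊ ≤ n := by
  have h1 := one_le_sqrt_natCast hn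
  refine ⟨Nat.one_le_ceil_iff.2 (by linarith), Nat.ceil_le.2 ?_⟩
  nlinarith [sq_sqrt (Nat.cast_nonneg (α := ℝ) n)]

/-- For `s = ⌈√n⌉` the exponent `2 * s + 2 * (n / (s + 1)) + 9` is at most `4 * √n + 11`, hence at
most `15 * √n`. -/
theorem solveCost_le_rpow_sqrt {n : ℕ} {size : ℕ → ℕ} {k : ℕ} (hn : 2 ≤ n) (hk : k ≤ n + 1) :
    (solveCost (levelCost n size fun _ => ⌈√(n : ℝ)⌉₊) (fun _ => ⌈√(n : ℝ)⌉₊) k n : ℝ) ≤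
      (n : ℝ) ^ (15 * √(n : ℝ)) := by
  obtain ⟨h1, h2⟩ := ceil_sqrt_mem (show 1 ≤ n by omega)
  have h3 := one_le_sqrt_natCast (show 1 ≤ n by omega)
  refine (Nat.cast_le.2 (solveCost_le_pow hn h1 h2 hk)).trans
    (rpow_nat_le_rpow_sqrt (by omega) ?_)
  have h4 : (⌈√(n : ℝ)⌉₊ : ℝ) < √n + 1 := Nat.ceil_lt_add_one (by linarith)
  have h5 : ((n / (⌈√(n : ℝ)⌉₊ + 1) : ℕ) : ℝ) ≤ √n := by
    refine Nat.cast_div_le.trans ((div_le_iff₀ (by positivity)).2 ?_)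
    have := Nat.le_ceil √(n : ℝ)
    push_cast
    nlinarith [sq_sqrt (Nat.cast_nonneg (α := ℝ) n)]
  push_cast
  linarith

theorem solveCost_le_rpow_sqrt_of_le_three {n : ℕ} {size h : ℕ → ℕ} {k : ℕ} (hn : 2 ≤ n)
    (hk : k ≤ 3) : (solveCost (levelCost n size h) h k n : ℝ) ≤ (n : ℝ) ^ (15 * √(n : ℝ)) := by
  have h3 := one_le_sqrt_natCast (show 1 ≤ n by omega)
  refine (Nat.cast_le.2 (?_ : _ ≤ n ^ 9)).trans (rpow_nat_le_rpow_sqrt (by omega) ?_)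
  · rw [solveCost]
    split_ifs with h1
    · exact Nat.zero_le _
    · exact levelCost_le_pow_of_le_three hn (by omega) hk
  · push_cast; linarith

end BigStep

/-! ### The bound for few priorities -/

namespace BigStep

open Rank Real

theorem bigStepGamma_three : bigStepGamma 3 = 1 := by
  rw [bigStepGamma, if_pos (by decide)]; norm_num

/-- With `q = (k + 1) / 2`, the exponent `γ(k - 1) / q` in the search parameter balances search and
recursive call, and the number of iterations adds `1 - γ(k - 1) / q` to the exponent. The closed
form in the theorem solves this recursion with `γ(3) = 1`. -/
theorem bigStepGamma_rec {k : ℕ} (hk : 4 ≤ k) : bigStepGamma k =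
    1 + bigStepGamma (k - 1) * (1 - 1 / (((k + 1) / 2 : ℕ) : ℝ)) := by
  rcases Nat.even_or_odd' k with ⟨a, rfl | rfl⟩
  · have ha : (2 : ℝ) ≤ a := by exact_mod_cast (by omega : 2 ≤ a)
    rw [bigStepGamma, if_neg (by simp), bigStepGamma, if_pos ⟨a - 1, by omega⟩,
      show (2 * a + 1) / 2 = a by omega, Nat.cast_sub (by omega)]
    push_cast
    have h1 : (2 * (a : ℝ) - 1) ^ 2 - 1 = 4 * a * (a - 1) := by ring
    have h2 : (a : ℝ) - 1 ≠ 0 := by linarith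
    have h3 : (a : ℝ) ≠ 0 := by linarith
    rw [h1]
    field_simp
    ring
  · have ha : (2 : ℝ) ≤ a := by exact_mod_cast (by omega : 2 ≤ a)
    rw [bigStepGamma, if_pos ⟨a, rfl⟩, bigStepGamma, if_neg (by simp),
      show (2 * a + 1 + 1) / 2 = a + 1 by omega, Nat.add_sub_cancel]
    push_cast
    have h1 : (2 * (a : ℝ) + 1) ^ 2 - 1 = 4 * a * (a + 1) := by ring
    have h2 : (a : ℝ) + 1 ≠ 0 := by linarith
    have h3 : (a : ℝ) ≠ 0 := by linarith
    rw [h1]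
    field_simp
    ring

theorem le_bigStepGamma {k : ℕ} (hk : 3 ≤ k) : (k : ℝ) / 3 ≤ bigStepGamma k := by
  have h3 : (3 : ℝ) ≤ k := by exact_mod_cast hk
  rw [bigStepGamma]
  split_ifs with h
  · have : 4 / ((k : ℝ) ^ 2 - 1) ≤ 1 / 2 := by rw [div_le_div_iff₀] <;> nlinarith
    linarith
  · have h4 : (4 : ℝ) ≤ k := by
      have : k ≠ 3 := by rintro rfl; exact h (by decide)
      exact_mod_cast (by omega : 4 ≤ k)
    have h5 : 4 / (k : ℝ) ^ 2 ≤ 1 / 4 := by rw [div_le_div_iff₀] <;> nlinarith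
    have h6 : 1 / (3 * (k : ℝ)) ≤ 1 / 4 := by rw [div_le_div_iff₀] <;> nlinarith
    linarith

theorem bigStepGamma_le {k : ℕ} (hk : 3 ≤ k) : bigStepGamma k ≤ (k + 1) / 2 := by
  have h3 : (3 : ℝ) ≤ k := by exact_mod_cast hk
  rw [bigStepGamma]
  split_ifs with h
  · have : 0 ≤ 4 / ((k : ℝ) ^ 2 - 1) := div_nonneg (by norm_num) (by nlinarith)
    linarith
  · have h5 : 0 ≤ 4 / (k : ℝ) ^ 2 := by positivity
    have h6 : 0 ≤ 1 / (3 * (k : ℝ)) := by positivity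
    linarith

/-- The exponent `β` in the parameter `⌈q * (n / k) ^ β⌉` of the dominion search, where `q` is the
number of odd indices of the ranks. -/
noncomputable def searchExponent (k : ℕ) : ℝ := bigStepGamma (k - 1) / ((k + 1) / 2 : ℕ)

/-- The parameter of the dominion search for games with `k` priorities that yields the bound for few
priorities. -/
noncomputable def searchParam (n k : ℕ) : ℕ :=
  max 1 (min n ⌈(((k + 1) / 2 : ℕ) : ℝ) * ((n : ℝ) / k) ^ searchExponent k⌉₊)

theorem searchExponent_nonneg {k : ℕ} (hk : 4 ≤ k) : 0 ≤ searchExponent k := by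
  have := le_bigStepGamma (k := k - 1) (by omega)
  exact div_nonneg (le_trans (by positivity) this) (Nat.cast_nonneg _)

theorem searchExponent_le_one {k : ℕ} (hk : 4 ≤ k) : searchExponent k ≤ 1 := by
  have h1 := bigStepGamma_le (k := k - 1) (by omega)
  have h2 : (k : ℝ) ≤ 2 * ((k + 1) / 2 : ℕ) := by exact_mod_cast (by omega : k ≤ 2 * ((k + 1) / 2))
  rw [Nat.cast_sub (by omega)] at h1
  have h3 : (4 : ℝ) ≤ k := by exact_mod_cast hk
  refine div_le_one_of_le₀ ?_ (Nat.cast_nonneg _)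
  push_cast at h1
  linarith

theorem searchExponent_mul {k : ℕ} (hk : 4 ≤ k) :
    searchExponent k * ((k + 1) / 2 : ℕ) = bigStepGamma (k - 1) := by
  have : (0 : ℝ) < ((k + 1) / 2 : ℕ) := by exact_mod_cast (by omega : 0 < (k + 1) / 2)
  exact div_mul_cancel₀ _ this.ne'

theorem bigStepGamma_eq_sub {k : ℕ} (hk : 4 ≤ k) :
    bigStepGamma k = bigStepGamma (k - 1) + (1 - searchExponent k) := by
  rw [bigStepGamma_rec hk, searchExponent]; ring

/-- Since `k = n + 1` is possible, `n / k` can be below `1`; additive constants are absorbed into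
its powers by means of this lower bound. -/
theorem le_div_of_le_add_one {n k : ℕ} (hk : 4 ≤ k) (hn : k ≤ n + 1) : (3 / 4 : ℝ) ≤ n / k := by
  have h3 : (4 : ℝ) ≤ k := by exact_mod_cast hk
  have h4 : (k : ℝ) ≤ n + 1 := by exact_mod_cast hn
  rw [le_div_iff₀ (by linarith)]
  linarith

theorem le_rpow_of_le {x b : ℝ} (hx : 3 / 4 ≤ x) (h0 : 0 ≤ b) (h1 : b ≤ 1) : 3 / 4 ≤ x ^ b :=
  calc (3 / 4 : ℝ) = (3 / 4 : ℝ) ^ (1 : ℝ) := (rpow_one _).symm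
    _ ≤ (3 / 4 : ℝ) ^ b := rpow_le_rpow_of_exponent_ge (by norm_num) (by norm_num) h1
    _ ≤ x ^ b := rpow_le_rpow (by norm_num) hx h0

/-- The coefficient is at most `(h + q) ^ q / q!`, and `q ^ q / q!` is at most `exp q`. -/
theorem choose_le_exp_mul_pow (h q : ℕ) (hq : 0 < q) :
    ((h + q).choose q : ℝ) ≤ (exp 1 * ((h + q) / q)) ^ q := by
  have hq' : (0 : ℝ) < q := by exact_mod_cast hq
  have h1 : ((h + q).choose q : ℝ) ≤ (h + q : ℝ) ^ q / q.factorial := by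
    have := Nat.choose_le_pow_div (α := ℝ) q (h + q)
    push_cast at this
    exact this
  have h2 := pow_div_factorial_le_exp (q : ℝ) hq'.le q
  have hf : (0 : ℝ) < q.factorial := by exact_mod_cast q.factorial_pos
  have h3 : exp (q : ℝ) = exp 1 ^ q := by rw [← exp_nat_mul, mul_one]
  rw [h3, div_le_iff₀ hf] at h2
  refine h1.trans ((div_le_iff₀ hf).2 ?_)
  rw [mul_pow, div_pow]
  calc (h + q : ℝ) ^ q = (q : ℝ) ^ q * ((h + q : ℝ) ^ q / (q : ℝ) ^ q) := by field_simp
    _ ≤ exp 1 ^ q * q.factorial * ((h + q : ℝ) ^ q / (q : ℝ) ^ q) := by gcongr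
    _ = _ := by ring

theorem searchParam_le (n k : ℕ) :
    (searchParam n k : ℝ) ≤ ((k + 1) / 2 : ℕ) * ((n : ℝ) / k) ^ searchExponent k + 1 := by
  have h0 : 0 ≤ (((k + 1) / 2 : ℕ) : ℝ) * ((n : ℝ) / k) ^ searchExponent k := by positivity
  have h1 := (Nat.ceil_lt_add_one h0).le
  rw [searchParam]
  rcases le_total 1 (min n ⌈(((k + 1) / 2 : ℕ) : ℝ) * ((n : ℝ) / k) ^ searchExponent k⌉₊) with h | h
  · rw [max_eq_right h]
    exact (Nat.cast_le.2 (min_le_right _ _)).trans h1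
  · rw [max_eq_left h]
    push_cast
    linarith

theorem card_domain_searchParam_le {n k : ℕ} (size : ℕ → ℕ) (hk : 4 ≤ k) (hn : k ≤ n + 1) :
    ((domain (bounds (topPlayer k).opp size k) (searchParam n k)).card : ℝ) ≤
      9 ^ ((k + 1) / 2) * ((n : ℝ) / k) ^ bigStepGamma (k - 1) := by
  have hx := le_div_of_le_add_one hk hn
  have hb := le_rpow_of_le hx (searchExponent_nonneg hk) (searchExponent_le_one hk)
  have h1 := searchParam_le n k
  have h2 := card_domain_bounds_le (topPlayer k).opp size k (searchParam n k)
  rw [shift_topPlayer] at h2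
  have hg := searchExponent_mul hk
  have hq : 2 ≤ (k + 1) / 2 := by omega
  have hx0 : 0 ≤ (n : ℝ) / k := by positivity
  generalize (k + 1) / 2 = q at *
  have hq' : (2 : ℝ) ≤ q := by exact_mod_cast hq
  rw [← hg, rpow_mul hx0, rpow_natCast, ← mul_pow]
  refine (Nat.cast_le.2 h2).trans ((choose_le_exp_mul_pow _ _ (by omega)).trans ?_)
  -- It remains to absorb `q + 1` into `2 * q` times the power, which works since the power is at
  -- least `3 / 4` and `q ≥ 2`.
  have h3 : ((searchParam n k : ℝ) + q) / q ≤ 3 * ((n : ℝ) / k) ^ searchExponent k := by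
    rw [div_le_iff₀ (by linarith)]
    nlinarith
  have h4 : exp 1 ≤ 3 := exp_one_lt_three.le
  refine pow_le_pow_left₀ (by positivity) ?_ q
  calc _ ≤ 3 * (3 * ((n : ℝ) / k) ^ searchExponent k) :=
        mul_le_mul h4 h3 (by positivity) (by norm_num)
    _ = _ := by ring

theorem levelCost_searchParam_le {n k : ℕ} (size : ℕ → ℕ) (hk : 4 ≤ k) (hn : k ≤ n + 1) :
    (levelCost n size (searchParam n) k : ℝ) ≤
      45 * k * 3 ^ k * (n * ((n : ℝ) / k) ^ bigStepGamma (k - 1)) := by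
  rw [levelCost, if_neg (by omega)]
  have h1 := card_domain_searchParam_le size hk hn
  have h2 := iterationCost_le (n := n) (size := size) (y := (topPlayer k).opp) (k := k) le_rfl
    (h := searchParam n k)
  have h3 : 1 ≤ (domain (bounds (topPlayer k).opp size k) (searchParam n k)).card :=
    Finset.card_pos.2 ⟨_, zero_mem⟩
  have h4 : (9 : ℝ) ^ ((k + 1) / 2) ≤ 3 * 3 ^ k := by
    rw [← pow_succ', show (9 : ℝ) = 3 ^ 2 by norm_num, ← pow_mul]
    exact pow_le_pow_right₀ (by norm_num) (by omega)
  generalize (domain (bounds (topPlayer k).opp size k) (searchParam n k)).card = M at *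
  have h5 : iterationCost n size (topPlayer k).opp k (searchParam n k) ≤ 15 * k * n * M := by
    refine h2.trans ?_
    calc (2 * k + 4) * ((2 * n + 1) * M + 1) + 6 * (n + 1)
        ≤ (2 * k + 4) * ((2 * n + 1) * M + M) + 6 * (n + 1) * M := by
          have := Nat.le_mul_of_pos_right (6 * (n + 1)) h3
          gcongr
      _ = ((2 * k + 4) * (2 * n + 2) + 6 * (n + 1)) * M := by ring
      _ ≤ 15 * k * n * M := by
        gcongr
        nlinarith [Nat.mul_le_mul hk (show 3 ≤ n by omega)]
  calc (iterationCost n size (topPlayer k).opp k (searchParam n k) : ℝ)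
      ≤ 15 * k * n * M := by exact_mod_cast h5
    _ ≤ 15 * k * n * (3 * 3 ^ k * ((n : ℝ) / k) ^ bigStepGamma (k - 1)) := by
        gcongr
        exact h1.trans (by gcongr)
    _ = _ := by ring

theorem div_searchParam_le {n k : ℕ} (hk : 4 ≤ k) (hn : k ≤ n + 1) :
    ((n / (searchParam n k + 1) + 1 : ℕ) : ℝ) ≤ 4 * ((n : ℝ) / k) ^ (1 - searchExponent k) := by
  have hx := le_div_of_le_add_one hk hn
  have hx0 : 0 < (n : ℝ) / k := by linarith
  have hk' : (4 : ℝ) ≤ k := by exact_mod_cast hk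
  have h0 := searchExponent_nonneg hk
  have h1 := searchExponent_le_one hk
  have h2 := le_rpow_of_le (b := 1 - searchExponent k) hx (by linarith) (by linarith)
  have h3 : ((n / (searchParam n k + 1) : ℕ) : ℝ) ≤ 2 * ((n : ℝ) / k) ^ (1 - searchExponent k) := by
    -- If the cap at `n` is effective, the quotient is zero; otherwise the parameter is at least the
    -- uncapped real number.
    by_cases h : n < searchParam n k + 1
    · rw [Nat.div_eq_of_lt h]
      push_cast
      linarith
    refine Nat.cast_div_le.trans ((div_le_iff₀ (by positivity)).2 ?_)
    have h4 : (((k + 1) / 2 : ℕ) : ℝ) * ((n : ℝ) / k) ^ searchExponent k ≤ searchParam n k := by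
      refine Nat.ceil_le.1 ?_
      by_contra hc
      refine h ?_
      rw [searchParam] at hc ⊢
      omega
    have h5 : (k : ℝ) ≤ 2 * ((k + 1) / 2 : ℕ) := by
      exact_mod_cast (by omega : k ≤ 2 * ((k + 1) / 2))
    calc (n : ℝ) = k * (((n : ℝ) / k) ^ (1 - searchExponent k) *
          ((n : ℝ) / k) ^ searchExponent k) := by
          rw [← rpow_add hx0, sub_add_cancel, rpow_one]; field_simp
      _ ≤ 2 * ((k + 1) / 2 : ℕ) * (((n : ℝ) / k) ^ (1 - searchExponent k) *
          ((n : ℝ) / k) ^ searchExponent k) := by gcongr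
      _ = 2 * ((n : ℝ) / k) ^ (1 - searchExponent k) *
          (((k + 1) / 2 : ℕ) * ((n : ℝ) / k) ^ searchExponent k) := by ring
      _ ≤ 2 * ((n : ℝ) / k) ^ (1 - searchExponent k) * (searchParam n k + 1 : ℕ) := by
          gcongr
          push_cast
          linarith
  push_cast at h3 ⊢
  linarith

/-- Passing from `k - 1` to `k` in the denominator costs only a constant: `(1 + 1 / (k - 1)) ^ γ(k -
1)` is at most `exp 1`, since `γ(k - 1) ≤ k - 1`. -/
theorem div_pred_rpow_le {n k : ℕ} (hk : 4 ≤ k) :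
    ((n : ℝ) / (k - 1 : ℕ)) ^ bigStepGamma (k - 1) ≤
      3 * ((n : ℝ) / k) ^ bigStepGamma (k - 1) := by
  have h1 : (3 : ℝ) ≤ (k - 1 : ℕ) := by exact_mod_cast (by omega : 3 ≤ k - 1)
  have h2 : (k : ℝ) = (k - 1 : ℕ) + 1 := by exact_mod_cast (by omega : k = k - 1 + 1)
  have h3 := bigStepGamma_le (k := k - 1) (by omega)
  have h4 := le_bigStepGamma (k := k - 1) (by omega)
  generalize bigStepGamma (k - 1) = g at *
  rw [h2]
  generalize ((k - 1 : ℕ) : ℝ) = j at *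
  have h5 : (n : ℝ) / j = (1 + 1 / j) * (n / (j + 1)) := by field_simp
  rw [h5, mul_rpow (by positivity) (by positivity)]
  refine mul_le_mul_of_nonneg_right ?_ (by positivity)
  calc (1 + 1 / j) ^ g ≤ exp (1 / j) ^ g := by
        refine rpow_le_rpow (by positivity) ?_ (by linarith)
        linarith [add_one_le_exp (1 / j)]
    _ = exp (1 / j * g) := (exp_mul _ _).symm
    _ ≤ exp 1 := by
        refine exp_le_exp.2 ?_
        rw [one_div_mul_eq_div, div_le_one (by linarith)]
        linarith
    _ ≤ 3 := exp_one_lt_three.le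

theorem levelCost_three_le {n : ℕ} (size h : ℕ → ℕ) (hn : 1 ≤ n) :
    levelCost n size h 3 ≤ 68 * n ^ 2 := by
  rw [levelCost, if_pos le_rfl]
  have h1 := card_domain_bounds_le .even size 3 n
  rw [show (3 + shift .even) / 2 = 1 by simp [shift], Nat.choose_one_right] at h1
  have h2 : iterationCost n size .even 3 n ≤ _ := le_refl
    ((2 * (3 + 0) + 2) * ((2 * n + 1) * (domain (bounds .even size 3) n).card + 1) + 6 * (n + 1))
  refine h2.trans ?_
  calc _ ≤ (2 * (3 + 0) + 2) * ((2 * n + 1) * (n + 1) + 1) + 6 * (n + 1) := by gcongr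
    _ ≤ _ := by nlinarith

/-- This closes the induction in `solveCost_searchParam_le`: up to `4` times the power of `n / k`
iterations, each with factor `45 * k * 3 ^ k` from the search and `3 * 1000 ^ (k - 1)` from the
recursive call. -/
theorem mul_three_pow_le {k : ℕ} (hk : 4 ≤ k) :
    180 * k * 3 ^ k + 12 * 1000 ^ (k - 1) ≤ 1000 ^ k := by
  induction k, hk using Nat.le_induction with
  | base => norm_num
  | succ k hk ih =>
    obtain ⟨j, rfl⟩ : ∃ j, k = j + 1 := ⟨k - 1, by omega⟩
    simp only [Nat.add_sub_cancel, pow_succ] at *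
    generalize 1000 ^ j = a at *
    generalize 3 ^ j = b at *
    nlinarith [Nat.zero_le (j * b)]

theorem solveCost_searchParam_le {n k : ℕ} (size : ℕ → ℕ) (hk : 3 ≤ k) (hn : k ≤ n + 1) :
    (solveCost (levelCost n size (searchParam n)) (searchParam n) k n : ℝ) ≤
      1000 ^ k * (n * ((n : ℝ) / k) ^ bigStepGamma k) := by
  induction k, hk using Nat.le_induction with
  | base =>
    rw [solveCost, if_neg (by norm_num), if_pos le_rfl, bigStepGamma_three, rpow_one]
    refine (Nat.cast_le.2 (levelCost_three_le size _ (by omega))).trans ?_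
    push_cast
    nlinarith [sq_nonneg (n : ℝ)]
  | succ k hk ih =>
    have h1 := ih (by omega)
    have hk' : 4 ≤ k + 1 := by omega
    have h2 := solveCost_le_mul (levelCost n size (searchParam n)) (searchParam n) hk' (le_refl n)
    have h3 := div_searchParam_le hk' hn
    have h4 := levelCost_searchParam_le size hk' hn
    have h5 := div_pred_rpow_le (n := n) hk'
    have h6 := bigStepGamma_eq_sub hk'
    have h7 : (180 * (k + 1 : ℕ) * 3 ^ (k + 1) + 12 * 1000 ^ k : ℝ) ≤ 1000 ^ (k + 1) := by
      exact_mod_cast mul_three_pow_le hk'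
    have hx : 0 < (n : ℝ) / (k + 1 : ℕ) := by linarith [le_div_of_le_add_one hk' hn]
    rw [Nat.add_sub_cancel] at *
    rw [h6, rpow_add hx]
    generalize solveCost (levelCost n size (searchParam n)) (searchParam n) (k + 1) n = T at *
    generalize solveCost (levelCost n size (searchParam n)) (searchParam n) k n = T' at *
    generalize n / (searchParam n (k + 1) + 1) + 1 = N at *
    generalize levelCost n size (searchParam n) (k + 1) = L at *
    have hz : 0 ≤ ((n : ℝ) / (k + 1 : ℕ)) ^ (1 - searchExponent (k + 1)) := by positivity
    have hw : 0 ≤ ((n : ℝ) / (k + 1 : ℕ)) ^ bigStepGamma k := by positivity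
    generalize ((n : ℝ) / (k + 1 : ℕ)) ^ (1 - searchExponent (k + 1)) = z at *
    generalize ((n : ℝ) / (k + 1 : ℕ)) ^ bigStepGamma k = w at *
    calc (T : ℝ) ≤ N * (L + T') := by exact_mod_cast h2
      _ ≤ 4 * z * (45 * (k + 1 : ℕ) * 3 ^ (k + 1) * (n * w) + 1000 ^ k * (n * (3 * w))) := by
          gcongr
          exact h1.trans (by gcongr)
      _ = (180 * (k + 1 : ℕ) * 3 ^ (k + 1) + 12 * 1000 ^ k : ℝ) * (n * (w * z)) := by ring
      _ ≤ _ := by gcongr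

/-- The factor `1000 ^ k` is `(1000 ^ 3) ^ (k / 3)` and `k / 3 ≤ γ(k)`, so it disappears in the
constant `κ`. -/
theorem thousand_pow_mul_le {k : ℕ} {x : ℝ} (hk : 3 ≤ k) (hx : 0 ≤ x) :
    1000 ^ k * x ^ bigStepGamma k ≤ (1000 ^ 3 * x) ^ bigStepGamma k := by
  rw [mul_rpow (by positivity) hx]
  refine mul_le_mul_of_nonneg_right ?_ (by positivity)
  calc (1000 : ℝ) ^ k = (1000 ^ 3 : ℝ) ^ ((k : ℝ) / 3) := by
        rw [← rpow_natCast, ← rpow_natCast, ← rpow_mul (by norm_num)]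
        congr 1
        push_cast
        ring
    _ ≤ _ := rpow_le_rpow_of_exponent_le (by norm_num) (le_bigStepGamma hk)

open Classical in
/-- The parameter function: the better of the two choices for `n` vertices and `c₀` priorities. -/
noncomputable def dominionParam (n c₀ k : ℕ) : ℕ :=
  if (n : ℝ) * (1000 ^ 3 * (n : ℝ) / c₀) ^ bigStepGamma c₀ ≤ (n : ℝ) ^ (15 * √(n : ℝ)) then
    searchParam n k
  else ⌈√(n : ℝ)⌉₊

theorem dominionParam_mem {n : ℕ} (c₀ k : ℕ) (hn : 1 ≤ n) :
    1 ≤ dominionParam n c₀ k ∧ dominionParam n c₀ k ≤ n := by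
  unfold dominionParam
  split_ifs
  · exact ⟨le_max_left _ _, max_le hn (min_le_left _ _)⟩
  · exact ceil_sqrt_mem hn

theorem solveCost_dominionParam_le {n c : ℕ} (size : ℕ → ℕ) (hc : 3 ≤ c) (hn : c ≤ n + 1) :
    (solveCost (levelCost n size (dominionParam n c)) (dominionParam n c) c n : ℝ) ≤
      min (1 * ((n : ℝ) * (1000 ^ 3 * (n : ℝ) / c) ^ bigStepGamma c))
        ((n : ℝ) ^ (15 * √(n : ℝ))) := by
  rw [one_mul]
  by_cases h : (n : ℝ) * (1000 ^ 3 * (n : ℝ) / c) ^ bigStepGamma c ≤ (n : ℝ) ^ (15 * √(n : ℝ))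
  · have h1 : dominionParam n c = searchParam n := funext fun k => if_pos h
    rw [min_eq_left h, h1]
    refine (solveCost_searchParam_le size hc hn).trans ?_
    rw [mul_left_comm, mul_div_assoc]
    gcongr
    exact thousand_pow_mul_le hc (by positivity)
  · have h1 : dominionParam n c = fun _ => ⌈√(n : ℝ)⌉₊ := funext fun k => if_neg h
    rw [min_eq_right (not_le.1 h).le, h1]
    exact solveCost_le_rpow_sqrt (by omega) hn

end BigStep

/-! ### The number of stored sets -/

namespace BigStep

open Reg

/-- The sets that the algorithm stores for games with `c` priorities. -/
def registers (size : ℕ → ℕ) (c : ℕ) : Finset Reg :=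
  [vert, own .even, own .odd, top, cur, old, cmp, agree, step, esc, aux, att, dom].toFinset ∪
    (Finset.range (c + 1)).biUnion fun i =>
      {prio i, all i, game i, win .even i, win .odd i} ∪
        (Finset.range (size i + size (i - 1) + 1)).image (coord i)

theorem vert_mem_registers (size : ℕ → ℕ) (c : ℕ) : vert ∈ registers size c :=
  Finset.mem_union_left _ (List.mem_toFinset.2 (.head _))

theorem mem_registers {size : ℕ → ℕ} {c i : ℕ} {r : Reg} (hi : i ≤ c)
    (hr : r ∈ ({prio i, all i, game i, win .even i, win .odd i} : Finset Reg)) :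
    r ∈ registers size c :=
  Finset.mem_union_right _ (Finset.mem_biUnion.2
    ⟨i, Finset.mem_range.2 (by omega), Finset.mem_union_left _ hr⟩)

theorem hasSolveRegs_registers (size : ℕ → ℕ) (c : ℕ) :
    HasSolveRegs (registers size c) size c where
  aux r hr := by
    refine Finset.mem_union_left _ (List.mem_toFinset.2 ?_)
    cases r with
    | own z => cases z <;> simp
    | top | cur | old | cmp | agree | step | esc | aux | att | dom => simp
    | _ => exact hr.elim
  all i hi := mem_registers hi (by simp)
  game i hi := mem_registers hi (by simp)
  win z i hi := mem_registers hi (by cases z <;> simp)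
  prio i hi := mem_registers hi.le (by simp)
  coord y i hi j hj x hx := by
    have h1 := j.2
    have h2 : x ≤ size (j - shift y) := by simpa [bounds, hj] using hx
    simp only [registers, Finset.mem_union, Finset.mem_biUnion, Finset.mem_image, Finset.mem_range]
    -- The two players use index `j` for the priorities `j` and `j - 1`, respectively; for this
    -- reason `registers` admits index `c` and has entries up to `size j + size (j - 1)`.
    refine .inr ⟨j, ?_, .inr ⟨x, ?_, rfl⟩⟩
    · cases y <;> simp only [shift] at h1 <;> omega
    · cases y <;> simp only [shift, Nat.sub_zero] at h2 <;> omega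

theorem card_registers_le (size : ℕ → ℕ) (c : ℕ) :
    (registers size c).card ≤ 13 + ∑ i ∈ Finset.range (c + 1), (6 + size i + size (i - 1)) := by
  refine (Finset.card_union_le _ _).trans (Nat.add_le_add (List.toFinset_card_le _) ?_)
  refine Finset.card_biUnion_le.trans (Finset.sum_le_sum fun i _ => ?_)
  refine (Finset.card_union_le _ _).trans ?_
  have h1 := Finset.card_image_le (s := Finset.range (size i + size (i - 1) + 1)) (f := coord i)
  have h2 := Finset.card_le_five (a := Reg.prio i) (b := Reg.all i) (c := game i)
    (d := win .even i) (e := win .odd i)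
  rw [Finset.card_range] at h1
  omega

end BigStep

/-! ### The whole algorithm on the input game -/

namespace ParityGame

variable {V : Type*} {c : ℕ} (G : ParityGame V c)

theorem sum_ncard_prioSet_le [Fintype V] (l : ℕ) :
    ∑ i ∈ Finset.range l, (G.prioSet i).ncard ≤ Fintype.card V := by
  classical
  have h : ∀ i, (G.prioSet i).ncard = (Finset.univ.filter fun v => (G.prio v : ℕ) = i).card :=
    fun i => by rw [← Set.ncard_coe_finset]; congr 1; ext v; simp [prioSet]
  simp_rw [h]
  rw [← Finset.card_biUnion fun i _ j _ hij => Finset.disjoint_filter.2 fun v _ hi hj =>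
    hij (hi.symm.trans hj)]
  exact Finset.card_le_univ _

/-- The positive priorities are attained at distinct vertices; only priority `0` may be absent. -/
theorem le_card_add_one [Fintype V] [Nonempty V]
    (h : ∀ i : Fin c, 0 < (i : ℕ) → ∃ v, G.prio v = i) : c ≤ Fintype.card V + 1 := by
  cases c with
  | zero => omega
  | succ c =>
    choose f hf using fun i : Fin c => h i.succ (Nat.succ_pos _)
    have := Fintype.card_le_of_injective f fun i j hij =>
      Fin.succ_injective _ ((hf i).symm.trans ((congrArg G.prio hij).trans (hf j)))
    rw [Fintype.card_fin] at this
    omega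

theorem card_registers_prioSet_le [Fintype V] [Nonempty V] (hc : c ≤ Fintype.card V + 1) :
    (BigStep.registers (fun i => (G.prioSet i).ncard) c).card ≤ 34 * Fintype.card V := by
  refine (BigStep.card_registers_le _ _).trans ?_
  have h1 := G.sum_ncard_prioSet_le (c + 1)
  have h2 : ∑ i ∈ Finset.range (c + 1), (G.prioSet (i - 1)).ncard ≤ 2 * Fintype.card V := by
    rw [Finset.sum_range_succ']
    have h3 := G.sum_ncard_prioSet_le c
    have h4 := G.sum_ncard_prioSet_le 1
    simp only [Finset.sum_range_one, Nat.add_sub_cancel, Nat.zero_sub] at *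
    omega
  have h5 : 0 < Fintype.card V := Fintype.card_pos
  -- With `c ≤ n + 1` the total is at most `13 + 6 * (n + 2) + 3 * n = 9 * n + 25`, which is at most
  -- `34 * n`.
  simp only [Finset.sum_add_distrib, Finset.sum_const, Finset.card_range, smul_eq_mul]
  omega

open Reg in
theorem ensures_symbolicBigStep [Fintype V] [Nonempty V] (h : ℕ → ℕ) :
    Prog.Ensures G (BigStep.registers (fun i => (G.prioSet i).ncard) c)
      (symbolicBigStep (Fintype.card V) c (fun i => (G.prioSet i).ncard) h) G.input
      fun _ m t => (∀ z, m (win z c) = G.winningSet z) ∧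
        t ≤ BigStep.solveCost (BigStep.levelCost (Fintype.card V) (fun i => (G.prioSet i).ncard) h)
          h c (Fintype.card V) := by
  have hU := BigStep.hasSolveRegs_registers (fun i => (G.prioSet i).ncard) c
  have hc : 1 ≤ c := (Nat.zero_le _).trans_lt (G.prio (Classical.arbitrary V)).2
  rw [symbolicBigStep, Prog.ensures_bind, Prog.ensures_copy]
  refine ⟨⟨hU.all c le_rfl, BigStep.vert_mem_registers _ _⟩, ?_⟩
  obtain ⟨m, hm⟩ : ∃ m, m = Function.update G.input (all c) (G.input vert) := ⟨_, rfl⟩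
  rw [← hm]
  have hall : m (all c) = Set.univ := by simp [hm, input]
  refine (BigStep.ensures_solve (fun _ => rfl) hc hU (m := m)
    ⟨fun z => by simp [hm, input], fun i => by simp [hm, input]⟩
    (fun v _ => ?_) fun v _ => (G.prio v).2).mono ?_
  · obtain ⟨w, hw⟩ := G.exists_edge v
    exact ⟨w, by simp [hall], hw⟩
  · rintro - m' t ⟨⟨h1, h2, -⟩, h3⟩
    rw [hall] at h1 h2 h3
    -- The computed dominions lie in the disjoint winning sets and cover the game, so both
    -- inclusions are equalities.
    have h4 := fun z => (h1 z).subset_winningSet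
    refine ⟨fun z => (h4 z).antisymm fun v hv => ?_, by simpa using h3⟩
    obtain ⟨z', hz'⟩ := h2 v trivial
    have h5 := Set.disjoint_left.1 G.disjoint_winningSet
    have h6 := h4 z' hz'
    cases z <;> cases z'
    · exact hz'
    · exact absurd h6 (h5 hv)
    · exact absurd hv (h5 h6)
    · exact hz'

end ParityGame

theorem mainTheorem2 :
    ∃ (h : ℕ → ℕ → ℕ → ℕ) (κ K C : ℝ) (S : ℕ),
      0 < κ ∧
      (∀ n c₀ c : ℕ, 1 ≤ n → 1 ≤ h n c₀ c ∧ h n c₀ c ≤ n) ∧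
      ∀ (V : Type*) [Fintype V] [Nonempty V] (c : ℕ) (G : ParityGame V c),
        (∀ i : Fin c, 0 < (i : ℕ) → ∃ v, G.prio v = i) →
        ∃ (U : Finset Reg) (m : Reg → Set V) (t : ℕ),
          Prog.Run G U
            (symbolicBigStep (Fintype.card V) c (fun i => (G.prioSet i).ncard)
              (h (Fintype.card V) c))
            G.input () m t ∧
          m (.win .even c) = G.winningSet .even ∧
          m (.win .odd c) = G.winningSet .odd ∧
          U.card ≤ S * Fintype.card V ∧
          (3 ≤ c →
            (t : ℝ) ≤ min
              (K * ((Fintype.card V : ℝ) * (κ * (Fintype.card V : ℝ) / (c : ℝ)) ^ bigStepGamma c))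
              ((Fintype.card V : ℝ) ^ (C * √(Fintype.card V : ℝ)))) ∧
          (c < 3 → 2 ≤ Fintype.card V →
            (t : ℝ) ≤ (Fintype.card V : ℝ) ^ (C * √(Fintype.card V : ℝ))) := by
  -- The values are `κ = 1000 ^ 3` from `thousand_pow_mul_le`, `K = 1`, `C = 15` from the bounds
  -- with `√n`, and `S = 34` from the count of registers.
  refine ⟨BigStep.dominionParam, 1000 ^ 3, 1, 15, 34, by norm_num,
    fun n c₀ c hn => BigStep.dominionParam_mem c₀ c hn, fun V _ _ c G hG => ?_⟩
  have hc := G.le_card_add_one hG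
  obtain ⟨_, m, t, hrun, hwin, ht⟩ :=
    G.ensures_symbolicBigStep (BigStep.dominionParam (Fintype.card V) c)
  refine ⟨_, m, t, hrun, hwin .even, hwin .odd, G.card_registers_prioSet_le hc, fun h3 => ?_,
    fun h3 hn => ?_⟩
  · exact (Nat.cast_le.2 ht).trans (BigStep.solveCost_dominionParam_le _ h3 hc)
  · exact (Nat.cast_le.2 ht).trans (BigStep.solveCost_le_rpow_sqrt_of_le_three hn h3.le)
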